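/- **Setting.** For a finite set $S$ in a metric space $\mathcal M$ let $B_S(q,s)=\{p\in S: \mathrm{dist}(p,q)\le s\}$ and $n(q,s)=|B_S(q,s)|$. A *monotone $(c,r,p_1,p_2)$-LSH family* on $\mathcal M$ is a random function $h$ from $\mathcal M$ to a (linearly ordered) set of buckets such that $\Pr[h(x)=h(y)]\ge p_1$ if $\mathrm{dist}(x,y)\le r$, $\Pr[h(x)=h(y)]\le p_2$ if $\mathrm{dist}(x,y)\ge cr$, and $\Pr[h(x)=h(y)]$ is non-increasing in $\mathrm{dist}(x,y)$. Fix $c>1$ and functions $\rho,a,b$ with $a(c')>0$ and $b(c')<1$ for $c'\in(1,c]$. Let $r>0$ and let $\mathcal M$ be a metric space such that for all $c'\in(1,c]$ and $r'\in[r,cr]$ it has a monotone $(c',r',p_1,p_2)$-LSH family for some $0<p_2<p_1<1$ with $p_1\ge a(c')$, $p_2\le b(c')$ and $\rho(c')=\log(1/p_1)/\log(1/p_2)$. Let one distance computation or one hash evaluation cost $d\ge 1$ steps (the "dimension"). **Model.** A randomized preprocessing stage builds from $S$ a read-only data structure of memory cells, each holding a $w$-bit word, a point, a radius, or a hash function of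 the given families; its *space* is the number of cells. A query is answered by a program for a randomized word RAM with word length $w$, run on the data structure, the query point, fresh random choices and cleared working memory; word operations cost one step, comparing the distance between a stored point and the query with a stored radius costs $d$ steps, and comparing (in the order on buckets) the hash values of a stored point and the query costs $2d$ steps. **Relaxed fairness.** For a query $q$, a law of the answer is *relaxed fair with failure probability $\delta$* if it is obtained by drawing either a radius $r'$ or "no radius" from some distribution and then answering with a uniformly random point of $B_S(q,r')$ (or $\perp$ if no radius was drawn or this ball is empty), where: if $B_S(q,r)\ne\emptyset$, then $r'\in[r,cr]$ always and no radius is drawn with probability at most $\delta$; if $B_S(q,r)=\emptyset$, then $r'\in(r,cr]$ always. The algorithm *solves the relaxed fair $(c,r)$-ANN problem* for $Q$ queries with failure probability $\delta$ if for every sequence of at most $Q$ queries fixed independently of the preprocessing randomness, with probability at least $1-\delta$ over preprocessing the following holds: in every round, the conditional law of the answer given the data structure and all previous answers is one relaxed fair law with failure probability $\delta$, which does not depend on the previous answers. **Theorem.** Suppose that $\bar k\ge 1$ minimizes $\max\{\rho(c^{1/k}),1/k\}$ over the integers $k\ge1$, and let $\beta=\max\{\rho(c^{1/\bar k}),1/\bar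 k\}$. There are a single query program and constants $C,e$, depending only on $c,\rho,a,b,\bar k$, such that for all $\mathcal M,d,r$ and LSH families as above and every $S\subset\mathcal M$ with $|S|=n\ge1$ the following holds. 1. For every $Q\ge1$ and $\delta\in(0,1)$ there are a word length $w\le C(1+\log(nQ/\delta))$ and a randomized preprocessing of $S$ with which the program solves the relaxed fair $(c,r)$-ANN problem for $Q$ queries with failure probability $\delta$. The data structure always has space at most $C\,n^{1+\rho(c^{1/\bar k})}(1+\log(nQ/\delta))^e=\widetilde O(n^{1+\rho(c^{1/\bar k})})$, and every query always takes at most $C\,d\,n^{\beta}(1+\log(nQ/\delta))^e=\widetilde O(d\,n^{\beta})$ steps. 2. For every $q\in\mathcal M$ with $B_S(q,r)\neq\emptyset$ there is $i\in\{0,\dots,\bar k-1\}$ with $n(q,rc^{(i+1)/\bar k})/n(q,rc^{i/\bar k})\le n^{1/\bar k}$. -/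

import Mathlib

open MeasureTheory

universe u v

/-! ### Data sets and balls -/

open Classical in
/-- `B_S(q, s)`: the points of the data set `S` at distance at most `s` from `q`. -/
noncomputable def ballIn {M : Type u} [MetricSpace M] (S : Finset M) (q : M) (s : ℝ) : Finset M :=
  S.filter (fun p => dist p q ≤ s)

/-! ### Locality-sensitive hashing -/

/-- A family of hash functions on `M`: a probability space of seeds, each seed giving a function
from `M` to a set of buckets. Bucket names can be compared in some linear order, as is needed to
look a bucket up in a table. -/
structure HashFamily (M : Type u) where
  Seed : Type v
  [measurableSeed : MeasurableSpace Seed]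
  law : Measure Seed
  [isProbabilityLaw : IsProbabilityMeasure law]
  Bucket : Type v
  [orderBucket : LinearOrder Bucket]
  hash : Seed → M → Bucket
  measurableSet_collision : ∀ x y, MeasurableSet {s | hash s x = hash s y}

attribute [instance] HashFamily.measurableSeed HashFamily.isProbabilityLaw
  HashFamily.orderBucket

/-- The probability that a random member of the family puts `x` and `y` into one bucket. -/
noncomputable def HashFamily.collisionProb {M : Type u} (H : HashFamily.{u, v} M) (x y : M) : ℝ :=
  H.law.real {s | H.hash s x = H.hash s y}

/-- `H` is a monotone `(c, r, p₁, p₂)`-LSH family. -/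
structure IsMonotoneLSH {M : Type u} [MetricSpace M] (H : HashFamily.{u, v} M)
    (c r p₁ p₂ : ℝ) : Prop where
  near : ∀ x y : M, dist x y ≤ r → p₁ ≤ H.collisionProb x y
  far : ∀ x y : M, c * r ≤ dist x y → H.collisionProb x y ≤ p₂
  monotone : ∀ x y x' y' : M, dist x y ≤ dist x' y' →
    H.collisionProb x' y' ≤ H.collisionProb x y

/-- The metric space `M` is equipped with LSH families with exponent `ρ`: for every approximation
factor `c' ∈ (1, c]` and every radius `r' ∈ [r, c r]`, the family `F c' r'` is a monotone
`(c', r', p₁, p₂)`-LSH family with `0 < p₂ < p₁ < 1` and `ρ(c') = log (1/p₁) / log (1/p₂)`.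
The numbers `a c'` and `b c'` bound `p₁` away from `0` and `p₂` away from `1`, so that constants
may depend on them and not on the space, its dimension or the radius. -/
def LSHEquipped {M : Type u} [MetricSpace M] (F : ℝ → ℝ → HashFamily.{u, v} M) (c r : ℝ)
    (ρ a b : ℝ → ℝ) : Prop :=
  ∀ c' ∈ Set.Ioc 1 c, ∀ r' ∈ Set.Icc r (c * r), ∃ p₁ p₂ : ℝ,
    0 < p₂ ∧ p₂ < p₁ ∧ p₁ < 1 ∧ a c' ≤ p₁ ∧ p₂ ≤ b c' ∧
      ρ c' = Real.log (1 / p₁) / Real.log (1 / p₂) ∧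
      IsMonotoneLSH (F c' r') c' r' p₁ p₂

/-! ### The machine model

A randomized word RAM with word length `w`. The preprocessing stage leaves a read-only data
structure in memory; a query program works on it, on the query point, and on a working memory of
words that is cleared before each query. Points, hash functions and radii are opaque objects which
the program can only use through distance tests and hash evaluations. -/

/-- What preprocessing stores: words, points of the space, hash functions that are members of the
available families (`⟨(c', r'), s⟩` is the member of `F c' r'` with seed `s`), and radii. -/
structure DataStructure {M : Type u} (F : ℝ → ℝ → HashFamily.{u, v} M) where
  words : List ℕ
  points : List M
  hashes : List (Σ x : ℝ × ℝ, (F x.1 x.2).Seed)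
  radii : List ℝ

/-- The space: the number of memory cells, each holding a word, a point, a hash function or a
radius. -/
def DataStructure.size {M : Type u} {F : ℝ → ℝ → HashFamily.{u, v} M}
    (D : DataStructure F) : ℕ :=
  D.words.length + D.points.length + D.hashes.length + D.radii.length

/-- Binary word operations. -/
inductive WordOp where
  | add | sub | mul | div | mod | lt | eq

/-- The value of a word operation, before reduction to word length. Subtraction is truncated at
zero, division by zero gives zero, comparisons give one or zero. -/
def WordOp.eval : WordOp → ℕ → ℕ → ℕ
  | .add, x, y => x + y
  | .sub, x, y => x - y
  | .mul, x, y => x * y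
  | .div, x, y => x / y
  | .mod, x, y => x % y
  | .lt, x, y => if x < y then 1 else 0
  | .eq, x, y => if x = y then 1 else 0

/-- Query programs. Arguments are addresses of cells of the working memory, except for the value
`n` in `const i n`. -/
inductive Prog where
  /-- do nothing -/
  | skip
  /-- `mem[i] := n` -/
  | const (i n : ℕ)
  /-- `mem[i] := mem[j] op mem[l]` -/
  | arith (op : WordOp) (i j l : ℕ)
  /-- `mem[i] := mem[mem[j]]` -/
  | load (i j : ℕ)
  /-- `mem[mem[i]] := mem[j]` -/
  | store (i j : ℕ)
  /-- `mem[i] := words[mem[j]]` -/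
  | read (i j : ℕ)
  /-- `mem[i] :=` a fresh uniformly random element of `{0, …, mem[j]}` -/
  | rand (i j : ℕ)
  /-- `mem[i] := 1` if the distance of `points[mem[j]]` to the query is at most `radii[mem[l]]`,
  and `0` if not -/
  | near (i j l : ℕ)
  /-- `mem[i] := 0, 1, 2` according to whether the bucket of `points[mem[j]]` under
  `hashes[mem[l]]` is smaller than, equal to, or larger than the bucket of the query -/
  | hash (i j l : ℕ)
  /-- first `P`, then `P'` -/
  | seq (P P' : Prog)
  /-- `P` if `mem[i] ≠ 0`, and `P'` otherwise -/
  | ite (i : ℕ) (P P' : Prog)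
  /-- repeat `P` as many times as the value of `mem[i]` at the start of the loop -/
  | loop (i : ℕ) (P : Prog)

/-- The working memory. -/
abbrev Mem := ℕ → ℕ

/-- Run `f` (which returns a new memory and a number of steps) `n` times in a row, with one extra
step for each round. -/
noncomputable def repeatSteps (f : Mem → PMF (Mem × ℕ)) : ℕ → Mem → PMF (Mem × ℕ)
  | 0, m => PMF.pure (m, 1)
  | n + 1, m => (f m).bind fun x => (repeatSteps f n x.1).map fun y => (y.1, x.2 + y.2 + 1)

/-- Result of a distance test; indices out of range give `0`. -/
noncomputable def nearValue {M : Type u} [MetricSpace M] {F : ℝ → ℝ → HashFamily.{u, v} M}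
    (D : DataStructure F) (q : M) (j l : ℕ) : ℕ :=
  match D.points[j]?, D.radii[l]? with
  | some p, some s => open Classical in if dist p q ≤ s then 1 else 0
  | _, _ => 0

/-- Result of a hash comparison; indices out of range give `0`. -/
noncomputable def hashValue {M : Type u} {F : ℝ → ℝ → HashFamily.{u, v} M}
    (D : DataStructure F) (q : M) (j l : ℕ) : ℕ :=
  match D.points[j]?, D.hashes[l]? with
  | some p, some ⟨x, s⟩ =>
    if (F x.1 x.2).hash s p < (F x.1 x.2).hash s q then 0
    else if (F x.1 x.2).hash s p = (F x.1 x.2).hash s q then 1 else 2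
  | _, _ => 0

/-- Execution of a program on the data structure `D` and the query `q`, from a given working
memory: the joint law of the final working memory and of the number of steps. Word instructions
take one step, a distance computation takes `d` steps, and a hash comparison, which evaluates a
hash function at two points, takes `2 d` steps. All stored values are reduced modulo `2 ^ w`. -/
noncomputable def Prog.exec {M : Type u} [MetricSpace M] {F : ℝ → ℝ → HashFamily.{u, v} M}
    (w d : ℕ) (D : DataStructure F) (q : M) : Prog → Mem → PMF (Mem × ℕ)
  | .skip, m => PMF.pure (m, 1)
  | .const i n, m => PMF.pure (Function.update m i (n % 2 ^ w), 1)
  | .arith op i j l, m => PMF.pure (Function.update m i (op.eval (m j) (m l) % 2 ^ w), 1)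
  | .load i j, m => PMF.pure (Function.update m i (m (m j)), 1)
  | .store i j, m => PMF.pure (Function.update m (m i) (m j), 1)
  | .read i j, m => PMF.pure (Function.update m i (D.words.getD (m j) 0 % 2 ^ w), 1)
  | .rand i j, m => (PMF.uniformOfFintype (Fin (m j + 1))).map
      fun x => (Function.update m i (x.val % 2 ^ w), 1)
  | .near i j l, m => PMF.pure (Function.update m i (nearValue D q (m j) (m l) % 2 ^ w), d)
  | .hash i j l, m => PMF.pure (Function.update m i (hashValue D q (m j) (m l) % 2 ^ w), 2 * d)
  | .seq P P', m => (P.exec w d D q m).bind fun x =>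
      (P'.exec w d D q x.1).map fun y => (y.1, x.2 + y.2)
  | .ite i P P', m =>
      ((if m i ≠ 0 then P.exec w d D q m else P'.exec w d D q m)).map fun y => (y.1, y.2 + 1)
  | .loop i P, m => repeatSteps (P.exec w d D q) (m i) m

/-- The query procedure: start with all working cells equal to zero. -/
noncomputable def Prog.run {M : Type u} [MetricSpace M] {F : ℝ → ℝ → HashFamily.{u, v} M}
    (P : Prog) (w d : ℕ) (D : DataStructure F) (q : M) : PMF (Mem × ℕ) :=
  P.exec w d D q (fun _ => 0)

/-- The answer left in cell `0`: the value `0` stands for `⊥` (here `none`), and the value `j + 1`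
for the stored point number `j`. -/
def readAnswer {M : Type u} {F : ℝ → ℝ → HashFamily.{u, v} M} (D : DataStructure F)
    (m : Mem) : Option M :=
  if m 0 = 0 then none else D.points[m 0 - 1]?

/-- The law of the list of answers to a list of queries that are asked one after the other to the
data structure `D`; each query uses fresh random choices. -/
noncomputable def Prog.session {M : Type u} [MetricSpace M] {F : ℝ → ℝ → HashFamily.{u, v} M}
    (P : Prog) (w d : ℕ) (D : DataStructure F) : List M → PMF (List (Option M))
  | [] => PMF.pure []
  | q :: qs => (P.run w d D q).bind fun x =>
      (P.session w d D qs).map fun l => readAnswer D x.1 :: l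

/-! ### Relaxed fairness -/

open Classical in
/-- A uniformly random point of `B_S(q, r')`; `⊥` if there is none or if no radius is given. -/
noncomputable def uniformAnswer {M : Type u} [MetricSpace M] (S : Finset M) (q : M) :
    Option ℝ → PMF (Option M)
  | none => PMF.pure none
  | some r' =>
    if h : (ballIn S q r').Nonempty then (PMF.uniformOfFinset (ballIn S q r') h).map some
    else PMF.pure none

/-- `ν` is a relaxed fair law for the answer to `q`: it arises by choosing a random radius `r'`
(or no radius) according to some law `R` and then answering with a uniformly random point of
`B_S(q, r')` (or with `⊥`). If `B_S(q, r)` is non-empty, then `r' ∈ [r, c r]`, and no radius is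
chosen with probability at most `δ`; if it is empty, then `r' ∈ (r, c r]`. -/
def RelaxedFairLaw {M : Type u} [MetricSpace M] (S : Finset M) (c r δ : ℝ) (q : M)
    (ν : PMF (Option M)) : Prop :=
  ∃ R : PMF (Option ℝ), ν = R.bind (uniformAnswer S q) ∧
    ((ballIn S q r).Nonempty →
      R none ≤ ENNReal.ofReal δ ∧ ∀ r', some r' ∈ R.support → r' ∈ Set.Icc r (c * r)) ∧
    (¬ (ballIn S q r).Nonempty → ∀ r', some r' ∈ R.support → r' ∈ Set.Ioc r (c * r))

/-- Relaxed fairness of the whole interaction on the data structure `D`: in every round, the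
conditional law of the answer given the transcript `T` of all earlier answers is one relaxed fair
law, whatever `T` is. -/
def RelaxedFairSession {M : Type u} [MetricSpace M] {F : ℝ → ℝ → HashFamily.{u, v} M}
    (P : Prog) (w d : ℕ) (D : DataStructure F) (S : Finset M) (c r δ : ℝ) (qs : List M) : Prop :=
  ∀ (past : List M) (q : M) (later : List M), qs = past ++ q :: later →
    ∃ ν : PMF (Option M), RelaxedFairLaw S c r δ q ν ∧
      ∀ (T : List (Option M)) (x : Option M),
        P.session w d D (past ++ [q]) (T ++ [x]) = P.session w d D past T * ν x

/-- With the query program `P` on words of length `w`, the random data structure `D` (built from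
`S` with setup randomness `ω` of law `μ`) solves the relaxed fair `(c, r)`-ANN problem for `Q`
queries with failure probability `δ`: for all sequences of at most `Q` queries that are fixed
independently of the setup randomness, the interaction is relaxed fair with probability at least
`1 - δ` over the setup. -/
def SolvesRelaxedFairANN {M : Type u} [MetricSpace M] {F : ℝ → ℝ → HashFamily.{u, v} M}
    {Ω : Type v} [MeasurableSpace Ω] (μ : Measure Ω) (D : Ω → DataStructure F)
    (P : Prog) (w d : ℕ) (S : Finset M) (c r : ℝ) (Q : ℕ) (δ : ℝ) : Prop :=
  ∀ qs : List M, qs.length ≤ Q →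
    μ {ω | ¬ RelaxedFairSession P w d (D ω) S c r δ qs} ≤ ENNReal.ofReal δ

/-!
Let `c' = c ^ (1 / k)`, and call `r c ^ (i / k)` with `i < k` the radius of level `i`. A sequence of
blocks is built, `R` of them for each level, where `R` is proportional to `ℓ = 1 + log (n Q / δ)`.
A block is an ordinary LSH structure for its radius `s` and the factor `c'`: it has `L` tables, each
of them the list of all points of `S` sorted by the concatenation of `K` independent hash functions,
so that the bucket of a query in a table is an interval that binary search finds.

*Query.* The blocks are tried in turn until one of them answers. In a block, the program
repeatedly draws a uniformly random entry of the multiset union of the query's buckets. An entry is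
accepted if its point is within distance `s` and its table is the first one where this point
collides with the query. If the tables cover the ball, that is if every near point collides
somewhere, then every near point owns exactly one accepted entry, so that an accepted point is
uniform in the ball (`Layout.Covered`, `Layout.Fits.fairFrom_queryProg`). A block has a budget of
`B` units, a failed trial costs one unit for a point that is not near, and a number of units
proportional to the length of the search for the first collision for a near point. A trial that has
been started is always finished, since to interrupt a trial would favour points with an early first
collision; hence fairness is exact and the budget only influences the probability of no answer.

*Failure.* A potential argument bounds the failure probability of a block by the total cost of the
bucket entries divided by `B` times the number of near points (`Layout.Fits.expect_failInd_le`). The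
expected total cost is at most `2 L` per near point, since `∑ π (1 - π) ^ s ≤ 1`; it is `L π` per
point between distances `s` and `c' s`, where `π` is the least collision probability of near
points, which by monotonicity bounds that of farther points; and it is `L / n` per far point
(`lintegral_tableCost_ball_le`). The `k` growth factors of the balls from one level to the next
have product at most `n`, so on one level the ball of radius `c' s` is at most `n ^ (1 / k)` times as
large as the ball of radius `s` (`exists_slow_growth`). With `L π` close to `Λ = 9 k ℓ` and `B` of
order `L + n ^ (1 / k) Λ`, a block of that level fails with mean probability at most `1 / 2`. The
blocks are independent, so the mean of the product over the `R` blocks of that level is at most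
`2 ^ (-R)`, and by Markov's inequality the conditional failure probability given the data structure
exceeds `δ` only rarely (`seedsLaw_prod_gt_le`). Similarly `L π ≥ Λ` makes all near points covered
except with probability exponentially small in `Λ` (`tableLaw_not_covered_le`). A union bound over
the queries finishes the probabilistic part (`GoodLayout.solves`).

*Resources.* Since `π` is at least a constant times `n ^ (-ρ)`, there are `Õ(n ^ ρ)` tables; the
budget is `Õ(n ^ β)` because `β = max ρ (1 / k)`. The program is analysed with a weakest
precondition calculus for its deterministic parts (`wp_sound`), and with expectations of functions of
the final memory for the random ones (`FairFrom`).
-/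

/-! ### A weakest-precondition calculus for query programs -/

section Logic

theorem hashValue_le_two {M : Type u} {F : ℝ → ℝ → HashFamily.{u, v} M} (D : DataStructure F)
    (q : M) (j l : ℕ) : hashValue D q j l ≤ 2 := by
  unfold hashValue
  split
  · split
    · simp
    · split <;> simp
  · simp

variable {M : Type u} [MetricSpace M] {F : ℝ → ℝ → HashFamily.{u, v} M}

/-- `n` rounds of a predicate transformer, with the step count of a loop. -/
def wpRep (f : Mem → (Mem → ℕ → Prop) → Prop) : ℕ → Mem → (Mem → ℕ → Prop) → Prop
  | 0, m, Q => Q m 1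
  | n + 1, m, Q => f m fun m1 s1 => wpRep f n m1 fun m2 s2 => Q m2 (s1 + s2 + 1)

/-- Weakest precondition: `wp w d D q P m Q` guarantees that every run of `P` from `m` ends in a
memory and with a step count that satisfy `Q`. Additions, multiplications, constants and reads
come with the obligation that no reduction modulo `2 ^ w` takes place; the other instructions
cannot overflow if the memory consists of words. -/
def wp (w d : ℕ) (D : DataStructure F) (q : M) : Prog → Mem → (Mem → ℕ → Prop) → Prop
  | .skip, m, Q => Q m 1
  | .const i n, m, Q => n < 2 ^ w ∧ Q (Function.update m i n) 1
  | .arith .add i j l, m, Q => m j + m l < 2 ^ w ∧ Q (Function.update m i (m j + m l)) 1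
  | .arith .mul i j l, m, Q => m j * m l < 2 ^ w ∧ Q (Function.update m i (m j * m l)) 1
  | .arith .sub i j l, m, Q => Q (Function.update m i (m j - m l)) 1
  | .arith .div i j l, m, Q => Q (Function.update m i (m j / m l)) 1
  | .arith .mod i j l, m, Q => Q (Function.update m i (m j % m l)) 1
  | .arith .lt i j l, m, Q => Q (Function.update m i (if m j < m l then 1 else 0)) 1
  | .arith .eq i j l, m, Q => Q (Function.update m i (if m j = m l then 1 else 0)) 1
  | .load i j, m, Q => Q (Function.update m i (m (m j))) 1
  | .store i j, m, Q => Q (Function.update m (m i) (m j)) 1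
  | .read i j, m, Q => D.words.getD (m j) 0 < 2 ^ w ∧
      Q (Function.update m i (D.words.getD (m j) 0)) 1
  | .rand i j, m, Q => ∀ u ≤ m j, Q (Function.update m i u) 1
  | .near i j l, m, Q => Q (Function.update m i (nearValue D q (m j) (m l))) d
  | .hash i j l, m, Q => Q (Function.update m i (hashValue D q (m j) (m l))) (2 * d)
  | .seq P P', m, Q => wp w d D q P m fun m1 s1 => wp w d D q P' m1 fun m2 s2 => Q m2 (s1 + s2)
  | .ite i P P', m, Q => (m i ≠ 0 → wp w d D q P m fun m1 s1 => Q m1 (s1 + 1)) ∧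
      (m i = 0 → wp w d D q P' m fun m1 s1 => Q m1 (s1 + 1))
  | .loop i P, m, Q => wpRep (wp w d D q P) (m i) m Q

/-- Every cell holds a `w`-bit word. -/
def IsWords (w : ℕ) (m : Mem) : Prop := ∀ i, m i < 2 ^ w

/-- Programs without random choices. -/
def Prog.RandFree : Prog → Prop
  | .rand _ _ => False
  | .seq P P' => P.RandFree ∧ P'.RandFree
  | .ite _ P P' => P.RandFree ∧ P'.RandFree
  | .loop _ P => P.RandFree
  | _ => True

theorem wpRep_mono {f : Mem → (Mem → ℕ → Prop) → Prop}
    (hf : ∀ m (Q Q' : Mem → ℕ → Prop), (∀ m' s, Q m' s → Q' m' s) → f m Q → f m Q') (n : ℕ) :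
    ∀ m (Q Q' : Mem → ℕ → Prop), (∀ m' s, Q m' s → Q' m' s) → wpRep f n m Q → wpRep f n m Q' := by
  induction n with
  | zero => intro m Q Q' h hw; exact h _ _ hw
  | succ n ih =>
    intro m Q Q' h hw
    exact hf _ _ _ (fun m1 s1 h1 => ih _ _ _ (fun m2 s2 h2 => h _ _ h2) h1) hw

theorem wp_mono {w d : ℕ} {D : DataStructure F} {q : M} (P : Prog) :
    ∀ (m : Mem) (Q Q' : Mem → ℕ → Prop), (∀ m' s, Q m' s → Q' m' s) →
      wp w d D q P m Q → wp w d D q P m Q' := by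
  induction P with
  | seq P P' ih ih' =>
    intro m Q Q' h hw
    exact ih _ _ _ (fun m1 s1 h1 => ih' _ _ _ (fun m2 s2 h2 => h _ _ h2) h1) hw
  | ite i P P' ih ih' =>
    intro m Q Q' h hw
    exact ⟨fun hi => ih _ _ _ (fun m1 s1 h1 => h _ _ h1) (hw.1 hi),
      fun hi => ih' _ _ _ (fun m1 s1 h1 => h _ _ h1) (hw.2 hi)⟩
  | loop i P ih => exact fun m Q Q' h hw => wpRep_mono ih _ _ _ _ h hw
  | arith op i j l =>
    intro m Q Q' h hw
    cases op <;> simp only [wp] at hw ⊢ <;> first | exact h _ _ hw | exact ⟨hw.1, h _ _ hw.2⟩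
  | const i n => exact fun m Q Q' h hw => ⟨hw.1, h _ _ hw.2⟩
  | read i n => exact fun m Q Q' h hw => ⟨hw.1, h _ _ hw.2⟩
  | rand i j => exact fun m Q Q' h hw u hu => h _ _ (hw u hu)
  | _ => exact fun m Q Q' h hw => h _ _ hw

/-- Loop rule: an invariant that may mention the number of rounds done and the steps spent. -/
theorem wpRep_of_invariant {w d : ℕ} {D : DataStructure F} {q : M} {P : Prog} {m : Mem}
    {Q : Mem → ℕ → Prop} (I : ℕ → Mem → ℕ → Prop) {n : ℕ} (h0 : I 0 m 0)
    (hs : ∀ j < n, ∀ m s, I j m s → wp w d D q P m fun m' s' => I (j + 1) m' (s + s' + 1))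
    (hQ : ∀ m s, I n m s → Q m (s + 1)) : wpRep (wp w d D q P) n m Q := by
  suffices H : ∀ k j m s, j + k = n → I j m s →
      wpRep (wp w d D q P) k m fun m' s' => Q m' (s + s') by
    have := H n 0 m 0 (by simp) h0
    simpa using this
  intro k
  induction k with
  | zero => intro j m s hj hI; simp only [add_zero] at hj; subst hj; exact hQ _ _ hI
  | succ k ih =>
    intro j m s hj hI
    refine wp_mono _ _ _ _ (fun m1 s1 h1 => ?_) (hs j (by omega) m s hI)
    refine wpRep_mono (fun m Q Q' h => wp_mono P m Q Q' h) _ _ _ _ (fun m2 s2 h2 => ?_)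
      (ih (j + 1) m1 _ (by omega) h1)
    convert h2 using 1
    omega

theorem mem_support_repeatSteps_succ {f : Mem → PMF (Mem × ℕ)} {n : ℕ} {m : Mem} {y : Mem × ℕ}
    (hy : y ∈ (repeatSteps f (n + 1) m).support) :
    ∃ x ∈ (f m).support, ∃ z ∈ (repeatSteps f n x.1).support, y = (z.1, x.2 + z.2 + 1) := by
  simp only [repeatSteps, PMF.mem_support_bind_iff, PMF.mem_support_map_iff] at hy
  obtain ⟨x, hx, z, hz, rfl⟩ := hy
  exact ⟨x, hx, z, hz, rfl⟩

theorem IsWords.update {w : ℕ} {m : Mem} (hm : IsWords w m) (i : ℕ) {x : ℕ} (hx : x < 2 ^ w) :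
    IsWords w (Function.update m i x) := by
  intro j
  rcases eq_or_ne j i with rfl | h
  · simpa using hx
  · simpa [h] using hm j

theorem nearValue_le_one (D : DataStructure F) (q : M) (j l : ℕ) : nearValue D q j l ≤ 1 := by
  unfold nearValue
  split
  · split <;> simp
  · simp

/-- Soundness of `wp` for the support of the law of a run. -/
theorem wp_sound {w d : ℕ} (hw : 2 ≤ w) {D : DataStructure F} {q : M} (P : Prog) :
    ∀ (m : Mem) (Q : Mem → ℕ → Prop), IsWords w m → wp w d D q P m Q →
      ∀ y ∈ (P.exec w d D q m).support, IsWords w y.1 ∧ Q y.1 y.2 := by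
  have h4 : 4 ≤ 2 ^ w := by
    calc 4 = 2 ^ 2 := by norm_num
      _ ≤ 2 ^ w := Nat.pow_le_pow_right (by norm_num) hw
  -- a deterministic instruction whose value fits into a word
  have key : ∀ (m : Mem) (Q : Mem → ℕ → Prop) (i x s : ℕ), IsWords w m → x < 2 ^ w →
      Q (Function.update m i x) s →
      ∀ y ∈ (PMF.pure (Function.update m i (x % 2 ^ w), s)).support,
        IsWords w y.1 ∧ Q y.1 y.2 := by
    intro m Q i x s hm hx hQ y hy
    simp only [PMF.support_pure, Set.mem_singleton_iff] at hy
    subst hy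
    rw [Nat.mod_eq_of_lt hx]
    exact ⟨hm.update i hx, hQ⟩
  induction P with
  | skip =>
    intro m Q hm hQ y hy
    simp only [Prog.exec, PMF.support_pure, Set.mem_singleton_iff] at hy
    subst hy; exact ⟨hm, hQ⟩
  | const i n => exact fun m Q hm hQ => key m Q i n 1 hm hQ.1 hQ.2
  | arith op i j l =>
    intro m Q hm hQ
    cases op with
    | add => exact key m Q i _ 1 hm hQ.1 hQ.2
    | mul => exact key m Q i _ 1 hm hQ.1 hQ.2
    | sub => exact key m Q i _ 1 hm (lt_of_le_of_lt (Nat.sub_le _ _) (hm j)) hQ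
    | div => exact key m Q i _ 1 hm (lt_of_le_of_lt (Nat.div_le_self _ _) (hm j)) hQ
    | mod => exact key m Q i _ 1 hm (lt_of_le_of_lt (Nat.mod_le _ _) (hm j)) hQ
    | lt => exact key m Q i _ 1 hm (by simp only [WordOp.eval]; split <;> omega) hQ
    | eq => exact key m Q i _ 1 hm (by simp only [WordOp.eval]; split <;> omega) hQ
  | load i j =>
    intro m Q hm hQ y hy
    simp only [Prog.exec, PMF.support_pure, Set.mem_singleton_iff] at hy
    subst hy; exact ⟨hm.update i (hm _), hQ⟩
  | store i j =>
    intro m Q hm hQ y hy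
    simp only [Prog.exec, PMF.support_pure, Set.mem_singleton_iff] at hy
    subst hy; exact ⟨hm.update _ (hm _), hQ⟩
  | read i j => exact fun m Q hm hQ => key m Q i _ 1 hm hQ.1 hQ.2
  | rand i j =>
    intro m Q hm hQ y hy
    simp only [Prog.exec, PMF.mem_support_map_iff] at hy
    obtain ⟨x, -, rfl⟩ := hy
    have hx : x.val < 2 ^ w := lt_of_lt_of_le x.2 (hm j)
    rw [Nat.mod_eq_of_lt hx]
    exact ⟨hm.update i hx, hQ _ (Nat.lt_succ_iff.1 x.2)⟩
  | near i j l =>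
    exact fun m Q hm hQ => key m Q i _ d hm
      (lt_of_le_of_lt (nearValue_le_one D q _ _) (by omega)) hQ
  | hash i j l =>
    exact fun m Q hm hQ => key m Q i _ (2 * d) hm
      (lt_of_le_of_lt (hashValue_le_two D q _ _) (by omega)) hQ
  | seq P P' ih ih' =>
    intro m Q hm hQ y hy
    simp only [Prog.exec, PMF.mem_support_bind_iff, PMF.mem_support_map_iff] at hy
    obtain ⟨x, hx, z, hz, rfl⟩ := hy
    have h1 := ih m _ hm hQ x hx
    exact ih' x.1 _ h1.1 h1.2 z hz
  | ite i P P' ih ih' =>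
    intro m Q hm hQ y hy
    simp only [Prog.exec, PMF.mem_support_map_iff] at hy
    obtain ⟨x, hx, rfl⟩ := hy
    by_cases h : m i ≠ 0
    · rw [if_pos h] at hx
      exact ih m _ hm (hQ.1 h) x hx
    · rw [if_neg h] at hx
      exact ih' m _ hm (hQ.2 (not_not.1 h)) x hx
  | loop i P ih =>
    intro m Q hm hQ
    simp only [Prog.exec]
    simp only [wp] at hQ
    generalize m i = n at hQ
    induction n generalizing m Q with
    | zero =>
      intro y hy
      simp only [repeatSteps, PMF.support_pure, Set.mem_singleton_iff] at hy
      subst hy; exact ⟨hm, hQ⟩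
    | succ n ihn =>
      intro y hy
      obtain ⟨x, hx, z, hz, rfl⟩ := mem_support_repeatSteps_succ hy
      have h1 := ih m _ hm hQ x hx
      exact ihn x.1 _ h1.1 h1.2 z hz

theorem Prog.RandFree.exec_eq_pure {w d : ℕ} {D : DataStructure F} {q : M} {P : Prog}
    (hP : P.RandFree) : ∀ m, ∃ y, P.exec w d D q m = PMF.pure y := by
  induction P with
  | rand i j => exact hP.elim
  | seq P P' ih ih' =>
    intro m
    obtain ⟨y, hy⟩ := ih hP.1 m
    obtain ⟨z, hz⟩ := ih' hP.2 y.1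
    exact ⟨_, by simp only [Prog.exec, hy, PMF.pure_bind, hz, PMF.pure_map]; rfl⟩
  | ite i P P' ih ih' =>
    intro m
    obtain ⟨y, hy⟩ := ih hP.1 m
    obtain ⟨z, hz⟩ := ih' hP.2 m
    by_cases h : m i ≠ 0
    · exact ⟨_, by simp only [Prog.exec, if_pos h, hy, PMF.pure_map]; rfl⟩
    · exact ⟨_, by simp only [Prog.exec, if_neg h, hz, PMF.pure_map]; rfl⟩
  | loop i P ih =>
    intro m
    simp only [Prog.exec]
    generalize m i = n
    induction n generalizing m with
    | zero => exact ⟨_, rfl⟩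
    | succ n ihn =>
      obtain ⟨y, hy⟩ := ih hP m
      obtain ⟨z, hz⟩ := ihn y.1
      exact ⟨_, by simp only [repeatSteps, hy, PMF.pure_bind, hz, PMF.pure_map]; rfl⟩
  | _ => exact fun m => ⟨_, rfl⟩

/-- A program without random choices has a single outcome, and it satisfies what `wp` says. -/
theorem Prog.RandFree.exists_outcome {w d : ℕ} (hw : 2 ≤ w) {D : DataStructure F} {q : M}
    {P : Prog} (hP : P.RandFree) {m : Mem} {Q : Mem → ℕ → Prop} (hm : IsWords w m)
    (h : wp w d D q P m Q) :
    ∃ y, P.exec w d D q m = PMF.pure y ∧ IsWords w y.1 ∧ Q y.1 y.2 := by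
  obtain ⟨y, hy⟩ := hP.exec_eq_pure (w := w) (d := d) (D := D) (q := q) m
  exact ⟨y, hy, wp_sound hw P m Q hm h y (by simp [hy])⟩

end Logic

/-! ### The query program

Use of the working memory, for a data structure that is described by a `Layout`:

* `0` the answer in the encoding of `readAnswer`, `1` the block that gave it;
* `3`, `4`, `5`, `6`, `7`, `8`, `12` the parameters `n`, `J`, `2 ^ J`, `B`, `Lm`, `Km`, `NB`;
* `9`, `10`, `11`, `13` the constants `1`, `0`, `100`, `2`;
* `2` the current block `x`, `14` and `15` its parameters `L x` and `K x`, `16` the number `x * Lm`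
  of its first table in the list of all tables;
* `17` the total size of the buckets of the query in the block, `18` the remaining budget;
* `19` the current table, `20` the number of the stored point to be compared with the query,
  `22` the result of the comparison, `23` the number of the hash function in turn;
* `25` the result of a binary search, `26` its step, `27` its candidate, `28` the result of its test,
  `30` the length of the range searched, `31` the threshold of `bucketTest`;
* `32` the end of the array of bucket ends and cumulative bucket sizes, which starts at cell `100`;
* `33` the bucket entry drawn, `34` its table, `37` the number of tables in the next round of
  `checkProg`, `38` whether that search has found a collision;
* `24`, `29`, `35`, `36`, `39`, `40` intermediate results.

The words `0, …, 6` of the data structure are `NB`, `n`, `J`, `2 ^ J`, `B`, `Lm`, `Km`, and the words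
`8 + 2 x` and `9 + 2 x` are `L x` and `K x`. Table `t` of block `x` occupies `n` consecutive stored
points and `Km` consecutive hash functions, and radius `x` is the radius of block `x`. -/

namespace Query

/-- One round of `cmpProg`: as long as the comparison is a tie, the next hash function decides. -/
def cmpBody : Prog :=
  .seq (.arith .eq 24 22 9) (.ite 24 (.seq (.hash 22 20 23) (.arith .add 23 23 9)) .skip)

/-- Compares the stored point in cell `20` with the query, lexicographically under the hash
functions of the table in cell `19`. -/
def cmpProg : Prog :=
  .seq (.arith .add 23 16 19) (.seq (.arith .mul 23 23 8) (.seq (.const 22 1) (.loop 15 cmpBody)))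

/-- One round of `searchProg`: the step is halved, and the search moves on by one step if the
candidate reached lies in the range and passes the test. -/
def searchBody (test : Prog) : Prog :=
  .seq (.arith .div 26 26 13) (.seq (.arith .add 27 25 26) (.seq (.arith .lt 28 30 27)
    (.ite 28 .skip (.seq test (.ite 28 (.arith .sub 25 27 10) .skip)))))

/-- Binary search for the largest position up to the value of cell `30` that passes the test, by
steps of length `2 ^ (J - 1), …, 2, 1`. -/
def searchProg (test : Prog) : Prog :=
  .seq (.const 25 0) (.seq (.arith .sub 26 5 10) (.loop 4 (searchBody test)))

/-- Tests whether the entry before the candidate position compares below the threshold: with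
threshold `1` it lies before the bucket of the query, with threshold `2` it lies in this bucket or
before it. -/
def bucketTest : Prog :=
  .seq (.arith .add 29 16 19) (.seq (.arith .mul 29 29 3) (.seq (.arith .add 29 29 27)
    (.seq (.arith .sub 20 29 9) (.seq cmpProg (.arith .lt 28 22 31)))))

/-- Tests whether the tables before the candidate table contain at most as many bucket entries as
the number of the entry drawn, so that this entry lies in the candidate table or a later one. -/
def sumTest : Prog :=
  .seq (.arith .add 29 27 27) (.seq (.arith .add 29 29 11) (.seq (.arith .sub 29 29 9)
    (.seq (.load 28 29) (.seq (.arith .lt 28 33 28) (.arith .eq 28 28 10)))))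

/-- Appends the end of the bucket in the current table and the cumulative bucket size to the array.
-/
def intervalsBody : Prog :=
  .seq (.const 31 1) (.seq (searchProg bucketTest) (.seq (.arith .sub 35 25 10)
    (.seq (.const 31 2) (.seq (searchProg bucketTest) (.seq (.store 32 25)
      (.seq (.arith .add 32 32 9) (.seq (.arith .sub 35 25 35) (.seq (.arith .add 17 17 35)
        (.seq (.store 32 17) (.seq (.arith .add 32 32 9) (.arith .add 19 19 9)))))))))))

/-- Finds the buckets of the query in all tables of the block. -/
def intervalsProg : Prog :=
  .seq (.const 17 0) (.seq (.const 19 0) (.seq (.arith .sub 32 11 10) (.seq (.arith .sub 30 3 10)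
    (.loop 14 intervalsBody))))

/-- Looks at one more table for a collision of the point in cell `20` with the query, unless all
tables before the one in cell `34` have been seen. A collision sets cell `34` to `0`, which ends the
search. -/
def probeProg : Prog :=
  .seq (.arith .lt 39 19 34) (.ite 39 (.seq cmpProg (.seq (.arith .eq 39 22 9)
    (.ite 39 (.seq (.const 38 1) (.const 34 0)) (.arith .add 19 19 9)))) .skip)

/-- One round of the search for a collision: it pays for its length in advance and then doubles the
length for the next round. -/
def roundProg : Prog :=
  .seq (.arith .lt 39 19 34) (.ite 39 (.seq (.arith .sub 18 18 37)
    (.seq (.loop 37 probeProg) (.arith .add 37 37 37))) .skip)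

/-- Searches the tables before the one in cell `34` for a collision of the point in cell `20` with
the query. If there is none, the point becomes the answer. -/
def checkProg : Prog :=
  .seq (.const 19 0) (.seq (.const 37 1) (.seq (.const 38 0) (.seq (.loop 4 roundProg)
    (.ite 38 .skip (.seq (.arith .add 0 20 9) (.arith .sub 1 2 10))))))

/-- The trial with the bucket entry in cell `33`: it finds the table and the point of this entry,
tests the distance, and for a near point checks that the entry is its first occurrence. -/
def pickProg : Prog :=
  .seq (.arith .sub 18 18 9) (.seq (.arith .sub 30 14 10) (.seq (searchProg sumTest)
    (.seq (.arith .sub 34 25 10) (.seq (.arith .add 29 34 34) (.seq (.arith .add 29 29 11)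
      (.seq (.load 35 29) (.seq (.arith .add 29 29 9) (.seq (.load 36 29)
        (.seq (.arith .add 35 35 33) (.seq (.arith .sub 35 35 36) (.seq (.arith .add 20 16 34)
          (.seq (.arith .mul 20 20 3) (.seq (.arith .add 20 20 35) (.seq (.near 36 20 2)
            (.ite 36 checkProg .skip)))))))))))))))

/-- One trial, if there is no answer yet and some budget is left. -/
def trialProg : Prog :=
  .ite 0 .skip (.ite 18 (.seq (.arith .sub 33 17 9) (.seq (.rand 33 33) pickProg)) .skip)

/-- Prepares the trials in the current block. If all buckets are empty, there is nothing to draw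
from, and the budget is set to `0`. -/
def setupProg : Prog :=
  .seq (.const 40 8) (.seq (.arith .add 40 40 2) (.seq (.arith .add 40 40 2) (.seq (.read 14 40)
    (.seq (.arith .add 40 40 9) (.seq (.read 15 40) (.seq (.arith .mul 16 2 7)
      (.seq intervalsProg (.ite 17 (.arith .sub 18 6 10) (.const 18 0)))))))))

/-- One block. There are `B` trials since each of them spends at least one unit of the budget `B`.
-/
def blockProg : Prog :=
  .seq setupProg (.seq (.loop 6 trialProg) (.arith .add 2 2 9))

/-- Sets the constants and reads the parameters of the data structure. -/
def initProg : Prog :=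
  .seq (.const 9 1) (.seq (.const 10 0) (.seq (.const 11 100) (.seq (.const 13 2)
    (.seq (.read 12 10) (.seq (.read 3 9) (.seq (.read 4 13) (.seq (.const 40 3)
      (.seq (.read 5 40) (.seq (.const 40 4) (.seq (.read 6 40) (.seq (.const 40 5)
        (.seq (.read 7 40) (.seq (.const 40 6) (.read 8 40))))))))))))))

/-- The program that answers a query. -/
def queryProg : Prog := .seq initProg (.loop 12 blockProg)

section Spec

variable {M : Type u} [MetricSpace M] {F : ℝ → ℝ → HashFamily.{u, v} M}

/-- Lexicographic comparison of point `j` with the query under the hash functions number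
`h, …, h + i - 1`: the value is `0`, `1`, `2` if the point is smaller, equal, larger. -/
noncomputable def lexVal (D : DataStructure F) (q : M) (j h : ℕ) : ℕ → ℕ
  | 0 => 1
  | i + 1 => if lexVal D q j h i = 1 then hashValue D q j (h + i) else lexVal D q j h i

theorem cmpProg_spec {w d : ℕ} (D : DataStructure F) (q : M) (m : Mem) (h9 : m 9 = 1)
    (hov : (m 16 + m 19 + 1) * (m 8 + 1) + m 15 < 2 ^ w) :
    wp w d D q cmpProg m fun m' s =>
      (∀ a, a < 22 ∨ 24 < a → m' a = m a) ∧
        m' 22 = lexVal D q (m 20) ((m 16 + m 19) * m 8) (m 15) ∧ s ≤ m 15 * (2 * d + 4) + 4 := by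
  have e : (m 16 + m 19 + 1) * (m 8 + 1) = (m 16 + m 19) * m 8 + m 8 + m 16 + m 19 + 1 := by ring
  rw [e] at hov
  simp only [cmpProg, wp]
  refine ⟨by omega, ?_, ?_, ?_⟩
  · simp; omega
  · omega
  simp only [ne_eq, Nat.reduceEqDiff, not_false_eq_true, Function.update_of_ne,
    Function.update_self, Function.update_idem]
  apply wpRep_of_invariant
    (fun i m' s => (∀ a, a < 22 ∨ 24 < a → m' a = m a) ∧
      m' 22 = lexVal D q (m 20) ((m 16 + m 19) * m 8) i ∧
      (m' 22 = 1 → m' 23 = (m 16 + m 19) * m 8 + i) ∧ s ≤ i * (2 * d + 4))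
  · refine ⟨fun a ha => ?_, by simp [lexVal], by simp, by simp⟩
    rw [Function.update_of_ne (by omega), Function.update_of_ne (by omega)]
  · rintro j hj m' s ⟨hfr, h22, h23, hs⟩
    have h9' : m' 9 = 1 := by rw [hfr _ (by omega), h9]
    have h20' : m' 20 = m 20 := hfr _ (by omega)
    simp only [cmpBody, wp, Function.update_self, h9']
    refine ⟨fun h1 => ?_, fun h1 => ?_⟩
    · have h1' : m' 22 = 1 := by by_contra h; simp [h] at h1
      simp [h9', h23 h1', h20']
      refine ⟨by omega, fun a ha => ?_, ?_, ?_, ?_⟩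
      · rw [Function.update_of_ne (by omega), Function.update_of_ne (by omega),
          Function.update_of_ne (by omega), hfr a ha]
      · rw [lexVal, if_pos (by rw [← h22, h1'])]
      · omega
      · rw [add_mul]; omega
    · have h1' : m' 22 ≠ 1 := by intro h; simp [h] at h1
      refine ⟨fun a ha => ?_, ?_, ?_, ?_⟩
      · rw [Function.update_of_ne (by omega), hfr a ha]
      · rw [lexVal, ← h22]; simp [h1']
      · simp [h1']
      · rw [add_mul]; omega
  · rintro m' s ⟨hfr, h22, h23, hs⟩
    exact ⟨hfr, h22, by omega⟩

end Spec
end Query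

/-! ### Binary search -/

namespace Query

section Spec

variable {M : Type u} [MetricSpace M] {F : ℝ → ℝ → HashFamily.{u, v} M}

/-- A downward closed predicate on `{0, …, N - 1}` holds exactly below the number of its
elements. -/
theorem lt_card_filter_range_iff {pred : ℕ → Prop} [DecidablePred pred] {N : ℕ}
    (hmono : ∀ i j, i ≤ j → j < N → pred j → pred i) {i : ℕ} (hi : i < N) :
    i < ((Finset.range N).filter pred).card ↔ pred i := by
  constructor
  · intro h
    by_contra hp
    have : (Finset.range N).filter pred ⊆ Finset.range i := by
      intro j hj
      simp only [Finset.mem_filter, Finset.mem_range] at hj ⊢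
      by_contra hji
      exact hp (hmono i j (by omega) hj.1 hj.2)
    have := Finset.card_le_card this
    simp at this
    omega
  · intro hp
    have : Finset.range (i + 1) ⊆ (Finset.range N).filter pred := by
      intro j hj
      simp only [Finset.mem_filter, Finset.mem_range] at hj ⊢
      exact ⟨by omega, hmono j i (by omega) hi hp⟩
    have := Finset.card_le_card this
    simp at this
    omega

/-- Binary search for the number `cnt` of elements `i < N` with `pred i`, where `pred` is downward
closed and `test` decides `pred`. -/
theorem searchProg_spec {w d : ℕ} {D : DataStructure F} {q : M} {test : Prog} {m : Mem}
    {J N T : ℕ} {pred : ℕ → Prop} [DecidablePred pred] {cnt : ℕ} (h4 : m 4 = J) (h5 : m 5 = 2 ^ J)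
    (h10 : m 10 = 0) (h13 : m 13 = 2) (h30 : m 30 = N) (hN : N < 2 ^ J) (hw : w = J + 1)
    (hcnt : cnt ≤ N) (hpred : ∀ i < N, i < cnt ↔ pred i)
    (htest : ∀ (c : ℕ) (m' : Mem), 1 ≤ c → c ≤ N → (∀ a, a < 20 ∨ 29 < a → m' a = m a) →
      m' 27 = c → wp w d D q test m' fun m'' s =>
        (∀ a, a < 20 ∨ (25 ≤ a ∧ a ≤ 27) ∨ 29 < a → m'' a = m' a) ∧
          m'' 28 = (if pred (c - 1) then 1 else 0) ∧ s ≤ T) :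
    wp w d D q (searchProg test) m fun m' s =>
      (∀ a, a < 20 ∨ 29 < a → m' a = m a) ∧ m' 25 = cnt ∧ s ≤ J * (T + 7) + 3 := by
  have hpw : 2 ^ w = 2 ^ J + 2 ^ J := by rw [hw, pow_succ]; ring
  simp only [searchProg, wp]
  refine ⟨by positivity, ?_⟩
  simp only [ne_eq, Nat.reduceEqDiff, not_false_eq_true, Function.update_of_ne, h4, h5, h10,
    Nat.sub_zero]
  apply wpRep_of_invariant (fun i m' s => (∀ a, a < 20 ∨ 29 < a → m' a = m a) ∧
    m' 26 = 2 ^ (J - i) ∧ m' 25 ≤ cnt ∧ cnt < m' 25 + 2 ^ (J - i) ∧ s ≤ i * (T + 7))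
  · refine ⟨fun a ha => ?_, by simp, by simp, by simp; omega, by simp⟩
    rw [Function.update_of_ne (by omega), Function.update_of_ne (by omega)]
  · rintro i hi m' s ⟨hfr, h26, hlo, hhi, hs⟩
    have h13' : m' 13 = 2 := by rw [hfr _ (by omega), h13]
    have h30' : m' 30 = N := by rw [hfr _ (by omega), h30]
    have hpow : 2 ^ (J - i) = 2 * 2 ^ (J - (i + 1)) := by
      rw [← pow_succ']; congr 1; omega
    have hle : 2 ^ (J - (i + 1)) ≤ 2 ^ J := Nat.pow_le_pow_right (by norm_num) (by omega)
    have hdiv : 2 * 2 ^ (J - (i + 1)) / 2 = 2 ^ (J - (i + 1)) := by omega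
    simp only [searchBody, wp]
    simp only [ne_eq, Nat.reduceEqDiff, not_false_eq_true, Function.update_of_ne,
      Function.update_self, h26, h13', h30', hpow, hdiv]
    rw [hpow] at hhi
    generalize 2 ^ (J - (i + 1)) = st at *
    refine ⟨by omega, fun hN' => ?_, fun hN' => ?_⟩
    · have hlt : N < m' 25 + st := by by_contra h; simp [h] at hN'
      refine ⟨fun a ha => ?_, trivial, hlo, by omega, by rw [add_mul]; omega⟩
      rw [Function.update_of_ne (by omega), Function.update_of_ne (by omega),
        Function.update_of_ne (by omega), hfr a ha]
    · have hge : m' 25 + st ≤ N := by by_contra h; simp [not_le.1 h] at hN'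
      have hst : 0 < st := by
        rcases Nat.eq_zero_or_pos st with h | h
        · subst h; omega
        · exact h
      refine wp_mono _ _ _ _ ?_ (htest (m' 25 + st) _ (by omega) hge ?_ ?_)
      · rintro m1 s1 ⟨hfr1, h28, hs1⟩
        have hbase : ∀ a, a < 20 ∨ 29 < a → m1 a = m a := by
          intro a ha
          rw [hfr1 a (by omega), Function.update_of_ne (by omega),
            Function.update_of_ne (by omega), Function.update_of_ne (by omega), hfr a ha]
        have e25 : m1 25 = m' 25 := by rw [hfr1 _ (by omega)]; simp
        have e26 : m1 26 = st := by rw [hfr1 _ (by omega)]; simp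
        have e27 : m1 27 = m' 25 + st := by rw [hfr1 _ (by omega)]; simp
        have e10 : m1 10 = 0 := by rw [hbase _ (by omega), h10]
        have hp := hpred (m' 25 + st - 1) (by omega)
        refine ⟨fun hc => ?_, fun hc => ?_⟩
        · have hpt : pred (m' 25 + st - 1) := by by_contra h; simp [h28, h] at hc
          rw [← hp] at hpt
          simp only [e27, e10]
          refine ⟨fun a ha => ?_, ?_, ?_, ?_, by rw [add_mul]; omega⟩
          · rw [Function.update_of_ne (by omega), hbase a ha]
          · simp [e26]
          · simp; omega
          · simp; omega
        · have hpt : ¬ pred (m' 25 + st - 1) := by intro h; simp [h28, h] at hc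
          rw [← hp] at hpt
          exact ⟨hbase, e26, by omega, by omega, by rw [add_mul]; omega⟩
      · intro a ha
        rw [Function.update_of_ne (by omega), Function.update_of_ne (by omega),
          Function.update_of_ne (by omega), hfr a ha]
      · simp
  · rintro m' s ⟨hfr, h26, hlo, hhi, hs⟩
    simp only [Nat.sub_self, pow_zero] at hhi
    exact ⟨hfr, by omega, by omega⟩

end Spec
end Query

/-! ### The layout of the data structure and the buckets of a query -/

namespace Query

section Layout

set_option linter.unusedSectionVars false

variable {M : Type u} [MetricSpace M] {F : ℝ → ℝ → HashFamily.{u, v} M}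

/-- The parameters that describe a data structure: the number `NB` of blocks, the number `n` of
points, the exponent `J` with words of `J + 1` bits, the budget `B`, and the number `L x` of tables
of block `x` (space is reserved for `Lm`) and the number `K x` of hash functions per table (space is
reserved for `Km`). -/
structure Layout where
  NB : ℕ
  n : ℕ
  J : ℕ
  B : ℕ
  Lm : ℕ
  Km : ℕ
  L : ℕ → ℕ
  K : ℕ → ℕ

/-- Comparison of the query with the entry number `i` of table `t` of block `x`. -/
noncomputable def Layout.cmp (p : Layout) (D : DataStructure F) (q : M) (x t i : ℕ) : ℕ :=
  lexVal D q ((x * p.Lm + t) * p.n + i) ((x * p.Lm + t) * p.Km) (p.K x)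

/-- The number of entries of table `t` of block `x` that come before the bucket of the query. -/
noncomputable def Layout.lo (p : Layout) (D : DataStructure F) (q : M) (x t : ℕ) : ℕ :=
  ((Finset.range p.n).filter fun i => p.cmp D q x t i < 1).card

/-- The position in table `t` of block `x` where the bucket of the query ends. -/
noncomputable def Layout.hi (p : Layout) (D : DataStructure F) (q : M) (x t : ℕ) : ℕ :=
  ((Finset.range p.n).filter fun i => p.cmp D q x t i < 2).card

/-- The total size of the buckets of the query in the first `t` tables of block `x`. -/
noncomputable def Layout.total (p : Layout) (D : DataStructure F) (q : M) (x t : ℕ) : ℕ :=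
  ∑ s ∈ Finset.range t, (p.hi D q x s - p.lo D q x s)

/-- The data structure `D` is laid out according to `p`, and its tables are sorted in the sense
that binary search for the bucket of `q` works. -/
structure Layout.Fits (p : Layout) (D : DataStructure F) (q : M) : Prop where
  wordNB : D.words.getD 0 0 = p.NB
  wordn : D.words.getD 1 0 = p.n
  wordJ : D.words.getD 2 0 = p.J
  wordH : D.words.getD 3 0 = 2 ^ p.J
  wordB : D.words.getD 4 0 = p.B
  wordLm : D.words.getD 5 0 = p.Lm
  wordKm : D.words.getD 6 0 = p.Km
  wordL : ∀ x < p.NB, D.words.getD (8 + 2 * x) 0 = p.L x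
  wordK : ∀ x < p.NB, D.words.getD (9 + 2 * x) 0 = p.K x
  L_le : ∀ x < p.NB, p.L x ≤ p.Lm
  K_le : ∀ x < p.NB, p.K x ≤ p.Km
  bound : p.NB * p.Lm * (p.Km + 1) + p.NB * p.Lm * p.n + p.Km + p.n + 2 * p.Lm + 2 * p.NB + p.B
    + 110 < 2 ^ p.J
  sorted : ∀ x < p.NB, ∀ t < p.L x, ∀ i j, i ≤ j → j < p.n →
    p.cmp D q x t i ≤ p.cmp D q x t j

/-- The cells with the global parameters. -/
structure Layout.GlobMem (p : Layout) (m : Mem) : Prop where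
  c3 : m 3 = p.n
  c4 : m 4 = p.J
  c5 : m 5 = 2 ^ p.J
  c6 : m 6 = p.B
  c7 : m 7 = p.Lm
  c8 : m 8 = p.Km
  c9 : m 9 = 1
  c10 : m 10 = 0
  c11 : m 11 = 100
  c12 : m 12 = p.NB
  c13 : m 13 = 2

/-- The cells with the parameters of block `x`. -/
structure Layout.BlockMem (p : Layout) (x : ℕ) (m : Mem) : Prop extends p.GlobMem m where
  c2 : m 2 = x
  c14 : m 14 = p.L x
  c15 : m 15 = p.K x
  c16 : m 16 = x * p.Lm

variable {p : Layout} {D : DataStructure F} {q : M}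

theorem Layout.GlobMem.congr {m m' : Mem} (h : p.GlobMem m) (hm : ∀ a, 3 ≤ a → a < 14 → m' a = m a) :
    p.GlobMem m' := by
  constructor <;> rw [hm _ (by norm_num) (by norm_num)]
  exacts [h.c3, h.c4, h.c5, h.c6, h.c7, h.c8, h.c9, h.c10, h.c11, h.c12, h.c13]

theorem Layout.BlockMem.congr {x : ℕ} {m m' : Mem} (h : p.BlockMem x m)
    (hm : ∀ a, 2 ≤ a → a < 17 → m' a = m a) : p.BlockMem x m' := by
  refine ⟨h.toGlobMem.congr (fun a h1 h2 => hm a (by omega) (by omega)), ?_, ?_, ?_, ?_⟩ <;>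
    rw [hm _ (by norm_num) (by norm_num)]
  exacts [h.c2, h.c14, h.c15, h.c16]

theorem Layout.Fits.row_lt (h : p.Fits D q) {x t : ℕ} (hx : x < p.NB) (ht : t < p.L x) :
    x * p.Lm + t + 1 ≤ p.NB * p.Lm := by
  have h1 := h.L_le x hx
  calc x * p.Lm + t + 1 ≤ x * p.Lm + p.Lm := by omega
    _ = (x + 1) * p.Lm := by ring
    _ ≤ p.NB * p.Lm := Nat.mul_le_mul_right _ hx

theorem Layout.Fits.index_lt (h : p.Fits D q) {x t : ℕ} (hx : x < p.NB) (ht : t < p.L x) :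
    (x * p.Lm + t) * p.n + p.n ≤ p.NB * p.Lm * p.n := by
  calc (x * p.Lm + t) * p.n + p.n = (x * p.Lm + t + 1) * p.n := by ring
    _ ≤ _ := Nat.mul_le_mul_right _ (h.row_lt hx ht)

theorem Layout.Fits.total_le (h : p.Fits D q) {x t : ℕ} (hx : x < p.NB) (ht : t ≤ p.L x) :
    p.total D q x t ≤ p.NB * p.Lm * p.n := by
  have h1 := h.L_le x hx
  calc p.total D q x t ≤ ∑ s ∈ Finset.range t, p.n := by
        refine Finset.sum_le_sum fun s _ => (Nat.sub_le _ _).trans ?_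
        exact (Finset.card_filter_le _ _).trans (by simp)
    _ = t * p.n := by simp
    _ ≤ p.NB * p.Lm * p.n := by
        refine Nat.mul_le_mul_right _ (ht.trans (h1.trans ?_))
        exact Nat.le_mul_of_pos_left _ (by omega)

theorem Layout.lo_le_hi (x t : ℕ) : p.lo D q x t ≤ p.hi D q x t :=
  Finset.card_le_card (Finset.monotone_filter_right _ fun i _ h => h.trans (by norm_num))

theorem Layout.hi_le (x t : ℕ) : p.hi D q x t ≤ p.n :=
  (Finset.card_filter_le _ _).trans (by simp)

/-- A bound for the time of one comparison. -/
def Layout.cmpTime (p : Layout) (d : ℕ) : ℕ := p.Km * (2 * d + 4) + 4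

theorem Layout.BlockMem.cmpProg_spec {w d x t : ℕ} (hf : p.Fits D q) (hw : w = p.J + 1)
    (hx : x < p.NB) (ht : t < p.L x) {m : Mem} (hm : p.BlockMem x m) (h19 : m 19 = t) :
    wp w d D q cmpProg m fun m' s => (∀ a, a < 22 ∨ 24 < a → m' a = m a) ∧
      m' 22 = lexVal D q (m 20) ((x * p.Lm + t) * p.Km) (p.K x) ∧ s ≤ p.cmpTime d := by
  have hb := hf.bound
  have hpw : 2 ^ w = 2 ^ p.J + 2 ^ p.J := by rw [hw, pow_succ]; ring
  refine wp_mono _ _ _ _ (fun m' s h => ?_) (Query.cmpProg_spec D q m hm.c9 ?_)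
  · rw [hm.c16, h19, hm.c8, hm.c15] at h
    refine ⟨h.1, h.2.1, h.2.2.trans ?_⟩
    exact Nat.add_le_add_right (Nat.mul_le_mul_right _ (hf.K_le x hx)) _
  · rw [hm.c16, h19, hm.c8, hm.c15]
    have := hf.K_le x hx
    have h2 : (x * p.Lm + t + 1) * (p.Km + 1) ≤ p.NB * p.Lm * (p.Km + 1) :=
      Nat.mul_le_mul_right _ (hf.row_lt hx ht)
    omega

theorem Layout.BlockMem.bucketTest_spec {w d x t thr c : ℕ} (hf : p.Fits D q) (hw : w = p.J + 1)
    (hx : x < p.NB) (ht : t < p.L x) {m : Mem} (hm : p.BlockMem x m) (h19 : m 19 = t)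
    (h31 : m 31 = thr) (h27 : m 27 = c) (hc : 1 ≤ c) (hcn : c ≤ p.n) :
    wp w d D q bucketTest m fun m' s =>
      (∀ a, a < 20 ∨ (25 ≤ a ∧ a ≤ 27) ∨ 29 < a → m' a = m a) ∧
        m' 28 = (if p.cmp D q x t (c - 1) < thr then 1 else 0) ∧ s ≤ p.cmpTime d + 5 := by
  have hb := hf.bound
  have hpw : 2 ^ w = 2 ^ p.J + 2 ^ p.J := by rw [hw, pow_succ]; ring
  have hr := hf.row_lt hx ht
  have hi := hf.index_lt hx ht
  have hmul : p.NB * p.Lm * (p.Km + 1) = p.NB * p.Lm * p.Km + p.NB * p.Lm := by ring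
  simp only [bucketTest, wp]
  simp only [ne_eq, Nat.reduceEqDiff, not_false_eq_true, Function.update_of_ne,
    Function.update_self, hm.c16, hm.c3, hm.c9, h19, h27, Function.update_idem]
  refine ⟨by omega, by omega, by omega, ?_⟩
  refine wp_mono _ _ _ _ ?_ (Layout.BlockMem.cmpProg_spec (t := t) hf hw hx ht (hm.congr ?_) ?_)
  · rintro m1 s1 ⟨hfr, h22, hs⟩
    refine ⟨fun a ha => ?_, ?_, by omega⟩
    · rw [Function.update_of_ne (by omega), hfr a (by omega), Function.update_of_ne (by omega),
        Function.update_of_ne (by omega)]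
    · have e31 : m1 31 = thr := by rw [hfr _ (by omega)]; simpa using h31
      simp only [h22, e31, Layout.cmp, Function.update_self, Nat.add_sub_assoc hc]
      rfl
  · intro a h1 h2
    rw [Function.update_of_ne (by omega), Function.update_of_ne (by omega)]
  · simpa using h19

/-- A bound for the time of a binary search for a bucket. -/
def Layout.searchTime (p : Layout) (d : ℕ) : ℕ := p.J * (p.cmpTime d + 12) + 3

theorem Layout.BlockMem.bucketSearch_spec {w d x t thr : ℕ} (hf : p.Fits D q) (hw : w = p.J + 1)
    (hx : x < p.NB) (ht : t < p.L x) {m : Mem} (hm : p.BlockMem x m) (h19 : m 19 = t)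
    (h31 : m 31 = thr) (h30 : m 30 = p.n) :
    wp w d D q (searchProg bucketTest) m fun m' s =>
      (∀ a, a < 20 ∨ 29 < a → m' a = m a) ∧
        m' 25 = ((Finset.range p.n).filter fun i => p.cmp D q x t i < thr).card ∧
        s ≤ p.searchTime d := by
  have hb := hf.bound
  refine searchProg_spec (pred := fun i => p.cmp D q x t i < thr) hm.c4 hm.c5 hm.c10 hm.c13 h30
    (by omega) hw ((Finset.card_filter_le _ _).trans (by simp)) (fun i hi => ?_) ?_
  · exact lt_card_filter_range_iff
      (fun i j hij hj h => lt_of_le_of_lt (hf.sorted x hx t ht i j hij hj) h) hi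
  · intro c m' hc hcn hfr h27
    exact Layout.BlockMem.bucketTest_spec hf hw hx ht
      (hm.congr fun a h1 h2 => hfr a (by omega)) (by rw [hfr _ (by omega), h19])
      (by rw [hfr _ (by omega), h31]) h27 hc hcn

/-- The working memory holds the bucket ends and the cumulative bucket sizes of the first `T`
tables. -/
def Layout.Arr (p : Layout) (D : DataStructure F) (q : M) (x T : ℕ) (m : Mem) : Prop :=
  ∀ t < T, m (100 + 2 * t) = p.hi D q x t ∧ m (101 + 2 * t) = p.total D q x (t + 1)

theorem Layout.BlockMem.intervalsProg_spec {w d x : ℕ} (hf : p.Fits D q) (hw : w = p.J + 1)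
    (hx : x < p.NB) {m : Mem} (hm : p.BlockMem x m) :
    wp w d D q intervalsProg m fun m' s => (∀ a, a < 17 → m' a = m a) ∧ p.BlockMem x m' ∧
      p.Arr D q x (p.L x) m' ∧ m' 17 = p.total D q x (p.L x) ∧
        s ≤ p.L x * (2 * p.searchTime d + 11) + 5 := by
  have hb := hf.bound
  have hpw : 2 ^ w = 2 ^ p.J + 2 ^ p.J := by rw [hw, pow_succ]; ring
  have hLm := hf.L_le x hx
  simp only [intervalsProg, wp]
  refine ⟨by positivity, by positivity, ?_⟩
  simp only [ne_eq, Nat.reduceEqDiff, not_false_eq_true, Function.update_of_ne,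
    hm.c11, hm.c10, hm.c3, hm.c14, Nat.sub_zero]
  apply wpRep_of_invariant (fun t m' s => (∀ a, a < 17 → m' a = m a) ∧ p.Arr D q x t m' ∧
    m' 17 = p.total D q x t ∧ m' 19 = t ∧ m' 32 = 100 + 2 * t ∧ m' 30 = p.n ∧
    s ≤ t * (2 * p.searchTime d + 11))
  · refine ⟨fun a ha => ?_, fun t ht => by omega, by simp [Layout.total], by simp, by simp,
      by simp, by simp⟩
    rw [Function.update_of_ne (by omega), Function.update_of_ne (by omega),
      Function.update_of_ne (by omega), Function.update_of_ne (by omega)]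
  · rintro t ht m1 s ⟨hfr, harr, h17, h19, h32, h30, hs⟩
    have hm1 : p.BlockMem x m1 := hm.congr fun a _ h2 => hfr a h2
    simp only [intervalsBody, wp]
    refine ⟨by omega, ?_⟩
    refine wp_mono _ _ _ _ ?_ (Layout.BlockMem.bucketSearch_spec (t := t) (thr := 1) hf hw hx ht
      (hm1.congr ?_) (by simpa using h19) (by simp) (by simpa using h30))
    swap
    · intro a _ h2; rw [Function.update_of_ne (by omega)]
    rintro m2 s2 ⟨hfr2, h25, hs2⟩
    have hfr2' : ∀ a, a < 20 ∨ a = 30 ∨ 31 < a → m2 a = m1 a := by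
      intro a ha
      rw [hfr2 a (by omega), Function.update_of_ne (by omega)]
    have hm2 : p.BlockMem x m2 := hm1.congr fun a _ h2 => hfr2' a (by omega)
    refine ⟨by omega, ?_⟩
    refine wp_mono _ _ _ _ ?_ (Layout.BlockMem.bucketSearch_spec (t := t) (thr := 2) hf hw hx ht
      (hm2.congr ?_) ?_ (by simp) ?_)
    rotate_left
    · intro a _ h2; rw [Function.update_of_ne (by omega), Function.update_of_ne (by omega)]
    · simp [hfr2' 19, h19]
    · simp [hfr2' 30, h30]
    rintro m3 s3 ⟨hfr3, h25', hs3⟩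
    have hfr3' : ∀ a, a < 20 ∨ a = 30 ∨ (31 < a ∧ a ≠ 35) → m3 a = m1 a := by
      intro a ha
      rw [hfr3 a (by omega), Function.update_of_ne (by omega), Function.update_of_ne (by omega),
        hfr2' a (by omega)]
    have hm3 : p.BlockMem x m3 := hm1.congr fun a _ h2 => hfr3' a (by omega)
    have e35 : m3 35 = p.lo D q x t := by
      rw [hfr3 _ (by omega)]
      simp [h25, hm2.c10, Layout.lo]
    have e25 : m3 25 = p.hi D q x t := h25'
    have e17 : m3 17 = p.total D q x t := by rw [hfr3' _ (by omega), h17]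
    have e19 : m3 19 = t := by rw [hfr3' _ (by omega), h19]
    have e32 : m3 32 = 100 + 2 * t := by rw [hfr3' _ (by omega), h32]
    have e30 : m3 30 = p.n := by rw [hfr3' _ (by omega), h30]
    have htot : p.total D q x (t + 1) = p.total D q x t + (p.hi D q x t - p.lo D q x t) := by
      rw [Layout.total, Finset.sum_range_succ]; rfl
    have htot' := hf.total_le hx (t := t + 1) (by omega)
    rw [htot] at htot'
    obtain ⟨A, hA⟩ : ∃ A, A = 100 + 2 * t := ⟨_, rfl⟩
    obtain ⟨A', hA'⟩ : ∃ A', A' = A + 1 := ⟨_, rfl⟩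
    have e : ∀ (f : Mem) v a, a < 100 → Function.update f A v a = f a :=
      fun f v a ha => Function.update_of_ne (by omega) _ _
    have e' : ∀ (f : Mem) v a, a < 100 → Function.update f A' v a = f a :=
      fun f v a ha => Function.update_of_ne (by omega) _ _
    rw [← hA] at e32
    simp only [e32, e25]
    simp [e, e', e35, e17, e25, e32, hm3.c9, ← hA', e19]
    refine ⟨by omega, by omega, by omega, by omega, ?_⟩
    rw [← htot]
    refine ⟨fun a ha => ?_, fun t' ht' => ?_, by omega, ?_⟩
    · rw [Function.update_of_ne (by omega), Function.update_of_ne (by omega), e' _ _ _ (by omega),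
        Function.update_of_ne (by omega), Function.update_of_ne (by omega),
        Function.update_of_ne (by omega), e _ _ _ (by omega), hfr3' a (by omega), hfr a ha]
    · have hl : ∀ (f : Mem) i v t, i < 100 →
          Function.update f i v (100 + 2 * t) = f (100 + 2 * t) :=
        fun f i v a hi => Function.update_of_ne (by omega) _ _
      have hl' : ∀ (f : Mem) i v t, i < 100 →
          Function.update f i v (101 + 2 * t) = f (101 + 2 * t) :=
        fun f i v a hi => Function.update_of_ne (by omega) _ _
      have hv : ∀ (f : Mem) v, Function.update f A' v (100 + 2 * t') = f (100 + 2 * t') :=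
        fun f v => Function.update_of_ne (by omega) _ _
      simp only [hl, hl', hv, Nat.reduceLT]
      rcases Nat.lt_succ_iff_lt_or_eq.1 ht' with h | rfl
      · rw [Function.update_of_ne (by omega), Function.update_of_ne (by omega)]
        simp only [hl', Nat.reduceLT]
        rw [Function.update_of_ne (by omega), hfr3' _ (by omega), hfr3' _ (by omega)]
        exact harr t' h
      · rw [hA, Function.update_self, show 101 + 2 * t' = A' by omega, Function.update_self]
        exact ⟨rfl, rfl⟩
    · rw [add_mul]; omega
  · rintro m1 s ⟨hfr, harr, h17, h19, h32, h30, hs⟩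
    exact ⟨hfr, hm.congr fun a _ h2 => hfr a h2, harr, h17, by omega⟩

end Layout
end Query

/-! ### The search for the first collision -/

namespace Query

section Trial

set_option linter.unusedSectionVars false

variable {M : Type u} [MetricSpace M] {F : ℝ → ℝ → HashFamily.{u, v} M}

/-- The stored point number `j` lies in the bucket of the query in table `s` of block `x`. -/
def Layout.Coll (p : Layout) (D : DataStructure F) (q : M) (x j s : ℕ) : Prop :=
  lexVal D q j ((x * p.Lm + s) * p.Km) (p.K x) = 1

open Classical in
/-- The number of tables `s ≤ T` that a search for the first collision of point `j` has to look
at. -/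
noncomputable def Layout.probes (p : Layout) (D : DataStructure F) (q : M) (x j T : ℕ) : ℕ :=
  ((Finset.range (T + 1)).filter fun s => ∀ s' < s, ¬ p.Coll D q x j s').card

/-- The table that contains the bucket entry number `u`. -/
noncomputable def Layout.tbl (p : Layout) (D : DataStructure F) (q : M) (x u : ℕ) : ℕ :=
  ((Finset.range (p.L x)).filter fun i => p.total D q x (i + 1) ≤ u).card

/-- The number of the stored point at the bucket entry number `u`. -/
noncomputable def Layout.idx (p : Layout) (D : DataStructure F) (q : M) (x u : ℕ) : ℕ :=
  (x * p.Lm + p.tbl D q x u) * p.n +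
    (p.hi D q x (p.tbl D q x u) + u - p.total D q x (p.tbl D q x u + 1))

/-- The bucket entry number `u` is accepted: its point is near, and the entry is its first
occurrence. -/
def Layout.Acc (p : Layout) (D : DataStructure F) (q : M) (x u : ℕ) : Prop :=
  nearValue D q (p.idx D q x u) x ≠ 0 ∧
    ∀ s < p.tbl D q x u, ¬ p.Coll D q x (p.idx D q x u) s

/-- A bound for the part of the budget that is spent on the bucket entry number `u`. -/
noncomputable def Layout.cost (p : Layout) (D : DataStructure F) (q : M) (x u : ℕ) : ℕ :=
  if nearValue D q (p.idx D q x u) x = 0 then 1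
  else 2 * p.probes D q x (p.idx D q x u) (p.tbl D q x u)

variable {p : Layout} {D : DataStructure F} {q : M}

theorem Layout.lt_probes {x j T c : ℕ} (hc : c ≤ T) (h : ∀ s < c, ¬ p.Coll D q x j s) :
    c + 1 ≤ p.probes D q x j T := by
  classical
  have : Finset.range (c + 1) ⊆
      (Finset.range (T + 1)).filter fun s => ∀ s' < s, ¬ p.Coll D q x j s' := by
    intro s hs
    simp only [Finset.mem_range, Finset.mem_filter] at hs ⊢
    exact ⟨by omega, fun s' hs' => h s' (by omega)⟩
  have := Finset.card_le_card this
  rw [Finset.card_range] at this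
  exact this.trans_eq (by unfold Layout.probes; congr)

theorem Layout.probes_le (x j T : ℕ) : p.probes D q x j T ≤ T + 1 := by
  classical
  unfold Layout.probes
  exact (Finset.card_filter_le _ _).trans (by simp)

/-- The search for a collision of point `j` before table `T` is still running at table `c`. -/
structure Layout.Running (p : Layout) (D : DataStructure F) (q : M) (x j T c : ℕ) (m : Mem) :
    Prop where
  c38 : m 38 = 0
  c34 : m 34 = T
  c19 : m 19 = c
  le : c ≤ T
  no_coll : ∀ s < c, ¬ p.Coll D q x j s

/-- The search for a collision of point `j` before table `T` has ended. -/
def Layout.Finished (p : Layout) (D : DataStructure F) (q : M) (x j T : ℕ) (m : Mem) : Prop :=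
  (m 38 = 1 ∧ m 34 = 0 ∧ ∃ s < T, p.Coll D q x j s) ∨ p.Running D q x j T T m

theorem Layout.Running.congr {x j T c : ℕ} {m m' : Mem} (h : p.Running D q x j T c m)
    (h38 : m' 38 = m 38) (h34 : m' 34 = m 34) (h19 : m' 19 = m 19) :
    p.Running D q x j T c m' :=
  ⟨h38.trans h.c38, h34.trans h.c34, h19.trans h.c19, h.le, h.no_coll⟩

theorem Layout.Finished.congr {x j T : ℕ} {m m' : Mem} (h : p.Finished D q x j T m)
    (h38 : m' 38 = m 38) (h34 : m' 34 = m 34) (h19 : m' 19 = m 19) :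
    p.Finished D q x j T m' := by
  rcases h with ⟨h1, h2, h3⟩ | h
  · exact Or.inl ⟨h38.trans h1, h34.trans h2, h3⟩
  · exact Or.inr (h.congr h38 h34 h19)

theorem Layout.Finished.not_lt {x j T : ℕ} {m : Mem} (h : p.Finished D q x j T m) :
    ¬ m 19 < m 34 := by
  rcases h with ⟨-, h2, -⟩ | h
  · omega
  · rw [h.c34, h.c19]; omega

/-- The cells that a search for the first collision leaves alone. -/
def checkKeeps (a : ℕ) : Prop :=
  a < 18 ∨ a = 20 ∨ (24 < a ∧ a < 34) ∨ 39 < a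

theorem Layout.BlockMem.probeProg_spec {w d x j T c : ℕ} (hf : p.Fits D q) (hw : w = p.J + 1)
    (hx : x < p.NB) (hT : T < p.L x) {m : Mem} (hm : p.BlockMem x m) (h20 : m 20 = j)
    (h : p.Running D q x j T c m ∨ p.Finished D q x j T m) :
    wp w d D q probeProg m fun m' s =>
      (∀ a, checkKeeps a ∨ a = 37 ∨ a = 18 → m' a = m a) ∧
        (p.Running D q x j T (c + 1) m' ∨ p.Finished D q x j T m') ∧ s ≤ p.cmpTime d + 6 := by
  have hb := hf.bound
  have hpw : 2 ^ w = 2 ^ p.J + 2 ^ p.J := by rw [hw, pow_succ]; ring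
  have hLm := hf.L_le x hx
  simp only [probeProg, wp, Function.update_self]
  refine ⟨fun hlt => ?_, fun hlt => ?_⟩
  · have hlt' : m 19 < m 34 := by by_contra h; simp [h] at hlt
    replace h : p.Running D q x j T c m := by
      rcases h with h | h
      · exact h
      · exact absurd hlt' h.not_lt
    have hcT : c < T := by rw [h.c34, h.c19] at hlt'; exact hlt'
    refine wp_mono _ _ _ _ ?_ (Layout.BlockMem.cmpProg_spec (t := c) hf hw hx (by omega)
      (hm.congr fun a h1 h2 => ?_) ?_)
    rotate_left
    · rw [Function.update_of_ne (by omega)]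
    · simpa using h.c19
    rintro m1 s1 ⟨hfr, h22, hs⟩
    have hfr' : ∀ a, a < 22 ∨ (24 < a ∧ a ≠ 39) → m1 a = m a := by
      intro a ha
      rw [hfr a (by omega), Function.update_of_ne (by omega)]
    simp only [ne_eq, Nat.reduceEqDiff, not_false_eq_true, Function.update_of_ne, h20] at h22
    have e9 : m1 9 = 1 := by rw [hfr' _ (by omega), hm.c9]
    have e19 : m1 19 = c := by rw [hfr' _ (by omega), h.c19]
    refine ⟨fun hc => ?_, fun hc => ?_⟩
    · have hcoll : p.Coll D q x j c := by
        rw [Layout.Coll, ← h22]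
        by_contra h; simp [e9, h] at hc
      refine ⟨by omega, by positivity, fun a ha => ?_, ?_, by omega⟩
      · simp only [checkKeeps] at ha
        rw [Function.update_of_ne (by omega), Function.update_of_ne (by omega),
          Function.update_of_ne (by omega), hfr' a (by omega)]
      · exact Or.inr (Or.inl ⟨by simp, by simp, c, hcT, hcoll⟩)
    · have hcoll : ¬ p.Coll D q x j c := by
        rw [Layout.Coll, ← h22]
        intro h; simp [e9, h] at hc
      simp only [ne_eq, Nat.reduceEqDiff, not_false_eq_true, Function.update_of_ne, e19, e9]
      refine ⟨by omega, fun a ha => ?_, ?_, by omega⟩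
      · simp only [checkKeeps] at ha
        rw [Function.update_of_ne (by omega), Function.update_of_ne (by omega), hfr' a (by omega)]
      · refine Or.inl ⟨?_, ?_, by simp, hcT, fun s hs => ?_⟩
        · simp [hfr' 38, h.c38]
        · simp [hfr' 34, h.c34]
        · rcases Nat.lt_succ_iff_lt_or_eq.1 hs with h' | rfl
          · exact h.no_coll s h'
          · exact hcoll
  · have hlt' : ¬ m 19 < m 34 := by intro h; simp [h] at hlt
    refine ⟨fun a ha => ?_, Or.inr ?_, by omega⟩
    · simp only [checkKeeps] at ha
      rw [Function.update_of_ne (by omega)]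
    · suffices h' : p.Finished D q x j T m from h'.congr (by simp) (by simp) (by simp)
      rcases h with h | h
      · have : c = T := by
          rw [h.c34, h.c19] at hlt'
          have := h.le
          omega
        subst this
        exact Or.inr h
      · exact h

/-- A bound for the time of one probe. -/
def Layout.probeTime (p : Layout) (d : ℕ) : ℕ := p.cmpTime d + 7

/-- The search for a collision of point `j` after `i` rounds, when `c` units of the budget `b` have
been spent: it is running and has just finished the first `2 ^ i - 1` tables, or it has ended. -/
structure Layout.RoundState (p : Layout) (D : DataStructure F) (q : M) (x j T b i c : ℕ)
    (m : Mem) : Prop where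
  c18 : m 18 = b - c
  state : (p.Running D q x j T (2 ^ i - 1) m ∧ m 37 = 2 ^ i ∧ c = 2 ^ i - 1) ∨
    (p.Finished D q x j T m ∧ c + 1 ≤ 2 * p.probes D q x j T)

/-- A round that is started while the search is running at table `2 ^ i - 1` costs `2 ^ i` units, so
that the total paid so far is `2 ^ (i + 1) - 1`, less than twice the number of tables that have to
be looked at even if the search ends within this round. -/
theorem Layout.BlockMem.roundProg_spec {w d x j T b i c : ℕ} (hf : p.Fits D q)
    (hw : w = p.J + 1) (hx : x < p.NB) (hT : T < p.L x) (hi : i < p.J) {m : Mem}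
    (hm : p.BlockMem x m) (h20 : m 20 = j) (h : p.RoundState D q x j T b i c m) :
    wp w d D q roundProg m fun m' s => (∀ a, checkKeeps a → m' a = m a) ∧
      ∃ c', p.RoundState D q x j T b (i + 1) (c + c') m' ∧ s ≤ c' * p.probeTime d + 5 := by
  have hb := hf.bound
  have hpw : 2 ^ w = 2 ^ p.J + 2 ^ p.J := by rw [hw, pow_succ]; ring
  have hpi : 2 ^ (i + 1) ≤ 2 ^ p.J := Nat.pow_le_pow_right (by norm_num) (by omega)
  have hpi' : 2 ^ (i + 1) = 2 ^ i + 2 ^ i := by rw [pow_succ]; ring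
  have hpos : 0 < 2 ^ i := by positivity
  simp only [roundProg, wp, Function.update_self]
  refine ⟨fun hlt => ?_, fun hlt => ?_⟩
  · have hlt' : m 19 < m 34 := by by_contra h; simp [h] at hlt
    obtain ⟨hrun, h37, rfl⟩ : p.Running D q x j T (2 ^ i - 1) m ∧ m 37 = 2 ^ i ∧ c = 2 ^ i - 1 := by
      rcases h.state with h | h
      · exact h
      · exact absurd hlt' h.1.not_lt
    have hcT : 2 ^ i - 1 < T := by rw [hrun.c34, hrun.c19] at hlt'; exact hlt'
    have hN := Layout.lt_probes (T := T) hcT.le hrun.no_coll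
    simp only [ne_eq, Nat.reduceEqDiff, not_false_eq_true, Function.update_of_ne, h37]
    apply wpRep_of_invariant (fun k m' s =>
      (∀ a, checkKeeps a → m' a = m a) ∧ m' 37 = 2 ^ i ∧ m' 18 = b - (2 ^ i - 1) - 2 ^ i ∧
      (p.Running D q x j T (2 ^ i - 1 + k) m' ∨ p.Finished D q x j T m') ∧
      s ≤ k * p.probeTime d)
    · refine ⟨fun a ha => ?_, by simp [h37], by simp [h.c18], Or.inl (hrun.congr ?_ ?_ ?_),
        by simp⟩
      · simp only [checkKeeps] at ha
        rw [Function.update_of_ne (by omega), Function.update_of_ne (by omega)]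
      all_goals simp
    · rintro k hk m1 s ⟨hfr, e37, e18, hst, hs⟩
      have hkeep : ∀ a, 2 ≤ a → a < 17 → m1 a = m a :=
        fun a _ h2 => hfr a (by simp only [checkKeeps]; omega)
      refine wp_mono _ _ _ _ ?_ (Layout.BlockMem.probeProg_spec (w := w) (d := d) hf hw hx hT
        (hm.congr hkeep) ((hfr 20 (by simp [checkKeeps])).trans h20) hst)
      rintro m2 s2 ⟨hfr2, hst2, hs2⟩
      refine ⟨fun a ha => (hfr2 a (Or.inl ha)).trans (hfr a ha), ?_, ?_, hst2, ?_⟩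
      · rw [hfr2 _ (by simp), e37]
      · rw [hfr2 _ (by simp), e18]
      · rw [add_mul]; simp only [Layout.probeTime] at hs ⊢; omega
    · rintro m1 s ⟨hfr, e37, e18, hst, hs⟩
      simp only [e37]
      refine ⟨by omega, fun a ha => ?_, 2 ^ i, ⟨?_, ?_⟩, by omega⟩
      · have ha' := ha
        simp only [checkKeeps] at ha
        rw [Function.update_of_ne (by omega), hfr a ha']
      · simp [e18]; omega
      · rcases hst with hst | hst
        · refine Or.inl ⟨?_, by simp [hpi'], by omega⟩
          rw [show 2 ^ (i + 1) - 1 = 2 ^ i - 1 + 2 ^ i by omega]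
          exact hst.congr (by simp) (by simp) (by simp)
        · exact Or.inr ⟨hst.congr (by simp) (by simp) (by simp), by omega⟩
  · have hlt' : ¬ m 19 < m 34 := by intro h; simp [h] at hlt
    refine ⟨fun a ha => ?_, 0, ⟨by simp [h.c18], ?_⟩, by omega⟩
    · simp only [checkKeeps] at ha
      rw [Function.update_of_ne (by omega)]
    · rcases h.state with ⟨hrun, -, rfl⟩ | ⟨hfin, hc⟩
      · right
        have hrun' := hrun
        rw [hrun.c34, hrun.c19] at hlt'
        have hle := hrun.le
        have heq : 2 ^ i - 1 = T := by omega
        rw [heq] at hrun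
        have hN := Layout.lt_probes (T := T) le_rfl hrun.no_coll
        have hfin : p.Finished D q x j T m := Or.inr hrun
        exact ⟨hfin.congr (by simp) (by simp) (by simp),
          by omega⟩
      · exact Or.inr ⟨hfin.congr (by simp) (by simp) (by simp), by simpa using hc⟩

open Classical in
/-- The loop of `J` rounds is long enough since it looks at up to `2 ^ J - 1` tables. The budget
paid is less than twice the number of tables that have to be looked at, and the running time is
governed by the budget paid, even where the remaining budget is truncated at zero. -/
theorem Layout.BlockMem.checkProg_spec {w d x j T b : ℕ} (hf : p.Fits D q) (hw : w = p.J + 1)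
    (hx : x < p.NB) (hT : T < p.L x) (hj : j < p.NB * p.Lm * p.n) {m : Mem}
    (hm : p.BlockMem x m) (h20 : m 20 = j) (h34 : m 34 = T) (h18 : m 18 = b) :
    wp w d D q checkProg m fun m' s => (∀ a, 2 ≤ a → checkKeeps a → m' a = m a) ∧
      (m' 0 = if ∀ s < T, ¬ p.Coll D q x j s then j + 1 else m 0) ∧
      (m' 1 = if ∀ s < T, ¬ p.Coll D q x j s then x else m 1) ∧
      ∃ c, m' 18 = b - c ∧ c + 1 ≤ 2 * p.probes D q x j T ∧
        s ≤ c * p.probeTime d + p.J * 6 + 7 := by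
  have hb := hf.bound
  have hpw : 2 ^ w = 2 ^ p.J + 2 ^ p.J := by rw [hw, pow_succ]; ring
  have hLm := hf.L_le x hx
  simp only [checkProg, wp]
  refine ⟨by positivity, by omega, by positivity, ?_⟩
  simp only [ne_eq, Nat.reduceEqDiff, not_false_eq_true, Function.update_of_ne, hm.c4]
  apply wpRep_of_invariant (fun i m' s => (∀ a, checkKeeps a → m' a = m a) ∧
    ∃ c, p.RoundState D q x j T b i c m' ∧ s ≤ c * p.probeTime d + i * 6)
  · refine ⟨fun a ha => ?_, 0, ⟨by simp [h18], Or.inl ⟨⟨?_, ?_, ?_, ?_, ?_⟩, ?_, ?_⟩⟩, ?_⟩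
    · simp only [checkKeeps] at ha
      rw [Function.update_of_ne (by omega), Function.update_of_ne (by omega),
        Function.update_of_ne (by omega)]
    all_goals simp [h34]
  · rintro i hi m1 s ⟨hfr, c, hst, hs⟩
    have hkeep : ∀ a, 2 ≤ a → a < 17 → m1 a = m a :=
      fun a _ h2 => hfr a (by simp only [checkKeeps]; omega)
    refine wp_mono _ _ _ _ ?_ (Layout.BlockMem.roundProg_spec (w := w) (d := d) hf hw hx hT hi
      (hm.congr hkeep) ((hfr 20 (by simp [checkKeeps])).trans h20) hst)
    rintro m2 s2 ⟨hfr2, c', hst2, hs2⟩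
    exact ⟨fun a ha => (hfr2 a ha).trans (hfr a ha), c + c', hst2, by rw [add_mul]; omega⟩
  · rintro m1 s ⟨hfr, c, hst, hs⟩
    have hfin : p.Finished D q x j T m1 ∧ c + 1 ≤ 2 * p.probes D q x j T := by
      rcases hst.state with ⟨hrun, -⟩ | h
      · have := hrun.le
        omega
      · exact h
    have e0 : ∀ a, a < 17 → m1 a = m a := fun a ha => hfr a (by simp only [checkKeeps]; omega)
    have e20 : m1 20 = j := (hfr 20 (by simp [checkKeeps])).trans h20
    refine ⟨fun h38 => ?_, fun h38 => ?_⟩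
    · have hex : ¬ ∀ s < T, ¬ p.Coll D q x j s := by
        rcases hfin.1 with ⟨-, -, s, hs, hc⟩ | h
        · exact fun h => h s hs hc
        · exact absurd h.c38 h38
      rw [if_neg hex, if_neg hex]
      exact ⟨fun a _ ha => hfr a ha, e0 0 (by omega), e0 1 (by omega), c, hst.c18, hfin.2,
        by omega⟩
    · have hall : ∀ s < T, ¬ p.Coll D q x j s := by
        rcases hfin.1 with ⟨h1, -⟩ | h
        · omega
        · exact h.no_coll
      rw [if_pos hall, if_pos hall]
      simp only [e20, e0 9 (by omega), hm.c9]
      refine ⟨by omega, fun a h2 ha => ?_, by simp, ?_, c, ?_, hfin.2, by omega⟩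
      · rw [Function.update_of_ne (by omega), Function.update_of_ne (by omega), hfr a ha]
      · simp [e0 2, e0 10, hm.c2, hm.c10]
      · simpa using hst.c18

end Trial
end Query

/-! ### The trial with a given bucket entry -/

namespace Query

section Trial

set_option linter.unusedSectionVars false

variable {M : Type u} [MetricSpace M] {F : ℝ → ℝ → HashFamily.{u, v} M}
variable {p : Layout} {D : DataStructure F} {q : M}

theorem Layout.total_succ (x t : ℕ) :
    p.total D q x (t + 1) = p.total D q x t + (p.hi D q x t - p.lo D q x t) := by
  rw [Layout.total, Finset.sum_range_succ]; rfl

theorem Layout.total_mono (x : ℕ) : Monotone (p.total D q x) :=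
  monotone_nat_of_le_succ fun t => by rw [Layout.total_succ]; omega

theorem Layout.total_succ_le_iff {x u i : ℕ} (hi : i < p.L x) :
    i < p.tbl D q x u ↔ p.total D q x (i + 1) ≤ u :=
  lt_card_filter_range_iff (fun _ _ hij _ h => (Layout.total_mono x (by omega)).trans h) hi

theorem Layout.tbl_lt {x u : ℕ} (hu : u < p.total D q x (p.L x)) : p.tbl D q x u < p.L x := by
  by_contra h
  have h0 : 0 < p.L x := by
    rcases Nat.eq_zero_or_pos (p.L x) with h0 | h0
    · rw [h0] at hu; simp [Layout.total] at hu
    · exact h0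
  have := (Layout.total_succ_le_iff (p := p) (D := D) (q := q) (x := x) (u := u)
    (i := p.L x - 1) (by omega)).1 (by omega)
  rw [Nat.sub_add_cancel h0] at this
  omega

theorem Layout.lt_total_tbl {x u : ℕ} (hu : u < p.total D q x (p.L x)) :
    u < p.total D q x (p.tbl D q x u + 1) := by
  by_contra h
  exact lt_irrefl _ ((Layout.total_succ_le_iff (Layout.tbl_lt hu)).2 (not_lt.1 h))

theorem Layout.total_tbl_le {x u : ℕ} (hu : u < p.total D q x (p.L x)) :
    p.total D q x (p.tbl D q x u) ≤ u := by
  rcases Nat.eq_zero_or_pos (p.tbl D q x u) with h | h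
  · rw [h]; simp [Layout.total]
  · have := (Layout.total_succ_le_iff (p := p) (D := D) (q := q) (x := x) (u := u)
      (i := p.tbl D q x u - 1) (by have := Layout.tbl_lt hu; omega)).1 (by omega)
    rwa [Nat.sub_add_cancel h] at this

/-- The position of a bucket entry, counted from the start of the bucket. -/
theorem Layout.offset_eq {x u : ℕ} (hu : u < p.total D q x (p.L x)) :
    p.hi D q x (p.tbl D q x u) + u - p.total D q x (p.tbl D q x u + 1) =
      p.lo D q x (p.tbl D q x u) + (u - p.total D q x (p.tbl D q x u)) ∧
    u - p.total D q x (p.tbl D q x u) <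
      p.hi D q x (p.tbl D q x u) - p.lo D q x (p.tbl D q x u) := by
  have h1 := Layout.lt_total_tbl hu
  have h2 := Layout.total_tbl_le hu
  have h3 := p.lo_le_hi (D := D) (q := q) x (p.tbl D q x u)
  rw [Layout.total_succ] at h1 ⊢
  omega

theorem Layout.Fits.idx_lt (hf : p.Fits D q) {x u : ℕ} (hx : x < p.NB)
    (hu : u < p.total D q x (p.L x)) : p.idx D q x u < p.NB * p.Lm * p.n := by
  have h1 := Layout.offset_eq hu
  have h2 := hf.index_lt hx (Layout.tbl_lt hu)
  have h3 := p.hi_le (D := D) (q := q) x (p.tbl D q x u)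
  rw [Layout.idx, h1.1]
  omega

/-- The invariant of the trials in block `x`. -/
structure Layout.TrialMem (p : Layout) (D : DataStructure F) (q : M) (x : ℕ) (m : Mem) : Prop
    extends p.BlockMem x m where
  c17 : m 17 = p.total D q x (p.L x)
  arr : p.Arr D q x (p.L x) m
  pos : m 18 ≠ 0 → m 17 ≠ 0

theorem Layout.BlockMem.sumTest_spec {w d x u c : ℕ} (hf : p.Fits D q) (hw : w = p.J + 1)
    (hx : x < p.NB) {m : Mem} (hm : p.BlockMem x m) (harr : p.Arr D q x (p.L x) m)
    (h33 : m 33 = u) (h27 : m 27 = c) (hc : 1 ≤ c) (hcn : c ≤ p.L x) :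
    wp w d D q sumTest m fun m' s =>
      (∀ a, a < 20 ∨ (25 ≤ a ∧ a ≤ 27) ∨ 29 < a → m' a = m a) ∧
        m' 28 = (if p.total D q x (c - 1 + 1) ≤ u then 1 else 0) ∧ s ≤ 6 := by
  have hb := hf.bound
  have hpw : 2 ^ w = 2 ^ p.J + 2 ^ p.J := by rw [hw, pow_succ]; ring
  have hLm := hf.L_le x hx
  have ha : c + c + 100 - 1 = 101 + 2 * (c - 1) := by omega
  simp only [sumTest, wp]
  simp only [ne_eq, Nat.reduceEqDiff, not_false_eq_true, Function.update_of_ne,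
    Function.update_self, Function.update_idem, hm.c9, hm.c10, hm.c11, h27, h33, ha]
  rw [Function.update_of_ne (show 101 + 2 * (c - 1) ≠ 29 by omega), (harr (c - 1) (by omega)).2]
  refine ⟨by omega, by omega, fun a ha => ?_, ?_, by omega⟩
  · rw [Function.update_of_ne (by omega), Function.update_of_ne (by omega)]
  · by_cases h : p.total D q x (c - 1 + 1) ≤ u
    · simp [h]
    · simp [h, not_le.1 h]

/-- A bound for the time of one trial, per unit of budget. -/
def Layout.trialTime (p : Layout) (d : ℕ) : ℕ := p.probeTime d + p.J * 19 + d + 30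

open Classical in
/-- The trial with entry `u` answers exactly if `u` is accepted. The number `c` of units that it
uses may exceed the budget `b` that is left, since a trial is never interrupted. -/
theorem Layout.TrialMem.pickProg_spec {w d x u b : ℕ} (hf : p.Fits D q) (hw : w = p.J + 1)
    (hx : x < p.NB) {m : Mem} (hm : p.TrialMem D q x m) (hu : u < p.total D q x (p.L x))
    (h33 : m 33 = u) (h18 : m 18 = b) :
    wp w d D q pickProg m fun m' s => p.TrialMem D q x m' ∧
      (m' 0 = if p.Acc D q x u then p.idx D q x u + 1 else m 0) ∧
      (m' 1 = if p.Acc D q x u then x else m 1) ∧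
      ∃ c, m' 18 = b - c ∧ 1 ≤ c ∧ c ≤ p.cost D q x u ∧ s + 5 ≤ c * p.trialTime d := by
  have hb := hf.bound
  have hpw : 2 ^ w = 2 ^ p.J + 2 ^ p.J := by rw [hw, pow_succ]; ring
  have hLm := hf.L_le x hx
  have hT := Layout.tbl_lt hu
  simp only [pickProg, wp]
  simp only [ne_eq, Nat.reduceEqDiff, not_false_eq_true, Function.update_of_ne,
    h18, hm.c9, hm.c14, hm.c10, Nat.sub_zero]
  have e1 : ∀ a, a ≠ 18 → a ≠ 30 →
      Function.update (Function.update m 18 (b - 1)) 30 (p.L x) a = m a := fun a h h' => by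
    rw [Function.update_of_ne h', Function.update_of_ne h]
  have hsearch : ∀ m0 : Mem, (∀ a, a ≠ 18 → a ≠ 30 → m0 a = m a) → m0 30 = p.L x →
      wp w d D q (searchProg sumTest) m0 fun m' s =>
        (∀ a, a < 20 ∨ 29 < a → m' a = m0 a) ∧ m' 25 = p.tbl D q x u ∧ s ≤ p.J * (6 + 7) + 3 := by
    intro m0 h0 h30
    refine searchProg_spec (pred := fun i => p.total D q x (i + 1) ≤ u)
      (by rw [h0 _ (by omega) (by omega), hm.c4]) (by rw [h0 _ (by omega) (by omega), hm.c5])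
      (by rw [h0 _ (by omega) (by omega), hm.c10]) (by rw [h0 _ (by omega) (by omega), hm.c13])
      h30 (by omega) hw hT.le (fun i hi => Layout.total_succ_le_iff hi) ?_
    intro c m' hc hcn hfr h27
    refine Layout.BlockMem.sumTest_spec hf hw hx (hm.toBlockMem.congr fun a h1 h2 => ?_)
      (fun t ht => ?_) ?_ h27 hc hcn
    · rw [hfr _ (by omega), h0 _ (by omega) (by omega)]
    · rw [hfr _ (by omega), h0 _ (by omega) (by omega), hfr _ (by omega),
        h0 _ (by omega) (by omega)]
      exact hm.arr t ht
    · rw [hfr _ (by omega), h0 _ (by omega) (by omega), h33]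
  refine wp_mono _ _ _ _ ?_ (hsearch _ e1 (by simp))
  rintro m1 s1 ⟨hfr, h25, hs1⟩
  have e18 : m1 18 = b - 1 := by rw [hfr _ (by omega)]; simp
  have hk : ∀ a, (a < 18 ∨ a = 19 ∨ 30 < a) → m1 a = m a := fun a ha => by
    rw [hfr a (by omega), e1 a (by omega) (by omega)]
  have hm1 : p.BlockMem x m1 := hm.toBlockMem.congr fun a h1 h2 => hk a (by omega)
  have e33 : m1 33 = u := by rw [hk _ (by omega), h33]
  have harr : p.Arr D q x (p.L x) m1 := fun t ht => by
    rw [hk _ (by omega), hk _ (by omega)]; exact hm.arr t ht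
  have hrow := hf.row_lt hx hT
  have hidx := hf.idx_lt hx hu
  have hhi := p.hi_le (D := D) (q := q) x (p.tbl D q x u)
  have htot := hf.total_le (x := x) hx (t := p.L x) le_rfl
  have hmul : p.NB * p.Lm * (p.Km + 1) = p.NB * p.Lm * p.Km + p.NB * p.Lm := by ring
  have hnb : p.NB * p.Lm * p.n ≤ 2 ^ p.J := by omega
  have hidx' := hidx
  rw [Layout.idx] at hidx'
  have hacc : p.Acc D q x u ↔ nearValue D q (p.idx D q x u) x ≠ 0 ∧
    ∀ s < p.tbl D q x u, ¬ p.Coll D q x (p.idx D q x u) s := Iff.rfl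
  have hcost : p.cost D q x u = if nearValue D q (p.idx D q x u) x = 0 then 1
    else 2 * p.probes D q x (p.idx D q x u) (p.tbl D q x u) := rfl
  have hidxe : p.idx D q x u = (x * p.Lm + p.tbl D q x u) * p.n +
    (p.hi D q x (p.tbl D q x u) + u - p.total D q x (p.tbl D q x u + 1)) := rfl
  generalize p.tbl D q x u = T at *
  generalize p.idx D q x u = j at *
  simp only [ne_eq, Nat.reduceEqDiff, not_false_eq_true, Function.update_of_ne,
    Function.update_self, h25, hm1.c10, Nat.sub_zero, hm1.c11, hm1.c9, Function.update_idem, e33,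
    hm1.c16, hm1.c3, hm1.c2]
  have hA : T + T + 100 = 100 + 2 * T := by omega
  have hA1 : 100 + 2 * T + 1 = 101 + 2 * T := by omega
  simp only [hA, hA1]
  rw [(harr T hT).1, (harr T hT).2]
  rw [← hidxe]
  generalize hm2 : Function.update (_ : Mem) 36 (nearValue D q j x) = m2
  have hk2 : ∀ a, (a < 18 ∨ a = 19 ∨ 36 < a) → m2 a = m a := fun a ha => by
    rw [← hm2]
    repeat rw [Function.update_of_ne (by omega)]
    exact hk a (by omega)
  have f20 : m2 20 = j := by rw [← hm2]; simp
  have f34 : m2 34 = T := by rw [← hm2]; simp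
  have f18 : m2 18 = b - 1 := by rw [← hm2]; simp [e18]
  have hm2b : p.BlockMem x m2 := hm.toBlockMem.congr fun a h1 h2 => hk2 a (by omega)
  refine ⟨by omega, by omega, by omega, by omega, by omega, by omega, by omega, ?_, ?_⟩
  · intro hnear
    refine wp_mono _ _ _ _ ?_ (Layout.BlockMem.checkProg_spec hf hw hx hT hidx hm2b f20 f34 f18)
    rintro m3 s3 ⟨hfr3, h0, h1, c, hc18, hcN, hs3⟩
    have hiff : (p.Acc D q x u ↔ ∀ s < T, ¬ p.Coll D q x j s) := by
      rw [hacc]; exact ⟨fun h => h.2, fun h => ⟨hnear, h⟩⟩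
    have hk3 : ∀ a, (2 ≤ a ∧ a < 18) ∨ 39 < a → m3 a = m a := fun a ha => by
      rw [hfr3 a (by omega) (by simp only [checkKeeps]; omega), hk2 a (by omega)]
    refine ⟨⟨hm.toBlockMem.congr fun a h1 h2 => hk3 a (by omega), ?_, fun t ht => ?_, ?_⟩, ?_, ?_,
      c + 1, ?_, by omega, ?_, ?_⟩
    · rw [hk3 _ (by omega), hm.c17]
    · rw [hk3 _ (by omega), hk3 _ (by omega)]; exact hm.arr t ht
    · intro _; rw [hk3 _ (by omega), hm.c17]; omega
    · simp only [hiff]; rw [h0, hk2 0 (by omega)]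
    · simp only [hiff]; rw [h1, hk2 1 (by omega)]
    · rw [hc18]; omega
    · rw [hcost, if_neg hnear]; omega
    · have : (c + 1) * p.trialTime d =
        c * p.probeTime d + (c * (p.J * 19 + d + 30) + p.trialTime d) := by
        simp only [Layout.trialTime]; ring
      rw [this]
      have := Nat.zero_le (c * (p.J * 19 + d + 30))
      simp only [Layout.trialTime]
      clear * - hs1 hs3
      omega
  · intro hnear
    have hna : ¬ p.Acc D q x u := by rw [hacc]; exact fun h => h.1 hnear
    rw [if_neg hna, if_neg hna]
    refine ⟨⟨hm2b, ?_, fun t ht => ?_, ?_⟩, hk 0 (by omega), hk 1 (by omega), 1, e18, le_rfl, ?_, ?_⟩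
    · rw [hk2 _ (by omega), hm.c17]
    · rw [hk2 _ (by omega), hk2 _ (by omega)]; exact hm.arr t ht
    · intro _; rw [hk2 _ (by omega), hm.c17]; omega
    · rw [hcost, if_pos hnear]
    · rw [one_mul]
      simp only [Layout.trialTime]
      clear * - hs1
      omega

end Trial
end Query

/-! ### Expectations and fairness of random programs -/

section Expect

/-- The expectation of a nonnegative function of a discrete random variable. -/
noncomputable def PMF.expect {α : Type*} (ν : PMF α) (φ : α → ENNReal) : ENNReal :=
  ∑' a, ν a * φ a

namespace PMF

variable {α β : Type*}

theorem expect_pure (a : α) (φ : α → ENNReal) : (PMF.pure a).expect φ = φ a := by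
  classical
  unfold expect
  rw [tsum_eq_single a (fun b hb => by simp [PMF.pure_apply, hb])]
  simp

theorem expect_bind (ν : PMF α) (f : α → PMF β) (φ : β → ENNReal) :
    (ν.bind f).expect φ = ν.expect fun a => (f a).expect φ := by
  unfold expect
  simp only [PMF.bind_apply, ← ENNReal.tsum_mul_right, ← ENNReal.tsum_mul_left]
  rw [ENNReal.tsum_comm]
  simp only [mul_assoc]

theorem expect_map (ν : PMF α) (g : α → β) (φ : β → ENNReal) :
    (ν.map g).expect φ = ν.expect fun a => φ (g a) := by
  rw [← PMF.bind_pure_comp, expect_bind]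
  simp only [Function.comp_apply, expect_pure]

theorem expect_mono {ν : PMF α} {φ ψ : α → ENNReal} (h : ∀ a ∈ ν.support, φ a ≤ ψ a) :
    ν.expect φ ≤ ν.expect ψ := by
  refine ENNReal.tsum_le_tsum fun a => ?_
  by_cases ha : a ∈ ν.support
  · exact mul_le_mul_right (h a ha) _
  · rw [PMF.mem_support_iff, not_not] at ha
    simp [ha]

theorem expect_congr {ν : PMF α} {φ ψ : α → ENNReal} (h : ∀ a ∈ ν.support, φ a = ψ a) :
    ν.expect φ = ν.expect ψ :=
  le_antisymm (expect_mono fun a ha => (h a ha).le) (expect_mono fun a ha => (h a ha).ge)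

theorem expect_const (ν : PMF α) (c : ENNReal) : (ν.expect fun _ => c) = c := by
  unfold expect
  rw [ENNReal.tsum_mul_right, ν.tsum_coe, one_mul]

theorem expect_add (ν : PMF α) (φ ψ : α → ENNReal) :
    (ν.expect fun a => φ a + ψ a) = ν.expect φ + ν.expect ψ := by
  unfold expect
  simp only [mul_add, ENNReal.tsum_add]

theorem expect_mul_const (ν : PMF α) (φ : α → ENNReal) (c : ENNReal) :
    (ν.expect fun a => φ a * c) = ν.expect φ * c := by
  unfold expect
  simp only [← mul_assoc, ENNReal.tsum_mul_right]

theorem expect_sum {ι : Type*} (ν : PMF α) (s : Finset ι) (φ : ι → α → ENNReal) :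
    (ν.expect fun a => ∑ i ∈ s, φ i a) = ∑ i ∈ s, ν.expect (φ i) := by
  classical
  induction s using Finset.induction_on with
  | empty => simp [expect]
  | insert i s hi ih => simp only [Finset.sum_insert hi, expect_add, ih]

theorem expect_uniform (n : ℕ) (φ : Fin (n + 1) → ENNReal) :
    (PMF.uniformOfFintype (Fin (n + 1))).expect φ = (∑ u, φ u) / (n + 1 : ℕ) := by
  unfold expect
  rw [tsum_fintype]
  simp only [PMF.uniformOfFintype_apply, Fintype.card_fin, ← Finset.mul_sum]
  rw [mul_comm, div_eq_mul_inv]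

theorem apply_eq_expect [DecidableEq α] (ν : PMF α) (a : α) :
    ν a = ν.expect fun b => if b = a then 1 else 0 := by
  unfold expect
  rw [tsum_eq_single a (fun b hb => by simp [hb])]
  simp

end PMF

end Expect

section Fair

variable {M : Type u} {F : ℝ → ℝ → HashFamily.{u, v} M}

/-- The event that the run from which `m` results has accepted the point `p` in block `y`. -/
def AcceptedIn (D : DataStructure F) (y : ℕ) (p : M) (m : Mem) : Prop :=
  readAnswer D m = some p ∧ m 1 = y

open Classical in
/-- The indicator of the event that `p` has been accepted in block `y`. -/
noncomputable def acceptInd (D : DataStructure F) (y : ℕ) (p : M) (x : Mem × ℕ) : ENNReal :=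
  if AcceptedIn D y p x.1 then 1 else 0

/-- The indicator of the event that no point has been accepted. -/
noncomputable def failInd (x : Mem × ℕ) : ENNReal := if x.1 0 = 0 then 1 else 0

/-- The random computation `f`, started in `m`, is fair with respect to the sets `Bl y`: an answer
that is already there is kept, and a new answer is, for every block `y`, each of the points of
`Bl y` with the same probability and no other point. -/
structure FairFrom (D : DataStructure F) (Bl : ℕ → Finset M) (f : Mem → PMF (Mem × ℕ)) (m : Mem) :
    Prop where
  keep : m 0 ≠ 0 → ∀ x ∈ (f m).support, x.1 0 = m 0 ∧ x.1 1 = m 1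
  valid : m 0 = 0 → ∀ x ∈ (f m).support, x.1 0 ≠ 0 → readAnswer D x.1 ≠ none
  fair : m 0 = 0 → ∀ y p p', p ∈ Bl y → p' ∈ Bl y →
    (f m).expect (acceptInd D y p) = (f m).expect (acceptInd D y p')
  null : m 0 = 0 → ∀ y p, p ∉ Bl y → (f m).expect (acceptInd D y p) = 0

variable {D : DataStructure F} {Bl : ℕ → Finset M}

theorem readAnswer_congr {m m' : Mem} (h : m 0 = m' 0) : readAnswer D m = readAnswer D m' := by
  simp only [readAnswer, h]

theorem acceptInd_congr {y : ℕ} {p : M} {x x' : Mem × ℕ} (h0 : x.1 0 = x'.1 0)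
    (h1 : x.1 1 = x'.1 1) : acceptInd D y p x = acceptInd D y p x' := by
  have : AcceptedIn D y p x.1 ↔ AcceptedIn D y p x'.1 := by
    simp only [AcceptedIn, readAnswer_congr h0, h1]
  classical
  exact if_congr this rfl rfl

theorem acceptInd_eq_zero {y : ℕ} {p : M} {x : Mem × ℕ} (h0 : x.1 0 = 0) :
    acceptInd D y p x = 0 := by
  simp [acceptInd, AcceptedIn, readAnswer, h0]

/-- Sequential composition of fair computations, with any bookkeeping `t` of step counts. -/
theorem FairFrom.comp {f g : Mem → PMF (Mem × ℕ)} {m : Mem} (t : ℕ → ℕ → ℕ)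
    (hf : FairFrom D Bl f m) (hg : ∀ x ∈ (f m).support, FairFrom D Bl g x.1) :
    FairFrom D Bl (fun m => (f m).bind fun x => (g x.1).map fun y => (y.1, t x.2 y.2)) m := by
  classical
  have key : m 0 = 0 → ∀ y p,
      ((f m).bind fun x => (g x.1).map fun z => (z.1, t x.2 z.2)).expect (acceptInd D y p) =
        (f m).expect (acceptInd D y p) +
          (f m).expect fun x => if x.1 0 = 0 then (g x.1).expect (acceptInd D y p) else 0 := by
    intro hm y p
    rw [PMF.expect_bind, ← PMF.expect_add]
    refine PMF.expect_congr fun x hx => ?_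
    rw [PMF.expect_map]
    by_cases h0 : x.1 0 = 0
    · rw [if_pos h0, acceptInd_eq_zero h0, zero_add]
      rfl
    · rw [if_neg h0, add_zero, ← PMF.expect_const (g x.1) (acceptInd D y p x)]
      refine PMF.expect_congr fun z hz => ?_
      have := (hg x hx).keep h0 z hz
      exact acceptInd_congr this.1 this.2
  refine ⟨?_, ?_, ?_, ?_⟩
  · intro hm z hz
    simp only [PMF.mem_support_bind_iff, PMF.mem_support_map_iff] at hz
    obtain ⟨x, hx, y, hy, rfl⟩ := hz
    have h1 := hf.keep hm x hx
    have h2 := (hg x hx).keep (by rw [h1.1]; exact hm) y hy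
    exact ⟨h2.1.trans h1.1, h2.2.trans h1.2⟩
  · intro hm z hz hz0
    simp only [PMF.mem_support_bind_iff, PMF.mem_support_map_iff] at hz
    obtain ⟨x, hx, y, hy, rfl⟩ := hz
    by_cases h0 : x.1 0 = 0
    · exact (hg x hx).valid h0 y hy hz0
    · rw [readAnswer_congr (m' := x.1) ((hg x hx).keep h0 y hy).1]
      exact hf.valid hm x hx h0
  · intro hm y p p' hp hp'
    rw [key hm, key hm, hf.fair hm y p p' hp hp']
    congr 1
    refine PMF.expect_congr fun x hx => ?_
    split_ifs with h0
    · exact (hg x hx).fair h0 y p p' hp hp'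
    · rfl
  · intro hm y p hp
    rw [key hm, hf.null hm y p hp, zero_add]
    refine (PMF.expect_congr (ψ := fun _ => 0) fun x hx => ?_).trans (PMF.expect_const _ _)
    split_ifs with h0
    · exact (hg x hx).null h0 y p hp
    · rfl

/-- A deterministic step that does not touch the answer is fair. -/
theorem FairFrom.of_pure {f : Mem → PMF (Mem × ℕ)} {m : Mem} {x : Mem × ℕ}
    (hf : f m = PMF.pure x) (h0 : x.1 0 = m 0) (h1 : x.1 1 = m 1) : FairFrom D Bl f m := by
  refine ⟨?_, ?_, ?_, ?_⟩
  · intro _ y hy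
    rw [hf, PMF.support_pure, Set.mem_singleton_iff] at hy
    subst hy; exact ⟨h0, h1⟩
  · intro hm y hy hy0
    rw [hf, PMF.support_pure, Set.mem_singleton_iff] at hy
    subst hy; exact absurd (h0.trans hm) hy0
  · intro hm y p p' _ _
    rw [hf, PMF.expect_pure, PMF.expect_pure, acceptInd_eq_zero (h0.trans hm),
      acceptInd_eq_zero (h0.trans hm)]
  · intro hm y p _
    rw [hf, PMF.expect_pure, acceptInd_eq_zero (h0.trans hm)]

theorem FairFrom.repeatSteps {f : Mem → PMF (Mem × ℕ)} (I : ℕ → Mem → Prop) (N : ℕ)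
    (hf : ∀ i m, i < N → I i m → FairFrom D Bl f m ∧ ∀ x ∈ (f m).support, I (i + 1) x.1) (n : ℕ) :
    ∀ i m, i + n = N → I i m → FairFrom D Bl (repeatSteps f n) m := by
  induction n with
  | zero => exact fun i m _ _ => FairFrom.of_pure rfl rfl rfl
  | succ n ih =>
    intro i m hi hm
    have h := hf i m (by omega) hm
    exact h.1.comp (g := _root_.repeatSteps f n) (fun a b => a + b + 1)
      fun x hx => ih (i + 1) x.1 (by omega) (h.2 x hx)

theorem expect_failInd_le_one (ν : PMF (Mem × ℕ)) : ν.expect failInd ≤ 1 := by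
  rw [← PMF.expect_const ν 1]
  refine PMF.expect_mono fun x _ => ?_
  unfold failInd
  split_ifs <;> simp

theorem FairFrom.expect_failInd_eq_zero {f : Mem → PMF (Mem × ℕ)} {m : Mem}
    (hf : FairFrom D Bl f m) (hm : m 0 ≠ 0) : (f m).expect failInd = 0 := by
  rw [← PMF.expect_const (f m) 0]
  refine PMF.expect_congr fun x hx => ?_
  rw [failInd, if_neg (by rw [(hf.keep hm x hx).1]; exact hm)]

/-- The probabilities to fail multiply under composition. -/
theorem FairFrom.expect_failInd_comp_le {f g : Mem → PMF (Mem × ℕ)} {m : Mem} (t : ℕ → ℕ → ℕ)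
    (hg : ∀ x ∈ (f m).support, FairFrom D Bl g x.1) (c c' : ENNReal)
    (hc : (f m).expect failInd ≤ c)
    (hc' : ∀ x ∈ (f m).support, x.1 0 = 0 → (g x.1).expect failInd ≤ c') :
    ((f m).bind fun x => (g x.1).map fun y => (y.1, t x.2 y.2)).expect failInd ≤ c * c' := by
  rw [PMF.expect_bind]
  calc _ ≤ (f m).expect fun x => failInd x * c' := by
        refine PMF.expect_mono fun x hx => ?_
        rw [PMF.expect_map]
        by_cases h0 : x.1 0 = 0
        · rw [show failInd x = 1 from if_pos h0, one_mul]
          exact hc' x hx h0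
        · exact ((hg x hx).expect_failInd_eq_zero h0).le.trans (zero_le)
    _ = (f m).expect failInd * c' := PMF.expect_mul_const _ _ _
    _ ≤ c * c' := mul_le_mul_left hc _

theorem FairFrom.expect_failInd_repeatSteps_le {f : Mem → PMF (Mem × ℕ)} (I : ℕ → Mem → Prop)
    (N : ℕ) (c : ℕ → ENNReal)
    (hf : ∀ i m, i < N → I i m → FairFrom D Bl f m ∧ ∀ x ∈ (f m).support, I (i + 1) x.1)
    (hc : ∀ i m, i < N → I i m → m 0 = 0 → (f m).expect failInd ≤ c i) (n : ℕ) :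
    ∀ i m, i + n = N → I i m → m 0 = 0 →
      (_root_.repeatSteps f n m).expect failInd ≤ ∏ j ∈ Finset.range n, c (i + j) := by
  induction n with
  | zero => exact fun i m _ _ _ => by simpa using expect_failInd_le_one _
  | succ n ih =>
    intro i m hi hI hm
    have h := hf i m (by omega) hI
    rw [Finset.prod_range_succ']
    rw [mul_comm]
    refine FairFrom.expect_failInd_comp_le (D := D) (Bl := Bl) (f := f)
      (g := _root_.repeatSteps f n) (fun a b => a + b + 1)
      (fun x hx => FairFrom.repeatSteps I N hf n (i + 1) x.1 (by omega) (h.2 x hx)) _ _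
      (hc i m (by omega) hI hm) fun x hx hx0 => ?_
    have := ih (i + 1) x.1 (by omega) (h.2 x hx) hx0
    simpa only [add_assoc, add_comm 1] using this

end Fair

/-! ### The law of a single trial -/

namespace Query

section TrialLaw

set_option linter.unusedSectionVars false

variable {M : Type u} [MetricSpace M] {F : ℝ → ℝ → HashFamily.{u, v} M}
variable {p : Layout} {D : DataStructure F} {q : M}

theorem pickProg_randFree : pickProg.RandFree := by
  simp [pickProg, searchProg, searchBody, sumTest, checkProg, roundProg, probeProg, cmpProg,
    cmpBody, Prog.RandFree]

theorem setupProg_randFree : setupProg.RandFree := by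
  simp [setupProg, intervalsProg, intervalsBody, searchProg, searchBody, bucketTest, cmpProg,
    cmpBody, Prog.RandFree]

theorem initProg_randFree : initProg.RandFree := by
  simp [initProg, Prog.RandFree]

theorem Layout.Fits.two_le (hf : p.Fits D q) {w : ℕ} (hw : w = p.J + 1) : 2 ≤ w := by
  have hb := hf.bound
  by_contra h
  have : p.J = 0 := by omega
  rw [this] at hb
  omega

/-- Trials in which nothing is left to do. -/
theorem exec_trialProg_skip {w d : ℕ} {m : Mem} (h : m 0 ≠ 0 ∨ m 18 = 0) :
    ∃ s ≤ 3, trialProg.exec w d D q m = PMF.pure (m, s) := by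
  by_cases h0 : m 0 = 0
  · have h18 : m 18 = 0 := by tauto
    exact ⟨3, le_rfl, by simp [trialProg, Prog.exec, h0, h18, PMF.pure_map]⟩
  · exact ⟨2, by omega, by simp [trialProg, Prog.exec, h0, PMF.pure_map]⟩

/-- What the trial with the bucket entry number `u` does to a memory `m`. -/
structure Layout.TrialStep (p : Layout) (D : DataStructure F) (q : M) (w d x u : ℕ) (m : Mem)
    (y : Mem × ℕ) : Prop where
  words : IsWords w y.1
  mem : p.TrialMem D q x y.1
  ans_acc : p.Acc D q x u → y.1 0 = p.idx D q x u + 1 ∧ y.1 1 = x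
  ans_not_acc : ¬ p.Acc D q x u → y.1 0 = 0
  cost : ∃ c, y.1 18 = m 18 - c ∧ 1 ≤ c ∧ c ≤ p.cost D q x u ∧ y.2 ≤ c * p.trialTime d

/-- The law of a trial is the image of the uniform law on the bucket entries. -/
theorem Layout.TrialMem.exec_trialProg {w d x : ℕ} (hf : p.Fits D q) (hw : w = p.J + 1)
    (hx : x < p.NB) {m : Mem} (hmw : IsWords w m) (hm : p.TrialMem D q x m) (h0 : m 0 = 0)
    (h18 : m 18 ≠ 0) :
    ∃ res : ℕ → Mem × ℕ,
      (∀ u < p.total D q x (p.L x), p.TrialStep D q w d x u m (res u)) ∧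
      (∀ y ∈ (trialProg.exec w d D q m).support, ∃ u < p.total D q x (p.L x), y = res u) ∧
      ∀ φ, (trialProg.exec w d D q m).expect φ =
        (∑ u ∈ Finset.range (p.total D q x (p.L x)), φ (res u)) / (p.total D q x (p.L x) : ℕ) := by
  classical
  have hW := hm.pos h18
  rw [hm.c17] at hW
  obtain ⟨W, hWW⟩ := Nat.exists_eq_succ_of_ne_zero hW
  have hWlt : p.total D q x (p.L x) < 2 ^ w := by rw [← hm.c17]; exact hmw 17
  set m1 := Function.update m 33 W with hm1
  have key : ∀ u < p.total D q x (p.L x), ∃ y : Mem × ℕ,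
      pickProg.exec w d D q (Function.update m1 33 u) = PMF.pure y ∧
        p.TrialStep D q w d x u m (y.1, y.2 + 4) := by
    intro u hu
    have hk : ∀ a, a ≠ 33 → Function.update m1 33 u a = m a := fun a ha => by
      rw [Function.update_of_ne ha, hm1, Function.update_of_ne ha]
    have hmem : p.TrialMem D q x (Function.update m1 33 u) := by
      refine ⟨hm.toBlockMem.congr fun a h1 h2 => hk a (by omega), ?_, fun t ht => ?_, ?_⟩
      · rw [hk _ (by omega), hm.c17]
      · rw [hk _ (by omega), hk _ (by omega)]; exact hm.arr t ht
      · rw [hk _ (by omega), hk _ (by omega)]; exact hm.pos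
    have hwords : IsWords w (Function.update m1 33 u) :=
      (hmw.update 33 (by omega)).update 33 (by omega)
    obtain ⟨y, hy, hyw, hyP⟩ := pickProg_randFree.exists_outcome (hf.two_le hw) hwords
      (Layout.TrialMem.pickProg_spec (d := d) hf hw hx hmem hu (by simp) rfl)
    obtain ⟨h1, h2, h3, c, h4, h5, h6, h7⟩ := hyP
    refine ⟨y, hy, hyw, h1, fun ha => ?_, fun ha => ?_, c, ?_, h5, h6, by omega⟩
    · rw [if_pos ha] at h2 h3; exact ⟨h2, h3⟩
    · rw [if_neg ha] at h2; rw [h2, hk 0 (by omega), h0]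
    · rw [h4, hk _ (by omega)]
  choose! res hres hstep using key
  have hexec : trialProg.exec w d D q m =
      (PMF.uniformOfFintype (Fin (W + 1))).map fun u : Fin (W + 1) => ((res u).1, (res u).2 + 4) := by
    have e : trialProg.exec w d D q m = (PMF.uniformOfFintype (Fin (W + 1))).bind fun u =>
        (pickProg.exec w d D q (Function.update m1 33 u)).map fun y => (y.1, y.2 + 4) := by
      have hmW : m 17 - m 9 = W := by rw [hm.c17, hm.c9, hWW]; simp
      have hWm : W % 2 ^ w = W := Nat.mod_eq_of_lt (by omega)
      have hsub : (Prog.arith .sub 33 17 9).exec w d D q m = PMF.pure (m1, 1) := by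
        simp only [Prog.exec, WordOp.eval, hmW, hWm, hm1]
      have hrand : ∀ m' : Mem, m' 33 = W → (Prog.rand 33 33).exec w d D q m' =
          (PMF.uniformOfFintype (Fin (W + 1))).map
            fun u : Fin (W + 1) => (Function.update m' 33 (u.val % 2 ^ w), 1) := by
        rintro m' rfl; rfl
      rw [trialProg, Prog.exec, if_neg (not_not.2 h0), Prog.exec, if_pos h18, Prog.exec, hsub,
        PMF.pure_bind, Prog.exec, hrand m1 (by simp [hm1])]
      simp only [PMF.map_comp, PMF.map_bind, PMF.bind_map]
      congr 1
      funext u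
      have hu : (u : ℕ) % 2 ^ w = u := Nat.mod_eq_of_lt (by have := u.2; omega)
      simp only [Function.comp_def, hu, PMF.map_comp]
      refine congrArg (fun f => PMF.map f _) ?_
      funext y
      simp only [Prod.mk.injEq, true_and]
      omega
    rw [e, ← PMF.bind_pure_comp]
    congr 1
    funext u
    rw [hres u (by have := u.2; omega), PMF.pure_map]
    rfl
  refine ⟨fun u => ((res u).1, (res u).2 + 4), hstep, fun y hy => ?_, fun φ => ?_⟩
  · rw [hexec, PMF.mem_support_map_iff] at hy
    obtain ⟨u, -, rfl⟩ := hy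
    exact ⟨u, by have := u.2; omega, rfl⟩
  · rw [hexec, PMF.expect_map, PMF.expect_uniform, hWW]
    rw [Finset.sum_range (n := W + 1)]

/-- The near points of block `x` are exactly the accepted ones, each at one bucket entry. -/
structure Layout.Covered (p : Layout) (D : DataStructure F) (q : M) (x : ℕ) (B : Finset M) :
    Prop where
  mem : ∀ u < p.total D q x (p.L x), p.Acc D q x u → ∃ a ∈ B, D.points[p.idx D q x u]? = some a
  unique : ∀ a ∈ B, ∃ u₀ < p.total D q x (p.L x), ∀ u < p.total D q x (p.L x),
    (p.Acc D q x u ∧ D.points[p.idx D q x u]? = some a) ↔ u = u₀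

open Classical in
theorem Layout.Covered.card_acc {x : ℕ} {B : Finset M} (h : p.Covered D q x B) :
    ((Finset.range (p.total D q x (p.L x))).filter fun u => p.Acc D q x u).card = B.card := by
  have : (Finset.range (p.total D q x (p.L x))).filter (fun u => p.Acc D q x u) =
      B.biUnion fun a => (Finset.range (p.total D q x (p.L x))).filter fun u =>
        p.Acc D q x u ∧ D.points[p.idx D q x u]? = some a := by
    ext u
    simp only [Finset.mem_filter, Finset.mem_range, Finset.mem_biUnion]
    constructor
    · rintro ⟨hu, ha⟩
      obtain ⟨a, haB, hs⟩ := h.mem u hu ha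
      exact ⟨a, haB, hu, ha, hs⟩
    · rintro ⟨a, -, hu, ha, -⟩
      exact ⟨hu, ha⟩
  rw [this, Finset.card_biUnion, Finset.sum_congr rfl (g := fun _ => 1)]
  · simp
  · intro a ha
    obtain ⟨u₀, hu₀, hu⟩ := h.unique a ha
    rw [Finset.card_eq_one]
    refine ⟨u₀, ?_⟩
    ext u
    simp only [Finset.mem_filter, Finset.mem_range, Finset.mem_singleton]
    exact ⟨fun hh => (hu u hh.1).1 hh.2, fun hh => by subst hh; exact ⟨hu₀, (hu u hu₀).2 rfl⟩⟩
  · intro a _ a' _ hne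
    rw [Function.onFun, Finset.disjoint_left]
    intro u hu hu'
    simp only [Finset.mem_filter] at hu hu'
    exact hne (Option.some_injective _ (hu.2.2.symm.trans hu'.2.2))

theorem Layout.TrialStep.readAnswer_eq {w d x u : ℕ} {m : Mem} {y : Mem × ℕ}
    (h : p.TrialStep D q w d x u m y) (ha : p.Acc D q x u) :
    readAnswer D y.1 = D.points[p.idx D q x u]? := by
  simp [readAnswer, (h.ans_acc ha).1]

theorem Layout.TrialMem.fairFrom_trialProg {w d x : ℕ} {Bl : ℕ → Finset M} (hf : p.Fits D q)
    (hw : w = p.J + 1) (hx : x < p.NB) (hcov : p.Covered D q x (Bl x)) {m : Mem}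
    (hmw : IsWords w m) (hm : p.TrialMem D q x m) :
    FairFrom D Bl (trialProg.exec w d D q) m := by
  classical
  by_cases h : m 0 ≠ 0 ∨ m 18 = 0
  · obtain ⟨s, -, hs⟩ := exec_trialProg_skip (w := w) (d := d) (D := D) (q := q) h
    exact FairFrom.of_pure hs rfl rfl
  push Not at h
  obtain ⟨res, hstep, hsupp, hexp⟩ :=
    Layout.TrialMem.exec_trialProg (d := d) hf hw hx hmw hm h.1 h.2
  -- the indicator of the event that entry `u` leads to the answer `a` in block `y`
  have hind : ∀ y a, ∀ u < p.total D q x (p.L x), acceptInd D y a (res u) =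
      if p.Acc D q x u ∧ D.points[p.idx D q x u]? = some a ∧ y = x then 1 else 0 := by
    intro y a u hu
    have hs := hstep u hu
    by_cases ha : p.Acc D q x u
    · refine if_congr ?_ rfl rfl
      rw [AcceptedIn, hs.readAnswer_eq ha, (hs.ans_acc ha).2]
      constructor
      · rintro ⟨h1, h2⟩; exact ⟨ha, h1, h2.symm⟩
      · rintro ⟨-, h1, h2⟩; exact ⟨h1, h2.symm⟩
    · rw [acceptInd_eq_zero (hs.ans_not_acc ha), if_neg (fun h => ha h.1)]
  have hsum : ∀ y a, a ∈ Bl y → (trialProg.exec w d D q m).expect (acceptInd D y a) =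
      (if y = x then 1 else 0) / (p.total D q x (p.L x) : ℕ) := by
    intro y a ha
    rw [hexp, Finset.sum_congr rfl fun u hu => hind y a u (Finset.mem_range.1 hu)]
    congr 1
    by_cases hy : y = x
    · subst hy
      obtain ⟨u₀, hu₀, hu⟩ := hcov.unique a ha
      rw [Finset.sum_congr rfl (g := fun u => if u = u₀ then 1 else 0)]
      · simp [hu₀]
      · intro u hu'
        refine if_congr ?_ rfl rfl
        rw [← hu u (Finset.mem_range.1 hu')]
        simp
    · simp [hy]
  refine ⟨fun h0 => absurd h.1 h0, ?_, ?_, ?_⟩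
  · intro _ y hy hy0
    obtain ⟨u, hu, rfl⟩ := hsupp y hy
    have hs := hstep u hu
    by_cases ha : p.Acc D q x u
    · obtain ⟨a, -, hpt⟩ := hcov.mem u hu ha
      rw [hs.readAnswer_eq ha, hpt]
      simp
    · exact absurd (hs.ans_not_acc ha) hy0
  · intro _ y a a' ha ha'
    rw [hsum y a ha, hsum y a' ha']
  · intro _ y a ha
    rw [hexp, Finset.sum_eq_zero, ENNReal.zero_div]
    intro u hu
    rw [hind y a u (Finset.mem_range.1 hu), if_neg]
    rintro ⟨h1, h2, rfl⟩
    obtain ⟨a', ha', h3⟩ := hcov.mem u (Finset.mem_range.1 hu) h1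
    rw [h2] at h3
    exact ha (Option.some_injective _ h3 ▸ ha')

end TrialLaw
end Query

/-! ### Blocks and the whole query -/

namespace Query

section Block

set_option linter.unusedSectionVars false

variable {M : Type u} [MetricSpace M] {F : ℝ → ℝ → HashFamily.{u, v} M}
variable {p : Layout} {D : DataStructure F} {q : M}

theorem Layout.TrialMem.support_trialProg {w d x : ℕ} (hf : p.Fits D q) (hw : w = p.J + 1)
    (hx : x < p.NB) {m : Mem} (hmw : IsWords w m) (hm : p.TrialMem D q x m) :
    ∀ y ∈ (trialProg.exec w d D q m).support, IsWords w y.1 ∧ p.TrialMem D q x y.1 := by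
  intro y hy
  by_cases h : m 0 ≠ 0 ∨ m 18 = 0
  · obtain ⟨s, -, hs⟩ := exec_trialProg_skip (w := w) (d := d) (D := D) (q := q) h
    rw [hs, PMF.support_pure, Set.mem_singleton_iff] at hy
    subst hy
    exact ⟨hmw, hm⟩
  · push Not at h
    obtain ⟨res, hstep, hsupp, -⟩ :=
      Layout.TrialMem.exec_trialProg (d := d) hf hw hx hmw hm h.1 h.2
    obtain ⟨u, hu, rfl⟩ := hsupp y hy
    exact ⟨(hstep u hu).words, (hstep u hu).mem⟩

/-- The probability that a sequence of trials fails is at most the expected cost of finding an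
accepted entry, divided by the budget. Induction on the number of trials: if the first trial costs
`c`, then `b = (b - c) + c`, where `b - c` is the budget of the remaining trials. -/
theorem Layout.TrialMem.expect_failInd_repeatSteps_le {w d x : ℕ} {B : Finset M}
    (hf : p.Fits D q) (hw : w = p.J + 1) (hx : x < p.NB) (hcov : p.Covered D q x B) (A : ℕ) :
    ∀ m, IsWords w m → p.TrialMem D q x m → m 0 = 0 → m 18 ≤ A →
      (m 18 : ENNReal) * B.card * (repeatSteps (trialProg.exec w d D q) A m).expect failInd ≤
        ∑ u ∈ Finset.range (p.total D q x (p.L x)), (p.cost D q x u : ENNReal) := by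
  classical
  induction A with
  | zero =>
    intro m _ _ _ hA
    simp [Nat.le_zero.1 hA]
  | succ A ih =>
    intro m hmw hm h0 hA
    by_cases h18 : m 18 = 0
    · simp [h18]
    obtain ⟨res, hstep, -, hexp⟩ :=
      Layout.TrialMem.exec_trialProg (d := d) hf hw hx hmw hm h0 h18
    have hW : p.total D q x (p.L x) ≠ 0 := by rw [← hm.c17]; exact hm.pos h18
    have hcard := hcov.card_acc
    set W := p.total D q x (p.L x) with hWdef
    set Csum := ∑ u ∈ Finset.range W, (p.cost D q x u : ENNReal) with hCsum
    set g : Mem → ENNReal := fun m' => (repeatSteps (trialProg.exec w d D q) A m').expect failInd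
      with hg
    have hE : (repeatSteps (trialProg.exec w d D q) (A + 1) m).expect failInd =
        (∑ u ∈ Finset.range W, g (res u).1) / (W : ENNReal) := by
      rw [← hexp (fun y => g y.1)]
      rw [repeatSteps, PMF.expect_bind]
      refine PMF.expect_congr fun y _ => ?_
      rw [PMF.expect_map]
      rfl
    have hfair : ∀ m', IsWords w m' → p.TrialMem D q x m' →
        FairFrom D (fun y => if y = x then B else ∅) (repeatSteps (trialProg.exec w d D q) A) m' := by
      intro m' h1 h2
      refine FairFrom.repeatSteps (fun _ m' => IsWords w m' ∧ p.TrialMem D q x m') A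
        (fun i m' _ h => ⟨Layout.TrialMem.fairFrom_trialProg hf hw hx (by simpa using hcov) h.1 h.2,
          Layout.TrialMem.support_trialProg hf hw hx h.1 h.2⟩) A 0 m' (by simp) ⟨h1, h2⟩
    have hu : ∀ u ∈ Finset.range W, (m 18 : ENNReal) * B.card * g (res u).1 ≤
        (if p.Acc D q x u then 0 else Csum) + B.card * p.cost D q x u := by
      intro u hu
      have hs := hstep u (Finset.mem_range.1 hu)
      by_cases ha : p.Acc D q x u
      · have hne : (res u).1 0 ≠ 0 := by rw [(hs.ans_acc ha).1]; omega
        have : g (res u).1 = 0 := (hfair _ hs.words hs.mem).expect_failInd_eq_zero hne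
        simp [this]
      · rw [if_neg ha]
        obtain ⟨c, h1, h2, h3, -⟩ := hs.cost
        have hih := ih (res u).1 hs.words hs.mem (hs.ans_not_acc ha) (by omega)
        have hle1 : g (res u).1 ≤ 1 := expect_failInd_le_one _
        have hsplit : (m 18 : ENNReal) ≤ ((res u).1 18 : ENNReal) + (p.cost D q x u : ENNReal) := by
          exact_mod_cast (by omega : m 18 ≤ (res u).1 18 + p.cost D q x u)
        calc (m 18 : ENNReal) * B.card * g (res u).1
            ≤ (((res u).1 18 : ENNReal) + (p.cost D q x u : ENNReal)) * B.card * g (res u).1 := by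
              gcongr
          _ = ((res u).1 18 : ENNReal) * B.card * g (res u).1 +
              B.card * (p.cost D q x u : ENNReal) * g (res u).1 := by ring
          _ ≤ Csum + B.card * (p.cost D q x u : ENNReal) * 1 := by gcongr
          _ = _ := by rw [mul_one]
    rw [hE, ← mul_div_assoc, Finset.mul_sum]
    refine ENNReal.div_le_of_le_mul ?_
    refine (Finset.sum_le_sum hu).trans (le_of_eq ?_)
    rw [Finset.sum_add_distrib, ← Finset.mul_sum, ← hCsum]
    have hsum : ∑ u ∈ Finset.range W, (if p.Acc D q x u then 0 else Csum) =
        (((Finset.range W).filter fun u => ¬ p.Acc D q x u).card : ENNReal) * Csum := by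
      rw [Finset.sum_ite]
      simp
    rw [hsum, ← add_mul, mul_comm Csum]
    congr 1
    have := Finset.card_filter_add_card_filter_not (s := Finset.range W) (fun u => p.Acc D q x u)
    rw [hcard, Finset.card_range] at this
    rw [add_comm]
    exact_mod_cast this

/-- The part of the budget `b` that the remaining trials can spend, overdraft included. -/
def Layout.potential (p : Layout) (b : ℕ) : ℕ := if b = 0 then 0 else b + 2 * p.Lm

/-- The time of a trial is paid by the decrease of the potential. The overdraft of a trial is at
most `2 * Lm`, the maximal cost of a bucket entry, and it occurs only once as it leaves no budget.
-/
theorem Layout.TrialMem.steps_trialProg {w d x : ℕ} (hf : p.Fits D q) (hw : w = p.J + 1)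
    (hx : x < p.NB) {m : Mem} (hmw : IsWords w m) (hm : p.TrialMem D q x m) :
    ∀ y ∈ (trialProg.exec w d D q m).support,
      y.2 + p.trialTime d * p.potential (y.1 18) ≤ p.trialTime d * p.potential (m 18) + 3 := by
  intro y hy
  by_cases h : m 0 ≠ 0 ∨ m 18 = 0
  · obtain ⟨s, h3, hs⟩ := exec_trialProg_skip (w := w) (d := d) (D := D) (q := q) h
    rw [hs, PMF.support_pure, Set.mem_singleton_iff] at hy
    subst hy
    simp only
    omega
  · push Not at h
    obtain ⟨res, hstep, hsupp, -⟩ :=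
      Layout.TrialMem.exec_trialProg (d := d) hf hw hx hmw hm h.1 h.2
    obtain ⟨u, hu, rfl⟩ := hsupp y hy
    obtain ⟨c, h1, h2, h3, h4⟩ := (hstep u hu).cost
    have hT := Layout.tbl_lt hu
    have hLm := hf.L_le x hx
    have hc : c ≤ 2 * p.Lm := by
      refine h3.trans ?_
      unfold Layout.cost
      split_ifs
      · omega
      · have := p.probes_le (D := D) (q := q) x (p.idx D q x u) (p.tbl D q x u)
        omega
    have hpot : c + p.potential ((res u).1 18) ≤ p.potential (m 18) := by
      unfold Layout.potential
      rw [if_neg h.2]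
      split_ifs <;> omega
    calc (res u).2 + p.trialTime d * p.potential ((res u).1 18)
        ≤ c * p.trialTime d + p.trialTime d * p.potential ((res u).1 18) := by omega
      _ = p.trialTime d * (c + p.potential ((res u).1 18)) := by ring
      _ ≤ p.trialTime d * p.potential (m 18) := Nat.mul_le_mul_left _ hpot
      _ ≤ _ := by omega

/-- A bound for the time of the preparation of a block. -/
def Layout.setupTime (p : Layout) (d : ℕ) : ℕ := p.Lm * (2 * p.searchTime d + 11) + 20

theorem Layout.GlobMem.setupProg_spec {w d x : ℕ} (hf : p.Fits D q) (hw : w = p.J + 1)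
    (hx : x < p.NB) {m : Mem} (hm : p.GlobMem m) (h2 : m 2 = x) :
    wp w d D q setupProg m fun m' s => p.TrialMem D q x m' ∧ m' 0 = m 0 ∧ m' 1 = m 1 ∧
      (m' 18 ≤ p.B) ∧ (p.total D q x (p.L x) ≠ 0 → m' 18 = p.B) ∧ s ≤ p.setupTime d := by
  have hb := hf.bound
  have hpw : 2 ^ w = 2 ^ p.J + 2 ^ p.J := by rw [hw, pow_succ]; ring
  have hLm := hf.L_le x hx
  have hKm := hf.K_le x hx
  have hxL : x * p.Lm ≤ p.NB * p.Lm := Nat.mul_le_mul_right _ hx.le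
  have hmul : p.NB * p.Lm * (p.Km + 1) = p.NB * p.Lm * p.Km + p.NB * p.Lm := by ring
  have hL := hf.wordL x hx
  have hK := hf.wordK x hx
  have hadd : 8 + x + x = 8 + 2 * x := by ring
  have hadd' : 8 + 2 * x + 1 = 9 + 2 * x := by ring
  simp only [setupProg, wp]
  simp only [ne_eq, Nat.reduceEqDiff, not_false_eq_true, Function.update_of_ne,
    Function.update_self, Function.update_idem, h2, hm.c9, hm.c7, hadd, hadd', hL, hK]
  refine ⟨by omega, by omega, by omega, by omega, by omega, by omega, by omega, ?_⟩
  generalize hm1 : Function.update (_ : Mem) 16 (x * p.Lm) = m1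
  have hk : ∀ a, a < 14 → m1 a = m a := fun a ha => by
    rw [← hm1]
    repeat rw [Function.update_of_ne (by omega)]
  have hmb : p.BlockMem x m1 :=
    ⟨hm.congr fun a _ ha => hk a ha, by rw [hk _ (by omega), h2], by simp [← hm1],
      by simp [← hm1], by simp [← hm1]⟩
  refine wp_mono _ _ _ _ ?_ (hmb.intervalsProg_spec hf hw hx)
  rintro m2 s2 ⟨hfr, hmb2, harr, h17, hs⟩
  have hs' : s2 ≤ p.Lm * (2 * p.searchTime d + 11) + 5 :=
    hs.trans (Nat.add_le_add_right (Nat.mul_le_mul_right _ hLm) _)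
  have e0 : m2 0 = m 0 := by rw [hfr _ (by omega), hk _ (by omega)]
  have e1 : m2 1 = m 1 := by rw [hfr _ (by omega), hk _ (by omega)]
  have hupd : ∀ v, (v ≠ 0 → m2 17 ≠ 0) → p.TrialMem D q x (Function.update m2 18 v) := by
    intro v hv
    refine ⟨hmb2.congr fun a _ h => by rw [Function.update_of_ne (by omega)], by simpa using h17,
      fun t ht => ?_, by simpa using hv⟩
    rw [Function.update_of_ne (by omega), Function.update_of_ne (by omega)]
    exact harr t ht
  simp only [hmb2.c6, hmb2.c10, Nat.sub_zero]
  simp only [Layout.setupTime]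
  refine ⟨fun hne => ⟨hupd _ fun _ => hne, by simpa using e0, by simpa using e1, by simp, by simp,
    by omega⟩, fun hne => ⟨by omega, hupd _ fun h => absurd rfl h, by simpa using e0,
    by simpa using e1, by simp, fun h => ?_, by omega⟩⟩
  exact absurd (h17.symm.trans hne) h

/-- A bound for the time of one block. -/
def Layout.blockTime (p : Layout) (d : ℕ) : ℕ :=
  p.setupTime d + p.trialTime d * (p.B + 2 * p.Lm) + 4 * p.B + 2

/-- The memory between two blocks. -/
structure Layout.Between (p : Layout) (w x : ℕ) (m : Mem) : Prop extends p.GlobMem m where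
  words : IsWords w m
  c2 : m 2 = x

theorem Layout.TrialMem.support_repeatSteps {w d x : ℕ} (hf : p.Fits D q) (hw : w = p.J + 1)
    (hx : x < p.NB) (n : ℕ) : ∀ m, IsWords w m → p.TrialMem D q x m →
    ∀ y ∈ (repeatSteps (trialProg.exec w d D q) n m).support, IsWords w y.1 ∧
      p.TrialMem D q x y.1 ∧
        y.2 + p.trialTime d * p.potential (y.1 18) ≤
          p.trialTime d * p.potential (m 18) + 4 * n + 1 := by
  induction n with
  | zero =>
    intro m hmw hm y hy
    rw [repeatSteps, PMF.support_pure, Set.mem_singleton_iff] at hy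
    subst hy
    exact ⟨hmw, hm, by simp only; omega⟩
  | succ n ih =>
    intro m hmw hm y hy
    obtain ⟨x1, hx1, z, hz, rfl⟩ := mem_support_repeatSteps_succ hy
    have h1 := Layout.TrialMem.support_trialProg hf hw hx hmw hm x1 hx1
    have h2 := Layout.TrialMem.steps_trialProg hf hw hx hmw hm x1 hx1
    have h3 := ih x1.1 h1.1 h1.2 z hz
    exact ⟨h3.1, h3.2.1, by simp only; omega⟩

theorem exec_seq (w d : ℕ) (P P' : Prog) (m : Mem) : (Prog.seq P P').exec w d D q m =
    (P.exec w d D q m).bind fun x => (P'.exec w d D q x.1).map fun y => (y.1, x.2 + y.2) := rfl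

theorem Layout.TrialMem.next {w d x : ℕ} (hf : p.Fits D q) (hw : w = p.J + 1) (hx : x < p.NB)
    {m : Mem} (hmw : IsWords w m) (hm : p.TrialMem D q x m) :
    (Prog.arith .add 2 2 9).exec w d D q m = PMF.pure (Function.update m 2 (x + 1), 1) ∧
      p.Between w (x + 1) (Function.update m 2 (x + 1)) := by
  have hb := hf.bound
  have hpw : 2 ^ w = 2 ^ p.J + 2 ^ p.J := by rw [hw, pow_succ]; ring
  have hlt : x + 1 < 2 ^ w := by omega
  refine ⟨?_, ⟨hm.toGlobMem.congr fun a h1 h2 => by rw [Function.update_of_ne (by omega)],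
    hmw.update 2 hlt, by simp⟩⟩
  simp only [Prog.exec, WordOp.eval, hm.c2, hm.c9, Nat.mod_eq_of_lt hlt]

theorem Layout.Between.exec_setupProg {w d x : ℕ} (hf : p.Fits D q) (hw : w = p.J + 1)
    (hx : x < p.NB) {m : Mem} (hm : p.Between w x m) :
    ∃ y, setupProg.exec w d D q m = PMF.pure y ∧ IsWords w y.1 ∧ p.TrialMem D q x y.1 ∧
      y.1 0 = m 0 ∧ y.1 1 = m 1 ∧ (y.1 18 ≤ p.B) ∧
        (p.total D q x (p.L x) ≠ 0 → y.1 18 = p.B) ∧ y.2 ≤ p.setupTime d :=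
  setupProg_randFree.exists_outcome (hf.two_le hw) hm.words
    (hm.toGlobMem.setupProg_spec (d := d) hf hw hx hm.c2)

theorem Layout.Between.support_blockProg {w d x : ℕ} (hf : p.Fits D q) (hw : w = p.J + 1)
    (hx : x < p.NB) {m : Mem} (hm : p.Between w x m) :
    ∀ y ∈ (blockProg.exec w d D q m).support,
      p.Between w (x + 1) y.1 ∧ y.2 ≤ p.blockTime d := by
  intro y hy
  obtain ⟨y1, he1, hw1, hm1, -, -, hB, -, ht1⟩ := hm.exec_setupProg (d := d) hf hw hx
  rw [blockProg, exec_seq, he1, PMF.pure_bind, PMF.mem_support_map_iff] at hy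
  obtain ⟨y2, hy2, rfl⟩ := hy
  rw [exec_seq, PMF.mem_support_bind_iff] at hy2
  obtain ⟨y3, hy3, hy2⟩ := hy2
  rw [Prog.exec, hm1.c6] at hy3
  obtain ⟨hw3, hm3, ht3⟩ := Layout.TrialMem.support_repeatSteps hf hw hx _ _ hw1 hm1 y3 hy3
  obtain ⟨he, hnext⟩ := hm3.next (d := d) hf hw hx hw3
  rw [he, PMF.pure_map, PMF.support_pure, Set.mem_singleton_iff] at hy2
  subst hy2
  refine ⟨hnext, ?_⟩
  have hpot : p.potential (y1.1 18) ≤ p.B + 2 * p.Lm := by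
    unfold Layout.potential
    split_ifs <;> omega
  have := Nat.mul_le_mul_left (p.trialTime d) hpot
  simp only [Layout.blockTime]
  omega

theorem Layout.Between.fairFrom_blockProg {w d x : ℕ} {Bl : ℕ → Finset M} (hf : p.Fits D q)
    (hw : w = p.J + 1) (hx : x < p.NB) (hcov : p.Covered D q x (Bl x)) {m : Mem}
    (hm : p.Between w x m) : FairFrom D Bl (blockProg.exec w d D q) m := by
  obtain ⟨y1, he1, hw1, hm1, h0, h1, hB, -, ht1⟩ := hm.exec_setupProg (d := d) hf hw hx
  refine FairFrom.comp (f := setupProg.exec w d D q)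
    (g := (Prog.seq (.loop 6 trialProg) (.arith .add 2 2 9)).exec w d D q) (fun a b => a + b)
    (FairFrom.of_pure he1 h0 h1) fun y hy => ?_
  rw [he1, PMF.support_pure, Set.mem_singleton_iff] at hy
  subst hy
  refine FairFrom.comp (f := (Prog.loop 6 trialProg).exec w d D q)
    (g := (Prog.arith .add 2 2 9).exec w d D q) (fun a b => a + b) ?_ fun y hy => ?_
  · have hfair := FairFrom.repeatSteps (D := D) (Bl := Bl) (f := trialProg.exec w d D q)
      (fun _ m' => IsWords w m' ∧ p.TrialMem D q x m') (y.1 6)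
      (fun i m' _ h => ⟨Layout.TrialMem.fairFrom_trialProg hf hw hx hcov h.1 h.2,
        Layout.TrialMem.support_trialProg hf hw hx h.1 h.2⟩) (y.1 6) 0 y.1 (by simp) ⟨hw1, hm1⟩
    exact ⟨hfair.keep, hfair.valid, hfair.fair, hfair.null⟩
  · rw [Prog.exec] at hy
    obtain ⟨hw3, hm3, -⟩ := Layout.TrialMem.support_repeatSteps hf hw hx _ _ hw1 hm1 y hy
    exact FairFrom.of_pure (hm3.next (d := d) hf hw hx hw3).1 (by simp) (by simp)

theorem Layout.Between.expect_failInd_blockProg_le {w d x : ℕ} {B : Finset M} (hf : p.Fits D q)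
    (hw : w = p.J + 1) (hx : x < p.NB) (hcov : p.Covered D q x B) (hB : B.Nonempty) {m : Mem}
    (hm : p.Between w x m) (hm0 : m 0 = 0) :
    (p.B : ENNReal) * B.card * (blockProg.exec w d D q m).expect failInd ≤
        ∑ u ∈ Finset.range (p.total D q x (p.L x)), (p.cost D q x u : ENNReal) := by
  obtain ⟨y1, he1, hw1, hm1, h0, h1, hle, hB18, ht1⟩ := hm.exec_setupProg (d := d) hf hw hx
  have hW : p.total D q x (p.L x) ≠ 0 := by
    obtain ⟨a, ha⟩ := hB
    obtain ⟨u, hu, -⟩ := hcov.unique a ha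
    omega
  have key := Layout.TrialMem.expect_failInd_repeatSteps_le (d := d) hf hw hx hcov p.B y1.1 hw1 hm1
    (h0.trans hm0) hle
  rw [hB18 hW] at key
  convert key using 2
  rw [blockProg, exec_seq, he1, PMF.pure_bind, PMF.expect_map, exec_seq, PMF.expect_bind,
    Prog.exec, hm1.c6]
  refine PMF.expect_congr fun y hy => ?_
  obtain ⟨hw3, hm3, -⟩ := Layout.TrialMem.support_repeatSteps hf hw hx _ _ hw1 hm1 y hy
  rw [(hm3.next (d := d) hf hw hx hw3).1, PMF.pure_map, PMF.expect_pure]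
  simp [failInd]

theorem Layout.Fits.initProg_spec {w d : ℕ} (hf : p.Fits D q) (hw : w = p.J + 1) :
    wp w d D q initProg (fun _ => 0) fun m s => p.GlobMem m ∧ m 0 = 0 ∧ m 1 = 0 ∧ m 2 = 0 ∧
      s ≤ 15 := by
  have hb := hf.bound
  have hpw : 2 ^ w = 2 ^ p.J + 2 ^ p.J := by rw [hw, pow_succ]; ring
  have hJ : p.J < 2 ^ p.J := Nat.lt_two_pow_self
  simp only [initProg, wp]
  simp only [ne_eq, Nat.reduceEqDiff, not_false_eq_true, Function.update_of_ne,
    Function.update_self, hf.wordNB, hf.wordn, hf.wordJ, hf.wordH, hf.wordB, hf.wordLm, hf.wordKm]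
  refine ⟨by omega, by omega, by omega, by omega, by omega, by omega, by omega, by omega,
    by omega, by omega, by omega, by omega, by omega, by omega, by omega, ?_, ?_⟩
  · constructor <;> simp
  · simp

/-- A bound for the time of a query. -/
def Layout.queryTime (p : Layout) (d : ℕ) : ℕ := p.NB * (p.blockTime d + 1) + 16

theorem Layout.Fits.exec_initProg {w d : ℕ} (hf : p.Fits D q) (hw : w = p.J + 1) :
    ∃ y, initProg.exec w d D q (fun _ => 0) = PMF.pure y ∧ p.Between w 0 y.1 ∧ y.1 0 = 0 ∧
      y.2 ≤ 15 := by
  have h2 := hf.two_le hw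
  obtain ⟨y, he, hyw, h1, h3, -, h4, h5⟩ := initProg_randFree.exists_outcome h2
    (show IsWords w (fun _ => 0) from fun _ => by positivity) (hf.initProg_spec (d := d) hw)
  exact ⟨y, he, ⟨h1, hyw, h4⟩, h3, h5⟩

theorem Layout.Fits.steps_le {w d : ℕ} (hf : p.Fits D q) (hw : w = p.J + 1) :
    ∀ y ∈ (queryProg.run w d D q).support, y.2 ≤ p.queryTime d := by
  intro y hy
  obtain ⟨y1, he, hbt, -, ht⟩ := hf.exec_initProg (d := d) hw
  rw [Prog.run, queryProg, exec_seq, he, PMF.pure_bind, PMF.mem_support_map_iff] at hy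
  obtain ⟨z, hz, rfl⟩ := hy
  rw [Prog.exec, hbt.c12] at hz
  suffices H : ∀ n i m, i + n = p.NB → p.Between w i m →
      ∀ z ∈ (repeatSteps (blockProg.exec w d D q) n m).support,
        z.2 ≤ n * (p.blockTime d + 1) + 1 by
    have := H p.NB 0 y1.1 (by simp) hbt z hz
    simp only [Layout.queryTime]
    omega
  intro n
  induction n with
  | zero =>
    intro i m _ _ z hz
    rw [repeatSteps, PMF.support_pure, Set.mem_singleton_iff] at hz
    subst hz
    simp
  | succ n ih =>
    intro i m hi hm z hz
    obtain ⟨x1, hx1, z1, hz1, rfl⟩ := mem_support_repeatSteps_succ hz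
    have h1 := hm.support_blockProg hf hw (by omega) x1 hx1
    have h2 := ih (i + 1) x1.1 (by omega) h1.1 z1 hz1
    rw [add_mul]
    simp only
    omega

/-- The answer is exactly fair whenever the buckets of each block cover its near points, whatever
the budget is. -/
theorem Layout.Fits.fairFrom_queryProg {w d : ℕ} {Bl : ℕ → Finset M} (hf : p.Fits D q)
    (hw : w = p.J + 1) (hcov : ∀ x < p.NB, p.Covered D q x (Bl x)) :
    FairFrom D Bl (queryProg.exec w d D q) (fun _ => 0) := by
  obtain ⟨y1, he, hbt, h0, -⟩ := hf.exec_initProg (d := d) hw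
  have hp := hf.initProg_spec (d := d) hw
  have h1 : y1.1 1 = 0 := by
    have := wp_sound (hf.two_le hw) initProg _ _ (fun _ => by positivity) hp y1 (by simp [he])
    exact this.2.2.2.1
  refine FairFrom.comp (f := initProg.exec w d D q) (g := (Prog.loop 12 blockProg).exec w d D q)
    (fun a b => a + b) (FairFrom.of_pure he h0 h1) fun y hy => ?_
  rw [he, PMF.support_pure, Set.mem_singleton_iff] at hy
  subst hy
  have hfair := FairFrom.repeatSteps (D := D) (Bl := Bl) (f := blockProg.exec w d D q)
    (fun i m' => p.Between w i m') (y.1 12)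
    (fun i m' hi h => ⟨h.fairFrom_blockProg hf hw (by rw [← hbt.c12]; exact hi)
      (hcov i (by rw [← hbt.c12]; exact hi)), fun x hx =>
        (h.support_blockProg hf hw (by rw [← hbt.c12]; exact hi) x hx).1⟩)
    (y.1 12) 0 y.1 (by simp) hbt
  exact ⟨hfair.keep, hfair.valid, hfair.fair, hfair.null⟩

/-- The conditional failure probability given the data structure is at most the product over the
blocks of the total cost of the bucket entries divided by `B` times the number of near points; the
bound `1` can be taken for blocks where this quotient is of no use. -/
theorem Layout.Fits.expect_failInd_le {w d : ℕ} {Bl : ℕ → Finset M} (hf : p.Fits D q)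
    (hw : w = p.J + 1) (hcov : ∀ x < p.NB, p.Covered D q x (Bl x)) (hB : 0 < p.B)
    (c : ℕ → ENNReal)
    (hc : ∀ x < p.NB, c x = 1 ∨ ((Bl x).Nonempty ∧
      (∑ u ∈ Finset.range (p.total D q x (p.L x)), (p.cost D q x u : ENNReal)) /
        ((p.B : ENNReal) * (Bl x).card) ≤ c x)) :
    (queryProg.run w d D q).expect failInd ≤ ∏ x ∈ Finset.range p.NB, c x := by
  obtain ⟨y1, he, hbt, h0, -⟩ := hf.exec_initProg (d := d) hw
  rw [Prog.run, queryProg, exec_seq, he, PMF.pure_bind, PMF.expect_map, Prog.exec, hbt.c12]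
  have := FairFrom.expect_failInd_repeatSteps_le (D := D) (Bl := Bl)
    (f := blockProg.exec w d D q) (fun i m' => p.Between w i m') p.NB c
    (fun i m' hi h => ⟨h.fairFrom_blockProg hf hw hi (hcov i hi), fun x hx =>
        (h.support_blockProg hf hw hi x hx).1⟩) ?_ p.NB 0 y1.1 (by simp) hbt h0
  · simp only [zero_add] at this
    exact this
  · intro i m hi hm hm0
    rcases hc i hi with h | ⟨hne, h⟩
    · rw [h]; exact expect_failInd_le_one _
    · refine le_trans ?_ h
      have hcard : 0 < (Bl i).card := hne.card_pos
      rw [ENNReal.le_div_iff_mul_le (Or.inl (by positivity))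
        (Or.inl (ENNReal.mul_ne_top (by simp) (by simp))), mul_comm]
      exact hm.expect_failInd_blockProg_le hf hw hi (hcov i hi) hne hm0

end Block
end Query

/-! ### From fair runs to relaxed fair answers -/

set_option linter.unusedSectionVars false

section Answers

variable {M : Type u} [MetricSpace M] {F : ℝ → ℝ → HashFamily.{u, v} M}

/-- The law of the answer to a single query. -/
noncomputable def answerLaw (P : Prog) (w d : ℕ) (D : DataStructure F) (q : M) : PMF (Option M) :=
  (P.run w d D q).map fun x => readAnswer D x.1

theorem session_concat (P : Prog) (w d : ℕ) (D : DataStructure F) (past : List M) (q : M) :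
    P.session w d D (past ++ [q]) =
      (P.session w d D past).bind fun T => (answerLaw P w d D q).map fun a => T ++ [a] := by
  induction past with
  | nil =>
    simp only [List.nil_append, Prog.session, PMF.pure_map, PMF.pure_bind, answerLaw, PMF.map_comp]
    rfl
  | cons q' qs ih =>
    simp only [List.cons_append, Prog.session, ih, PMF.map_bind, PMF.bind_bind, PMF.map_comp,
      PMF.bind_map]
    rfl

theorem session_concat_apply (P : Prog) (w d : ℕ) (D : DataStructure F) (past : List M) (q : M)
    (T : List (Option M)) (x : Option M) :
    P.session w d D (past ++ [q]) (T ++ [x]) = P.session w d D past T * answerLaw P w d D q x := by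
  classical
  rw [session_concat, PMF.bind_apply, tsum_eq_single T]
  · congr 1
    rw [PMF.map_apply, tsum_eq_single x]
    · simp
    · intro y hy
      simp [Ne.symm hy]
  · intro T' hT'
    rw [PMF.map_apply]
    simp only [List.append_singleton_inj, mul_eq_zero, ENNReal.tsum_eq_zero, ite_eq_right_iff]
    exact Or.inr fun a h => absurd h.1.symm hT'

theorem relaxedFairSession_of_forall (P : Prog) (w d : ℕ) (D : DataStructure F) (S : Finset M)
    (c r δ : ℝ) (qs : List M)
    (h : ∀ q ∈ qs, RelaxedFairLaw S c r δ q (answerLaw P w d D q)) :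
    RelaxedFairSession P w d D S c r δ qs := by
  intro past q later hqs
  exact ⟨_, h q (by simp [hqs]), session_concat_apply P w d D past q⟩

theorem mem_of_accepted {D : DataStructure F} {Bl : ℕ → Finset M} {f : Mem → PMF (Mem × ℕ)}
    {m : Mem} (hf : FairFrom D Bl f m) (hm : m 0 = 0) {x : Mem × ℕ} (hx : x ∈ (f m).support) {a : M}
    (ha : readAnswer D x.1 = some a) : a ∈ Bl (x.1 1) := by
  classical
  by_contra hn
  have h0 := hf.null hm _ _ hn
  rw [PMF.expect, ENNReal.tsum_eq_zero] at h0
  have := h0 x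
  rw [mul_eq_zero] at this
  rcases this with h | h
  · exact (PMF.mem_support_iff _ _).1 hx h
  · simp [acceptInd, AcceptedIn, ha] at h

open Classical in
theorem uniformAnswer_some_apply {S : Finset M} {q : M} {s : ℝ} (h : (ballIn S q s).Nonempty)
    (a : M) : uniformAnswer S q (some s) (some a) =
      if a ∈ ballIn S q s then ((ballIn S q s).card : ENNReal)⁻¹ else 0 := by
  rw [uniformAnswer, dif_pos h, PMF.map_apply, tsum_eq_single a]
  · simp [PMF.uniformOfFinset_apply]
  · intro b hb
    simp [Ne.symm hb]

theorem uniformAnswer_some_none {S : Finset M} {q : M} {s : ℝ} (h : (ballIn S q s).Nonempty) :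
    uniformAnswer S q (some s) none = 0 := by
  rw [uniformAnswer, dif_pos h, PMF.map_apply]
  simp

open Classical in
/-- The radius behind the answer in a memory, if block `y` works with radius `rad y`. -/
noncomputable def answerRadius (D : DataStructure F) (rad : ℕ → ℝ) (x : Mem × ℕ) : Option ℝ :=
  if readAnswer D x.1 = none then none else some (rad (x.1 1))

/-- The answer of a fair computation is a mixture of uniformly random points of balls. -/
theorem map_readAnswer_eq_bind {D : DataStructure F} {Bl : ℕ → Finset M}
    {f : Mem → PMF (Mem × ℕ)} {m : Mem} (hf : FairFrom D Bl f m) (hm : m 0 = 0) {S : Finset M}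
    {q : M} {NB : ℕ} {rad : ℕ → ℝ} (hBl : ∀ y < NB, Bl y = ballIn S q (rad y))
    (hBl' : ∀ y, NB ≤ y → Bl y = ∅) :
    ((f m).map fun x => readAnswer D x.1) =
      ((f m).map (answerRadius D rad)).bind (uniformAnswer S q) := by
  classical
  -- an accepted point lies in the ball of its block
  have hacc : ∀ x ∈ (f m).support, ∀ a, readAnswer D x.1 = some a →
      x.1 1 < NB ∧ a ∈ Bl (x.1 1) ∧ a ∈ ballIn S q (rad (x.1 1)) := by
    intro x hx a ha
    have h1 := mem_of_accepted hf hm hx ha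
    have h2 : x.1 1 < NB := by
      by_contra h
      rw [hBl' _ (not_lt.1 h)] at h1
      simp at h1
    exact ⟨h2, h1, hBl _ h2 ▸ h1⟩
  refine PMF.ext fun o => ?_
  rw [PMF.apply_eq_expect, PMF.expect_map, PMF.apply_eq_expect, PMF.expect_bind, PMF.expect_map]
  simp only [← PMF.apply_eq_expect]
  cases o with
  | none =>
    refine PMF.expect_congr fun x hx => ?_
    by_cases hr : readAnswer D x.1 = none
    · simp [answerRadius, hr, uniformAnswer]
    · obtain ⟨a, ha⟩ := Option.ne_none_iff_exists'.1 hr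
      have := hacc x hx a ha
      have he : answerRadius D rad x = some (rad (x.1 1)) := if_neg hr
      rw [he, uniformAnswer_some_none ⟨a, this.2.2⟩, if_neg hr]
  | some a₀ =>
    have h1 : ∀ x ∈ (f m).support, (if readAnswer D x.1 = some a₀ then (1 : ENNReal) else 0) =
        ∑ y ∈ Finset.range NB, (if a₀ ∈ Bl y then 1 else 0) * acceptInd D y a₀ x := by
      intro x hx
      by_cases hr : readAnswer D x.1 = some a₀
      · have := hacc x hx a₀ hr
        rw [if_pos hr, Finset.sum_eq_single (x.1 1)]
        · simp [this.2.1, acceptInd, AcceptedIn, hr]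
        · intro y _ hy
          simp [acceptInd, AcceptedIn, Ne.symm hy]
        · intro h
          exact absurd (Finset.mem_range.2 this.1) h
      · rw [if_neg hr, Finset.sum_eq_zero]
        intro y _
        simp [acceptInd, AcceptedIn, hr]
    have h2 : ∀ x ∈ (f m).support, uniformAnswer S q (answerRadius D rad x) (some a₀) =
        ∑ y ∈ Finset.range NB, ∑ a ∈ Bl y,
          acceptInd D y a x * (if a₀ ∈ Bl y then ((Bl y).card : ENNReal)⁻¹ else 0) := by
      intro x hx
      by_cases hr : readAnswer D x.1 = none
      · rw [answerRadius, if_pos hr, uniformAnswer, Finset.sum_eq_zero]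
        · simp
        · intro y _
          refine Finset.sum_eq_zero fun a _ => ?_
          simp [acceptInd, AcceptedIn, hr]
      · obtain ⟨a, ha⟩ := Option.ne_none_iff_exists'.1 hr
        have := hacc x hx a ha
        rw [answerRadius, if_neg hr, uniformAnswer_some_apply ⟨a, this.2.2⟩,
          Finset.sum_eq_single (x.1 1), Finset.sum_eq_single a]
        · rw [hBl _ this.1]
          simp [acceptInd, AcceptedIn, ha]
        · intro b _ hb
          simp [acceptInd, AcceptedIn, ha, Ne.symm hb]
        · exact fun h => absurd this.2.1 h
        · intro y _ hy
          refine Finset.sum_eq_zero fun b _ => ?_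
          simp [acceptInd, AcceptedIn, Ne.symm hy]
        · exact fun h => absurd (Finset.mem_range.2 this.1) h
    rw [PMF.expect_congr h1, PMF.expect_congr h2, PMF.expect_sum, PMF.expect_sum]
    refine Finset.sum_congr rfl fun y _ => ?_
    rw [PMF.expect_sum]
    simp only [PMF.expect_mul_const, mul_comm _ (acceptInd D y a₀ _)]
    by_cases ha : a₀ ∈ Bl y
    · rw [if_pos ha, if_pos ha, Finset.sum_congr rfl fun a ha' => by
        rw [hf.fair hm y a a₀ ha' ha]]
      rw [Finset.sum_const, nsmul_eq_mul, mul_one, mul_comm, mul_assoc, ENNReal.inv_mul_cancel,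
        mul_one]
      · simpa using Finset.ne_empty_of_mem ha
      · simp
    · simp [ha]

/-- Fair runs that rarely fail have relaxed fair answers. -/
theorem relaxedFairLaw_of_fairFrom {P : Prog} {w d : ℕ} {D : DataStructure F} {S : Finset M}
    {q : M} {Bl : ℕ → Finset M} (hf : FairFrom D Bl (P.exec w d D q) (fun _ => 0)) {NB : ℕ}
    {rad : ℕ → ℝ} (hBl : ∀ y < NB, Bl y = ballIn S q (rad y)) (hBl' : ∀ y, NB ≤ y → Bl y = ∅)
    {c r δ : ℝ} (hrad : ∀ y < NB, rad y ∈ Set.Icc r (c * r))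
    (hfail : (ballIn S q r).Nonempty → (P.run w d D q).expect failInd ≤ ENNReal.ofReal δ) :
    RelaxedFairLaw S c r δ q (answerLaw P w d D q) := by
  classical
  have hsupp : ∀ r', some r' ∈ ((P.run w d D q).map (answerRadius D rad)).support →
      ∃ y < NB, rad y = r' ∧ (ballIn S q r').Nonempty := by
    intro r' hr'
    rw [PMF.mem_support_map_iff] at hr'
    obtain ⟨x, hx, he⟩ := hr'
    by_cases hn : readAnswer D x.1 = none
    · simp [answerRadius, hn] at he
    · obtain ⟨a, ha⟩ := Option.ne_none_iff_exists'.1 hn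
      rw [answerRadius, if_neg hn, Option.some_inj] at he
      have hmem := mem_of_accepted hf rfl hx ha
      have hlt : x.1 1 < NB := by
        by_contra h
        rw [hBl' _ (not_lt.1 h)] at hmem
        simp at hmem
      exact ⟨_, hlt, he, a, by rw [← he, ← hBl _ hlt]; exact hmem⟩
  refine ⟨(P.run w d D q).map (answerRadius D rad),
    map_readAnswer_eq_bind hf rfl hBl hBl', fun hne => ⟨?_, fun r' hr' => ?_⟩, fun he r' hr' => ?_⟩
  · refine le_trans ?_ (hfail hne)
    rw [PMF.apply_eq_expect, PMF.expect_map]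
    refine PMF.expect_mono fun x hx => ?_
    by_cases hr : readAnswer D x.1 = none
    · have h0 : x.1 0 = 0 := by
        by_contra h0
        exact hf.valid rfl x hx h0 hr
      rw [failInd, if_pos h0]
      split_ifs <;> simp
    · simp [answerRadius, hr]
  · obtain ⟨y, hy, rfl, -⟩ := hsupp r' hr'
    exact hrad y hy
  · obtain ⟨y, hy, rfl, hne⟩ := hsupp r' hr'
    refine ⟨lt_of_le_of_ne (hrad y hy).1 ?_, (hrad y hy).2⟩
    intro h
    exact he (h ▸ hne)

end Answers

namespace Query

/-! ### The buckets of a query as sets of points -/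

section Buckets

set_option linter.unusedSectionVars false

variable {M : Type u} [MetricSpace M] {F : ℝ → ℝ → HashFamily.{u, v} M}

/-- The contents of block `x`: table `t` lists the points `pt t i` of `S`, the point `a` is in the
bucket of the query in table `t` if and only if `C a t`, and the near points are those of `B`. -/
structure Layout.Holds (p : Layout) (D : DataStructure F) (q : M) (x : ℕ) (S B : Finset M)
    (pt : ℕ → ℕ → M) (C : M → ℕ → Prop) : Prop where
  points : ∀ t < p.L x, ∀ i < p.n, D.points[(x * p.Lm + t) * p.n + i]? = some (pt t i)
  bij : ∀ t < p.L x, Set.BijOn (pt t) (Set.Iio p.n) S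
  coll : ∀ t < p.L x, ∀ j a, D.points[j]? = some a → (p.Coll D q x j t ↔ C a t)
  near : ∀ j a, D.points[j]? = some a → (nearValue D q j x ≠ 0 ↔ a ∈ B)
  sorted : ∀ t < p.L x, ∀ i j, i ≤ j → j < p.n → p.cmp D q x t i ≤ p.cmp D q x t j

variable {p : Layout} {D : DataStructure F} {q : M} {x : ℕ} {S B : Finset M} {pt : ℕ → ℕ → M}
  {C : M → ℕ → Prop}

/-- The point at the bucket entry number `u`. -/
noncomputable def Layout.entry (p : Layout) (D : DataStructure F) (q : M) (x : ℕ)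
    (pt : ℕ → ℕ → M) (u : ℕ) : M :=
  pt (p.tbl D q x u) (p.lo D q x (p.tbl D q x u) + (u - p.total D q x (p.tbl D q x u)))

theorem Layout.Holds.mem_bucket_iff (h : p.Holds D q x S B pt C) {t i : ℕ} (ht : t < p.L x)
    (hi : i < p.n) : (p.lo D q x t ≤ i ∧ i < p.hi D q x t) ↔ C (pt t i) t := by
  rw [← h.coll t ht _ _ (h.points t ht i hi), ← not_lt]
  have h1 : i < p.lo D q x t ↔ p.cmp D q x t i < 1 :=
    lt_card_filter_range_iff (fun i j hij hj hlt => (h.sorted t ht i j hij hj).trans_lt hlt) hi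
  have h2 : i < p.hi D q x t ↔ p.cmp D q x t i < 2 :=
    lt_card_filter_range_iff (fun i j hij hj hlt => (h.sorted t ht i j hij hj).trans_lt hlt) hi
  rw [h1, h2, Layout.Coll]
  change _ ↔ p.cmp D q x t i = 1
  omega

theorem Layout.Holds.entry_spec (h : p.Holds D q x S B pt C) {u : ℕ}
    (hu : u < p.total D q x (p.L x)) :
    D.points[p.idx D q x u]? = some (p.entry D q x pt u) ∧ p.entry D q x pt u ∈ S ∧
      C (p.entry D q x pt u) (p.tbl D q x u) := by
  have hT := Layout.tbl_lt hu
  obtain ⟨h1, h2⟩ := Layout.offset_eq hu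
  have h3 := p.hi_le (D := D) (q := q) x (p.tbl D q x u)
  have hi : p.lo D q x (p.tbl D q x u) + (u - p.total D q x (p.tbl D q x u)) < p.n := by omega
  refine ⟨?_, (h.bij _ hT).mapsTo hi, (h.mem_bucket_iff hT hi).1 ⟨by omega, by omega⟩⟩
  rw [Layout.idx, h1]
  exact h.points _ hT _ hi

theorem Layout.Holds.entry_injective (h : p.Holds D q x S B pt C) {u u' : ℕ}
    (hu : u < p.total D q x (p.L x)) (hu' : u' < p.total D q x (p.L x))
    (ht : p.tbl D q x u = p.tbl D q x u') (he : p.entry D q x pt u = p.entry D q x pt u') :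
    u = u' := by
  have hT := Layout.tbl_lt hu
  obtain ⟨-, h1⟩ := Layout.offset_eq hu
  obtain ⟨-, h2⟩ := Layout.offset_eq hu'
  have h3 := p.hi_le (D := D) (q := q) x (p.tbl D q x u)
  have h4 := Layout.total_tbl_le hu
  have h5 := Layout.total_tbl_le hu'
  rw [Layout.entry, Layout.entry, ← ht] at he
  rw [← ht] at h2 h5
  have := (h.bij _ hT).injOn (show _ < p.n by omega) (show _ < p.n by omega) he
  omega

theorem Layout.Holds.exists_entry (h : p.Holds D q x S B pt C) {t : ℕ} (ht : t < p.L x) {a : M}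
    (ha : a ∈ S) (hC : C a t) :
    ∃ u < p.total D q x (p.L x), p.tbl D q x u = t ∧ p.entry D q x pt u = a := by
  obtain ⟨i, hi, rfl⟩ := (h.bij t ht).surjOn ha
  obtain ⟨h1, h2⟩ := (h.mem_bucket_iff ht hi).2 hC
  have h3 : p.total D q x t + (i - p.lo D q x t) < p.total D q x (t + 1) := by
    rw [Layout.total_succ]; omega
  have h4 : p.total D q x (t + 1) ≤ p.total D q x (p.L x) := Layout.total_mono x ht
  have h5 : p.tbl D q x (p.total D q x t + (i - p.lo D q x t)) = t := by
    refine le_antisymm (not_lt.1 fun hlt => ?_) ?_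
    · have := (Layout.total_succ_le_iff ht).1 hlt
      omega
    · rcases Nat.eq_zero_or_pos t with h0 | h0
      · omega
      · have := (Layout.total_succ_le_iff (p := p) (D := D) (q := q) (x := x)
          (u := p.total D q x t + (i - p.lo D q x t)) (i := t - 1) (by omega)).2 (by
            rw [Nat.sub_add_cancel h0]; omega)
        omega
  refine ⟨_, by omega, h5, ?_⟩
  rw [Layout.entry, h5]
  congr 1
  omega

/-- If every near point is in the bucket of the query in some table, then the bucket entries that
are accepted represent each near point once. -/
theorem Layout.Holds.covered (h : p.Holds D q x S B pt C) (hBS : B ⊆ S)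
    (hcov : ∀ a ∈ B, ∃ t < p.L x, C a t) : p.Covered D q x B := by
  classical
  have hacc : ∀ u < p.total D q x (p.L x), (p.Acc D q x u ↔ p.entry D q x pt u ∈ B ∧
      ∀ s < p.tbl D q x u, ¬ C (p.entry D q x pt u) s) := by
    intro u hu
    obtain ⟨h1, h2, h3⟩ := h.entry_spec hu
    have hT := Layout.tbl_lt hu
    rw [Layout.Acc, h.near _ _ h1]
    refine and_congr_right fun _ => forall₂_congr fun s hs => ?_
    rw [h.coll s (by omega) _ _ h1]
  refine ⟨fun u hu ha => ⟨_, ((hacc u hu).1 ha).1, (h.entry_spec hu).1⟩, fun a ha => ?_⟩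
  obtain ⟨hT, hC⟩ := Nat.find_spec (hcov a ha)
  have hmin : ∀ s < Nat.find (hcov a ha), ¬ C a s := fun s hs hCs =>
    Nat.find_min (hcov a ha) hs ⟨by omega, hCs⟩
  obtain ⟨u₀, hu₀, ht₀, he₀⟩ := h.exists_entry hT (hBS ha) hC
  refine ⟨u₀, hu₀, fun u hu => ⟨fun ⟨h1, h2⟩ => ?_, ?_⟩⟩
  · obtain ⟨h3, h4, h5⟩ := h.entry_spec hu
    rw [h3, Option.some_inj] at h2
    rw [hacc u hu, h2] at h1
    rw [h2] at h5
    refine h.entry_injective hu hu₀ ?_ (h2.trans he₀.symm)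
    rw [ht₀]
    refine le_antisymm (not_lt.1 fun hlt => h1.2 _ hlt hC) (not_lt.1 fun hlt => hmin _ hlt h5)
  · rintro rfl
    rw [hacc u hu₀, (h.entry_spec hu₀).1, he₀, ht₀]
    exact ⟨⟨ha, hmin⟩, rfl⟩

open Classical in
/-- The total cost of the bucket entries, as a sum over tables and points. -/
theorem Layout.Holds.sum_cost (h : p.Holds D q x S B pt C) :
    ∑ u ∈ Finset.range (p.total D q x (p.L x)), (p.cost D q x u : ENNReal) =
      ∑ t ∈ Finset.range (p.L x), ∑ a ∈ S, if C a t then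
        (if a ∈ B then
          2 * ∑ s ∈ Finset.range (t + 1), if ∀ s' < s, ¬ C a s' then (1 : ENNReal) else 0
        else 1) else 0 := by
  simp only [← Finset.sum_filter (s := S)]
  rw [Finset.sum_sigma']
  refine Finset.sum_nbij (fun u => ⟨p.tbl D q x u, p.entry D q x pt u⟩) ?_ ?_ ?_ ?_
  · intro u hu
    rw [Finset.mem_range] at hu
    obtain ⟨-, h2, h3⟩ := h.entry_spec hu
    simp only [Finset.mem_sigma, Finset.mem_range, Finset.mem_filter]
    exact ⟨Layout.tbl_lt hu, h2, h3⟩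
  · intro u hu u' hu' he
    simp only [Finset.coe_range, Set.mem_Iio] at hu hu'
    simp only [Sigma.mk.injEq, heq_eq_eq] at he
    exact h.entry_injective hu hu' he.1 he.2
  · rintro ⟨t, a⟩ hta
    simp only [Finset.coe_sigma, Finset.coe_range, Set.mem_sigma_iff, Set.mem_Iio,
      Finset.coe_filter, Set.mem_ofPred_eq] at hta
    obtain ⟨u, hu, h1, h2⟩ := h.exists_entry hta.1 hta.2.1 hta.2.2
    exact ⟨u, by simpa using hu, by simp [h1, h2]⟩
  · intro u hu
    rw [Finset.mem_range] at hu
    obtain ⟨h1, -, -⟩ := h.entry_spec hu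
    have hT := Layout.tbl_lt hu
    have hn := h.near _ _ h1
    dsimp only
    rw [Layout.cost]
    by_cases hB : p.entry D q x pt u ∈ B
    · rw [if_neg (hn.2 hB), if_pos hB, Layout.probes, Nat.cast_mul, Finset.sum_boole]
      simp only [Nat.cast_ofNat]
      congr 3
      refine Finset.filter_congr fun s hs => forall₂_congr fun s' hs' => ?_
      rw [Finset.mem_range] at hs
      rw [h.coll s' (by omega) _ _ h1]
    · rw [if_pos (not_not.1 fun h0 => hB (hn.1 h0)), if_neg hB]
      simp

end Buckets

end Query

namespace Query

/-! ### The data structure -/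

section Build

set_option linter.unusedSectionVars false

/-- A finite set can be listed in the order of any key. -/
theorem exists_sorted_listing {M α : Type*} [LinearOrder α] (S : Finset M) (key : M → α)
    (hS : S.Nonempty) : ∃ pt : ℕ → M, Set.BijOn pt (Set.Iio S.card) S ∧
      ∀ i j, i ≤ j → j < S.card → key (pt i) ≤ key (pt j) := by
  classical
  let f : Fin S.card → M := fun i => (S.equivFin.symm i : M)
  let σ := Tuple.sort (key ∘ f)
  have hσ : Monotone ((key ∘ f) ∘ σ) := Tuple.monotone_sort _
  refine ⟨fun i => if h : i < S.card then f (σ ⟨i, h⟩) else hS.choose, ⟨?_, ?_, ?_⟩, ?_⟩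
  · intro i hi
    simp only [Set.mem_Iio] at hi
    simp [hi, f]
  · intro i hi j hj h
    simp only [Set.mem_Iio] at hi hj
    simpa [hi, hj, f, Subtype.ext_iff.symm] using h
  · intro a ha
    refine ⟨σ.symm (S.equivFin ⟨a, ha⟩), by simp, ?_⟩
    simp [f]
  · intro i j hij hj
    have hi : i < S.card := by omega
    simp only [hi, hj, dif_pos]
    exact hσ (show (⟨i, hi⟩ : Fin S.card) ≤ ⟨j, hj⟩ from hij)

variable {M : Type u} [MetricSpace M] {F : ℝ → ℝ → HashFamily.{u, v} M}

/-- The buckets of a concatenation of `K` hash functions, compared lexicographically. -/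
def Buckets (H : HashFamily.{u, v} M) (K : ℕ) : Type v := Lex (Fin K → H.Bucket)

noncomputable instance (H : HashFamily.{u, v} M) (K : ℕ) : LinearOrder (Buckets H K) :=
  inferInstanceAs (LinearOrder (Lex (Fin K → H.Bucket)))

/-- The bucket of `a` under the concatenation of the hash functions with the seeds
`s 0, …, s (K - 1)`. -/
def bucketKey {H : HashFamily.{u, v} M} (s : ℕ → H.Seed) (K : ℕ) (a : M) : Buckets H K :=
  toLex fun l : Fin K => H.hash (s l) a

theorem bucketKey_lt {H : HashFamily.{u, v} M} {s : ℕ → H.Seed} {K m : ℕ} {a b : M} (hm : m < K)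
    (h : ∀ l < m, H.hash (s l) a = H.hash (s l) b) (hlt : H.hash (s m) a < H.hash (s m) b) :
    bucketKey s K a < bucketKey s K b :=
  (⟨⟨m, hm⟩, fun l hl => h l hl, hlt⟩ :
    (toLex fun l : Fin K => H.hash (s l) a) < toLex fun l : Fin K => H.hash (s l) b)

theorem bucketKey_eq_iff {H : HashFamily.{u, v} M} {s : ℕ → H.Seed} {K : ℕ} {a b : M} :
    bucketKey s K a = bucketKey s K b ↔ ∀ l < K, H.hash (s l) a = H.hash (s l) b := by
  refine Iff.trans (b := (fun l : Fin K => H.hash (s l) a) = fun l : Fin K => H.hash (s l) b)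
    Iff.rfl ?_
  rw [funext_iff, Fin.forall_iff]

open Classical in
theorem lexVal_eq {H : HashFamily.{u, v} M} {D : DataStructure F} {q a : M} {j h K : ℕ}
    {s : ℕ → H.Seed} (hs : ∀ l < K, hashValue D q j (h + l) =
      if H.hash (s l) a < H.hash (s l) q then 0
      else if H.hash (s l) a = H.hash (s l) q then 1 else 2) :
    lexVal D q j h K = if bucketKey s K a < bucketKey s K q then 0
      else if bucketKey s K a = bucketKey s K q then 1 else 2 := by
  have key : ∀ i ≤ K,
      (lexVal D q j h i = 0 ∧ ∃ m < i, (∀ l < m, H.hash (s l) a = H.hash (s l) q) ∧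
        H.hash (s m) a < H.hash (s m) q) ∨
      (lexVal D q j h i = 1 ∧ ∀ l < i, H.hash (s l) a = H.hash (s l) q) ∨
      (lexVal D q j h i = 2 ∧ ∃ m < i, (∀ l < m, H.hash (s l) q = H.hash (s l) a) ∧
        H.hash (s m) q < H.hash (s m) a) := by
    intro i
    induction i with
    | zero => intro _; simp [lexVal]
    | succ i ih =>
      intro hi
      rw [lexVal]
      rcases ih (by omega) with ⟨h1, m, hm, h2⟩ | ⟨h1, h2⟩ | ⟨h1, m, hm, h2⟩
      · exact Or.inl ⟨by rw [h1]; simp, m, by omega, h2⟩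
      · rw [if_pos h1, hs i (by omega)]
        rcases lt_trichotomy (H.hash (s i) a) (H.hash (s i) q) with h3 | h3 | h3
        · exact Or.inl ⟨by simp [h3], i, by omega, h2, h3⟩
        · refine Or.inr (Or.inl ⟨by simp [h3], fun l hl => ?_⟩)
          rcases Nat.lt_succ_iff_lt_or_eq.1 hl with h4 | rfl
          exacts [h2 l h4, h3]
        · exact Or.inr (Or.inr ⟨by simp [h3.not_gt, h3.ne'], i, by omega,
            fun l hl => (h2 l hl).symm, h3⟩)
      · exact Or.inr (Or.inr ⟨by rw [h1]; simp, m, by omega, h2⟩)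
  rcases key K le_rfl with ⟨h1, m, hm, h2, h3⟩ | ⟨h1, h2⟩ | ⟨h1, m, hm, h2, h3⟩
  · rw [h1, if_pos (bucketKey_lt hm h2 h3)]
  · rw [h1, bucketKey_eq_iff.2 h2]; simp
  · have := bucketKey_lt hm h2 h3
    rw [h1, if_neg this.not_gt, if_neg this.ne']

/-- The points of `S` in the order of their buckets. -/
noncomputable def sortedTable {H : HashFamily.{u, v} M} {S : Finset M} (hS : S.Nonempty)
    (K : ℕ) (s : ℕ → H.Seed) : ℕ → M :=
  (exists_sorted_listing S (bucketKey s K) hS).choose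

/-- The space of random choices for the preprocessing: a seed for every hash function `l` of every
table `t` of every block `x`. -/
abbrev Seeds (F : ℝ → ℝ → HashFamily.{u, v} M) (c' : ℝ) (rad : ℕ → ℝ) : Type v :=
  (x : ℕ) → ℕ → ℕ → (F c' (rad x)).Seed

/-- The data structure with layout `p`, in which block `x` works with radius `rad x` and with hash
functions for the approximation factor `c'`. Row number `x * Lm + t` of the points and of the hash
functions belongs to table `t` of block `x`. -/
noncomputable def buildData (p : Layout) {S : Finset M} (hS : S.Nonempty) (c' : ℝ) (rad : ℕ → ℝ)
    (ω : Seeds F c' rad) : DataStructure F where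
  words := [p.NB, p.n, p.J, 2 ^ p.J, p.B, p.Lm, p.Km, 0] ++
    (List.range (2 * p.NB)).map fun i => if i % 2 = 0 then p.L (i / 2) else p.K (i / 2)
  points := (List.range (p.NB * p.Lm * p.n)).map fun i =>
    sortedTable hS (p.K (i / p.n / p.Lm)) (ω (i / p.n / p.Lm) (i / p.n % p.Lm)) (i % p.n)
  hashes := (List.range (p.NB * p.Lm * p.Km)).map fun i =>
    ⟨(c', rad (i / p.Km / p.Lm)), ω (i / p.Km / p.Lm) (i / p.Km % p.Lm) (i % p.Km)⟩
  radii := (List.range p.NB).map rad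

variable {p : Layout} {S : Finset M} {hS : S.Nonempty} {c' : ℝ} {rad : ℕ → ℝ}
  {ω : Seeds F c' rad} {q : M}

theorem size_buildData : (buildData p hS c' rad ω).size =
    8 + 3 * p.NB + p.NB * p.Lm * p.n + p.NB * p.Lm * p.Km := by
  simp only [DataStructure.size, buildData, List.length_append, List.length_cons, List.length_nil,
    List.length_map, List.length_range]
  ring

theorem words_buildData_lt (hL : ∀ x < p.NB, p.L x ≤ p.Lm) (hK : ∀ x < p.NB, p.K x ≤ p.Km)
    (hb : p.NB * p.Lm * (p.Km + 1) + p.NB * p.Lm * p.n + p.Km + p.n + 2 * p.Lm + 2 * p.NB + p.B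
      + 110 < 2 ^ p.J) : ∀ y ∈ (buildData p hS c' rad ω).words, y < 2 ^ (p.J + 1) := by
  have hJ : p.J < 2 ^ p.J := Nat.lt_two_pow_self
  have h2 : 2 ^ (p.J + 1) = 2 ^ p.J + 2 ^ p.J := by ring
  intro y hy
  simp only [buildData, List.mem_append, List.mem_cons, List.not_mem_nil, or_false,
    List.mem_map, List.mem_range] at hy
  rcases hy with (h | h | h | h | h | h | h | h) | ⟨i, hi, rfl⟩
  any_goals omega
  have h3 := hL (i / 2) (by omega)
  have h4 := hK (i / 2) (by omega)
  split_ifs <;> omega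

theorem row_lt {N L x t : ℕ} (hx : x < N) (ht : t < L) : x * L + t < N * L :=
  calc x * L + t < x * L + L := by omega
    _ = (x + 1) * L := by ring
    _ ≤ N * L := Nat.mul_le_mul_right _ hx

theorem row_div {L x t : ℕ} (ht : t < L) : (x * L + t) / L = x := by
  rw [mul_comm, Nat.mul_add_div (by omega), Nat.div_eq_of_lt ht, add_zero]

theorem row_mod {L x t : ℕ} (ht : t < L) : (x * L + t) % L = t := by
  rw [mul_comm, Nat.mul_add_mod, Nat.mod_eq_of_lt ht]

theorem points_buildData {x t i : ℕ} (hx : x < p.NB) (ht : t < p.Lm) (hi : i < p.n) :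
    (buildData p hS c' rad ω).points[(x * p.Lm + t) * p.n + i]? =
      some (sortedTable hS (p.K x) (ω x t) i) := by
  have h := row_lt (row_lt hx ht) hi
  simp only [buildData, List.getElem?_map, List.getElem?_range h, Option.map_some, 
    row_mod hi]
  have : ∀ y s, y = x → s = t → some (sortedTable hS (p.K y) (ω y s) i) =
      some (sortedTable hS (p.K x) (ω x t) i) := by rintro _ _ rfl rfl; rfl
  exact this _ _ (by rw [row_div hi, row_div ht]) (by rw [row_div hi, row_mod ht])

theorem hashes_buildData {x t l : ℕ} (hx : x < p.NB) (ht : t < p.Lm) (hl : l < p.Km) :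
    (buildData p hS c' rad ω).hashes[(x * p.Lm + t) * p.Km + l]? =
      some ⟨(c', rad x), ω x t l⟩ := by
  have h := row_lt (row_lt hx ht) hl
  simp only [buildData, List.getElem?_map, List.getElem?_range h, Option.map_some, 
    row_mod hl]
  have : ∀ y s, y = x → s = t →
      some (⟨(c', rad y), ω y s l⟩ : Σ x : ℝ × ℝ, (F x.1 x.2).Seed) =
        some ⟨(c', rad x), ω x t l⟩ := by rintro _ _ rfl rfl; rfl
  exact this _ _ (by rw [row_div hl, row_div ht]) (by rw [row_div hl, row_mod ht])

theorem mem_of_points_buildData (hn : p.n = S.card) {j : ℕ} {a : M}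
    (h : (buildData p hS c' rad ω).points[j]? = some a) : a ∈ S := by
  obtain ⟨i, hi, rfl⟩ := List.mem_map.1 (List.mem_of_getElem? h)
  rw [List.mem_range] at hi
  have hpos : 0 < p.n := Nat.pos_of_ne_zero fun h0 => by rw [h0] at hi; simp at hi
  refine (exists_sorted_listing S _ hS).choose_spec.1.mapsTo ?_
  rw [Set.mem_Iio, ← hn]
  exact Nat.mod_lt _ hpos

open Classical in
theorem lexVal_buildData {x t : ℕ} (hx : x < p.NB) (ht : t < p.Lm) (hK : p.K x ≤ p.Km) {j : ℕ}
    {a : M} (hj : (buildData p hS c' rad ω).points[j]? = some a) :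
    lexVal (buildData p hS c' rad ω) q j ((x * p.Lm + t) * p.Km) (p.K x) =
      if bucketKey (ω x t) (p.K x) a < bucketKey (ω x t) (p.K x) q then 0
      else if bucketKey (ω x t) (p.K x) a = bucketKey (ω x t) (p.K x) q then 1 else 2 := by
  refine lexVal_eq fun l hl => ?_
  rw [hashValue, hj, hashes_buildData hx ht (by omega)]

/-- The point `a` is in the bucket of `q` in table `t` of block `x`. -/
def Collide (p : Layout) (ω : Seeds F c' rad) (q : M) (x : ℕ) (a : M) (t : ℕ) : Prop :=
  ∀ l < p.K x, (F c' (rad x)).hash (ω x t l) a = (F c' (rad x)).hash (ω x t l) q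

theorem fits_buildData (hn : p.n = S.card) (hL : ∀ x < p.NB, p.L x ≤ p.Lm)
    (hK : ∀ x < p.NB, p.K x ≤ p.Km)
    (hb : p.NB * p.Lm * (p.Km + 1) + p.NB * p.Lm * p.n + p.Km + p.n + 2 * p.Lm + 2 * p.NB + p.B
      + 110 < 2 ^ p.J) : p.Fits (buildData p hS c' rad ω) q := by
  refine ⟨rfl, rfl, rfl, rfl, rfl, rfl, rfl, fun x hx => ?_, fun x hx => ?_, hL, hK, hb, ?_⟩
  · have h1 : 2 * x < 2 * p.NB := by omega
    simp only [buildData]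
    rw [List.getD_append_right _ _ _ _ (by simp)]
    simp [List.getD_eq_getElem?_getD, List.getElem?_range h1]
  · have h1 : 9 + 2 * x - 8 < 2 * p.NB := by omega
    have h2 : (9 + 2 * x - 8) % 2 = 1 := by omega
    have h3 : (9 + 2 * x - 8) / 2 = x := by omega
    simp only [buildData]
    rw [List.getD_append_right _ _ _ _ (by simp; omega)]
    simp [List.getD_eq_getElem?_getD, List.getElem?_range h1, h2, h3]
  · classical
    intro x hx t ht i j hij hj
    have ht' : t < p.Lm := ht.trans_le (hL x hx)
    rw [Layout.cmp, Layout.cmp,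
      lexVal_buildData hx ht' (hK x hx) (points_buildData hx ht' (hij.trans_lt hj)),
      lexVal_buildData hx ht' (hK x hx) (points_buildData hx ht' hj)]
    have hle : bucketKey (ω x t) (p.K x) (sortedTable hS (p.K x) (ω x t) i) ≤
        bucketKey (ω x t) (p.K x) (sortedTable hS (p.K x) (ω x t) j) :=
      (exists_sorted_listing S _ hS).choose_spec.2 i j hij (hn ▸ hj)
    generalize bucketKey (ω x t) (p.K x) (sortedTable hS (p.K x) (ω x t) i) = u at *
    generalize bucketKey (ω x t) (p.K x) (sortedTable hS (p.K x) (ω x t) j) = v at *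
    generalize bucketKey (ω x t) (p.K x) q = z at *
    by_cases h1 : u < z
    · simp [h1]
    · have h2 : ¬ v < z := fun h => h1 (hle.trans_lt h)
      rw [if_neg h1, if_neg h2]
      by_cases h3 : v = z
      · have h4 : u = z := le_antisymm (h3 ▸ hle) (not_lt.1 h1)
        simp [h3, h4]
      · rw [if_neg h3]
        split_ifs <;> omega

theorem holds_buildData (hn : p.n = S.card) (hL : ∀ x < p.NB, p.L x ≤ p.Lm)
    (hK : ∀ x < p.NB, p.K x ≤ p.Km) (hfit : p.Fits (buildData p hS c' rad ω) q) {x : ℕ}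
    (hx : x < p.NB) :
    p.Holds (buildData p hS c' rad ω) q x S (ballIn S q (rad x))
      (fun t => sortedTable hS (p.K x) (ω x t)) (Collide p ω q x) := by
  classical
  refine ⟨fun t ht i hi => points_buildData hx (ht.trans_le (hL x hx)) hi, fun t ht => ?_,
    fun t ht j a hj => ?_, fun j a hj => ?_, hfit.sorted x hx⟩
  · rw [hn]
    exact (exists_sorted_listing S _ hS).choose_spec.1
  · rw [Layout.Coll, lexVal_buildData hx (ht.trans_le (hL x hx)) (hK x hx) hj, Collide]
    rw [← bucketKey_eq_iff (s := ω x t)]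
    by_cases h2 : bucketKey (ω x t) (p.K x) a < bucketKey (ω x t) (p.K x) q
    · simp [h2, h2.ne]
    · by_cases h3 : bucketKey (ω x t) (p.K x) a = bucketKey (ω x t) (p.K x) q
      · simp [h3]
      · simp [h2, h3]
  · have hr : (buildData p hS c' rad ω).radii[x]? = some (rad x) := by
      simp [buildData, List.getElem?_range hx]
    rw [nearValue, hj, hr, ballIn, Finset.mem_filter]
    have := mem_of_points_buildData hn hj
    by_cases h : dist a q ≤ rad x <;> simp [h, this]

end Build
end Query

namespace Query

/-! ### Collisions in independent tables -/

section Tables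

set_option linter.unusedSectionVars false

section Hits

variable {X : Type v} [MeasurableSpace X] (ν : Measure X) [IsProbabilityMeasure ν] {E : Set X}

/-- The event that the independent trials `0, …, s - 1` miss `E` and trial `t` hits it. -/
def hitAfter (E : Set X) (s t : ℕ) : Set (ℕ → X) := {τ | τ t ∈ E ∧ ∀ s' < s, τ s' ∉ E}

theorem measurableSet_hitAfter (hE : MeasurableSet E) (s t : ℕ) :
    MeasurableSet (hitAfter E s t) := by
  have : hitAfter E s t = (fun τ => τ t) ⁻¹' E ∩ ⋂ s' ∈ Set.Iio s, (fun τ => τ s') ⁻¹' Eᶜ := by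
    ext τ; simp [hitAfter]
  rw [this]
  exact (measurable_pi_apply t hE).inter
    (MeasurableSet.biInter (Set.to_countable _) fun s' _ => measurable_pi_apply s' hE.compl)

theorem measure_hitAfter (hE : MeasurableSet E) {s t : ℕ} (hst : s ≤ t) :
    Measure.infinitePi (fun _ : ℕ => ν) (hitAfter E s t) = ν E * (1 - ν E) ^ s := by
  classical
  have : hitAfter E s t =
      Set.pi (insert t (Finset.range s) : Finset ℕ) (fun i => if i = t then E else Eᶜ) := by
    ext τ
    simp only [hitAfter, Set.mem_ofPred_eq, Set.mem_pi, Finset.coe_insert, Set.mem_insert_iff,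
      Finset.coe_range, Set.mem_Iio, forall_eq_or_imp, if_true]
    refine and_congr_right fun _ => forall₂_congr fun i hi => ?_
    rw [if_neg (by omega)]
    rfl
  rw [this, Measure.infinitePi_pi, Finset.prod_insert (by simp; omega), if_pos rfl]
  · congr 1
    rw [Finset.prod_congr rfl fun i hi => ?_, Finset.prod_const, Finset.card_range]
    rw [Finset.mem_range] at hi
    rw [if_neg (by omega), prob_compl_eq_one_sub hE]
  · intro i _
    split_ifs
    exacts [hE, hE.compl]

theorem measure_no_hit (hE : MeasurableSet E) (L : ℕ) :
    Measure.infinitePi (fun _ : ℕ => ν) {τ | ∀ t < L, τ t ∉ E} = (1 - ν E) ^ L := by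
  have : {τ : ℕ → X | ∀ t < L, τ t ∉ E} = Set.pi (Finset.range L) (fun _ => Eᶜ) := by
    ext τ; simp
  rw [this, Measure.infinitePi_pi _ fun _ _ => hE.compl]
  simp [prob_compl_eq_one_sub hE]

/-- The first trial that hits `E` is one of the first `m` trials with probability at most one. -/
theorem sum_first_hit_le_one {π : ENNReal} (hπ : π ≤ 1) (m : ℕ) :
    ∑ s ∈ Finset.range m, π * (1 - π) ^ s ≤ 1 := by
  have h : ∑ s ∈ Finset.range m, π * (1 - π) ^ s + (1 - π) ^ m = 1 := by
    induction m with
    | zero => simp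
    | succ m ih =>
      rw [Finset.sum_range_succ, add_assoc, pow_succ' (1 - π) m, ← add_mul,
        add_tsub_cancel_of_le hπ, one_mul, ih]
  exact le_self_add.trans_eq h

end Hits

variable {M : Type u} {H : HashFamily.{u, v} M}

/-- The seeds of one table for which `a` and `q` have the same bucket. -/
def sameBucket (H : HashFamily.{u, v} M) (K : ℕ) (q a : M) : Set (ℕ → H.Seed) :=
  {s | ∀ l < K, H.hash (s l) a = H.hash (s l) q}

/-- The law of the seeds of one table. -/
noncomputable def seedLaw (H : HashFamily.{u, v} M) : Measure (ℕ → H.Seed) :=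
  Measure.infinitePi fun _ => H.law

noncomputable instance : IsProbabilityMeasure (seedLaw H) := by
  unfold seedLaw; infer_instance

/-- The law of the seeds of all the tables of a block. -/
noncomputable def tableLaw (H : HashFamily.{u, v} M) : Measure (ℕ → ℕ → H.Seed) :=
  Measure.infinitePi fun _ => seedLaw H

noncomputable instance : IsProbabilityMeasure (tableLaw H) := by
  unfold tableLaw; infer_instance

theorem sameBucket_eq_pi (K : ℕ) (q a : M) : sameBucket H K q a =
    Set.pi (Finset.range K) (fun _ => {s | H.hash s a = H.hash s q}) := by
  ext s; simp [sameBucket]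

theorem measurableSet_sameBucket (K : ℕ) (q a : M) : MeasurableSet (sameBucket H K q a) := by
  rw [sameBucket_eq_pi]
  exact MeasurableSet.pi (Set.to_countable _) fun _ _ => H.measurableSet_collision a q

theorem seedLaw_sameBucket (K : ℕ) (q a : M) :
    seedLaw H (sameBucket H K q a) = ENNReal.ofReal (H.collisionProb a q ^ K) := by
  rw [sameBucket_eq_pi, seedLaw, Measure.infinitePi_pi _ fun _ _ => H.measurableSet_collision a q,
    Finset.prod_const, Finset.card_range, HashFamily.collisionProb,
    ENNReal.ofReal_pow measureReal_nonneg, ofReal_measureReal]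

open Classical in
/-- The cost of all bucket entries of a block with `L` tables. A near point is charged, in every
table where it collides, for the tables that come before its first collision; other points are
charged one unit per collision. -/
noncomputable def tableCost (H : HashFamily.{u, v} M) (K L : ℕ) (S B : Finset M) (q : M)
    (τ : ℕ → ℕ → H.Seed) : ENNReal :=
  ∑ t ∈ Finset.range L, ∑ a ∈ S, if τ t ∈ sameBucket H K q a then
    (if a ∈ B then 2 * ∑ s ∈ Finset.range (t + 1),
      if ∀ s' < s, τ s' ∉ sameBucket H K q a then (1 : ENNReal) else 0
    else 1) else 0

open Classical in
theorem tableCost_eq (K L : ℕ) (S B : Finset M) (q : M) : tableCost H K L S B q =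
    fun τ => ∑ t ∈ Finset.range L, ∑ a ∈ S, if a ∈ B then
      2 * ∑ s ∈ Finset.range (t + 1), (hitAfter (sameBucket H K q a) s t).indicator 1 τ
      else (hitAfter (sameBucket H K q a) 0 t).indicator 1 τ := by
  funext τ
  unfold tableCost
  refine Finset.sum_congr rfl fun t _ => Finset.sum_congr rfl fun a _ => ?_
  by_cases h : τ t ∈ sameBucket H K q a <;> by_cases hB : a ∈ B <;>
    simp [h, hB, hitAfter, Set.indicator_apply]

theorem measurable_tableCost (K L : ℕ) (S B : Finset M) (q : M) :
    Measurable (tableCost H K L S B q) := by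
  classical
  have hm : ∀ a s t, Measurable
      ((hitAfter (sameBucket H K q a) s t).indicator (1 : (ℕ → ℕ → H.Seed) → ENNReal)) :=
    fun a s t => measurable_one.indicator
      (measurableSet_hitAfter (measurableSet_sameBucket K q a) s t)
  rw [tableCost_eq]
  refine Finset.measurable_sum _ fun t _ => Finset.measurable_sum _ fun a _ => ?_
  split_ifs
  · exact (Finset.measurable_sum _ fun s _ => hm a s t).const_mul _
  · exact hm a 0 t

open Classical in
theorem lintegral_tableCost_le (K L : ℕ) (S B : Finset M) (q : M) :
    ∫⁻ τ, tableCost H K L S B q τ ∂tableLaw H ≤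
      L * ∑ a ∈ S, if a ∈ B then 2 else ENNReal.ofReal (H.collisionProb a q ^ K) := by
  have hE := fun a => measurableSet_sameBucket (H := H) K q a
  have hm : ∀ a s t, Measurable
      ((hitAfter (sameBucket H K q a) s t).indicator (1 : (ℕ → ℕ → H.Seed) → ENNReal)) :=
    fun a s t => measurable_one.indicator (measurableSet_hitAfter (hE a) s t)
  have hint : ∀ a s t, s ≤ t → ∫⁻ τ, (hitAfter (sameBucket H K q a) s t).indicator 1 τ ∂tableLaw H =
      seedLaw H (sameBucket H K q a) * (1 - seedLaw H (sameBucket H K q a)) ^ s := by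
    intro a s t hst
    rw [lintegral_indicator_one (measurableSet_hitAfter (hE a) s t), tableLaw,
      measure_hitAfter _ (hE a) hst]
  have hm2 : ∀ t a, Measurable fun τ => if a ∈ B then
      2 * ∑ s ∈ Finset.range (t + 1), (hitAfter (sameBucket H K q a) s t).indicator 1 τ
      else (hitAfter (sameBucket H K q a) 0 t).indicator (1 : (ℕ → ℕ → H.Seed) → ENNReal) τ := by
    intro t a
    split_ifs
    · exact (Finset.measurable_sum _ fun s _ => hm a s t).const_mul _
    · exact hm a 0 t
  rw [tableCost_eq, lintegral_finsetSum _ fun t _ => Finset.measurable_sum _ fun a _ => hm2 t a]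
  refine (Finset.sum_le_card_nsmul _ _ _ fun t _ => ?_).trans_eq
    (by rw [Finset.card_range, nsmul_eq_mul])
  rw [lintegral_finsetSum _ fun a _ => hm2 t a]
  refine Finset.sum_le_sum fun a _ => ?_
  by_cases hB : a ∈ B
  · simp only [hB, if_true]
    rw [lintegral_const_mul _ (Finset.measurable_sum _ fun s _ => hm a s t),
      lintegral_finsetSum _ fun s _ => hm a s t, Finset.sum_congr rfl fun s hs =>
        hint a s t (by rw [Finset.mem_range] at hs; omega)]
    exact (mul_le_mul_right (sum_first_hit_le_one prob_le_one _) 2).trans (by simp)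
  · simp only [hB, if_false]
    rw [hint a 0 t (by omega), pow_zero, mul_one, seedLaw_sameBucket]

/-- A union bound for the near points that do not collide with `q` in any of `L` tables. -/
theorem tableLaw_not_covered_le (K L : ℕ) (B : Finset M) (q : M) {π : ℝ} (hπ : 0 ≤ π)
    (hπB : ∀ a ∈ B, π ≤ H.collisionProb a q ^ K) :
    tableLaw H {τ | ¬ ∀ a ∈ B, ∃ t < L, τ t ∈ sameBucket H K q a} ≤
      ENNReal.ofReal (B.card * Real.exp (-(π * L))) := by
  have h1 : {τ : ℕ → ℕ → H.Seed | ¬ ∀ a ∈ B, ∃ t < L, τ t ∈ sameBucket H K q a} =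
      ⋃ a ∈ B, {τ | ∀ t < L, τ t ∉ sameBucket H K q a} := by
    ext τ; simp
  rw [h1]
  refine (measure_biUnion_finset_le _ _).trans ?_
  rw [ENNReal.ofReal_mul (by positivity), ENNReal.ofReal_natCast, ← nsmul_eq_mul]
  refine Finset.sum_le_card_nsmul _ _ _ fun a ha => ?_
  rw [tableLaw, measure_no_hit _ (measurableSet_sameBucket K q a), seedLaw_sameBucket,
    ← ENNReal.ofReal_one, ← ENNReal.ofReal_sub _ (hπ.trans (hπB a ha)),
    ← ENNReal.ofReal_pow]
  · refine ENNReal.ofReal_le_ofReal ?_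
    have h2 : H.collisionProb a q ^ K ≤ 1 := pow_le_one₀ measureReal_nonneg measureReal_le_one
    calc (1 - H.collisionProb a q ^ K) ^ L ≤ (Real.exp (-π)) ^ L := by
          refine pow_le_pow_left₀ (by linarith) ?_ L
          have := Real.add_one_le_exp (-π)
          linarith [hπB a ha]
      _ = Real.exp (-(π * L)) := by rw [← Real.exp_nat_mul]; ring_nf
  · linarith [show H.collisionProb a q ^ K ≤ 1 from
      pow_le_one₀ measureReal_nonneg measureReal_le_one]

end Tables

end Query

namespace Query

/-! ### The expected cost of a block -/

section Cost

set_option linter.unusedSectionVars false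

variable {M : Type u} [MetricSpace M] {H : HashFamily.{u, v} M}

/-- The smallest collision probability at distance at most `s`. By monotonicity it also bounds the
collision probabilities at larger distances from above. -/
noncomputable def nearProb (H : HashFamily.{u, v} M) (s : ℝ) : ℝ :=
  sInf {y | ∃ a b : M, dist a b ≤ s ∧ y = H.collisionProb a b}

variable {c s p₁ p₂ : ℝ}

theorem nearProb_le {a b : M} (h : dist a b ≤ s) : nearProb H s ≤ H.collisionProb a b :=
  csInf_le ⟨0, by rintro _ ⟨a, b, -, rfl⟩; exact measureReal_nonneg⟩ ⟨a, b, h, rfl⟩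

theorem le_nearProb [Nonempty M] (hs : 0 ≤ s) {y : ℝ}
    (h : ∀ a b : M, dist a b ≤ s → y ≤ H.collisionProb a b) : y ≤ nearProb H s := by
  obtain ⟨a⟩ := ‹Nonempty M›
  refine le_csInf ⟨_, a, a, by simpa using hs, rfl⟩ ?_
  rintro _ ⟨a, b, hab, rfl⟩
  exact h a b hab

theorem nearProb_le_one [Nonempty M] (hs : 0 ≤ s) : nearProb H s ≤ 1 := by
  obtain ⟨a⟩ := ‹Nonempty M›
  exact (nearProb_le (a := a) (b := a) (by simpa using hs)).trans measureReal_le_one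

theorem collisionProb_le_nearProb [Nonempty M] (h : IsMonotoneLSH H c s p₁ p₂) (hs : 0 ≤ s)
    {a b : M} (hab : s < dist a b) : H.collisionProb a b ≤ nearProb H s :=
  le_nearProb hs fun x y hxy => h.monotone x y a b (hxy.trans hab.le)

/-- Near points cost at most `2 L`, points between `s` and `c s` at most `L π`, where `π` is the
probability that two points at distance `s` collide in a table, and far points at most `L / n`. -/
theorem lintegral_tableCost_ball_le (h : IsMonotoneLSH H c s p₁ p₂) (hs : 0 ≤ s)
    {S : Finset M} (hS : S.Nonempty) (q : M) {K L : ℕ} {Λ : ℝ}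
    (hK : p₂ ^ K ≤ 1 / S.card) (hL : (L : ℝ) * nearProb H s ^ K ≤ Λ) :
    ∫⁻ τ, tableCost H K L S (ballIn S q s) q τ ∂tableLaw H ≤
      ENNReal.ofReal (2 * L * (ballIn S q s).card + Λ * (ballIn S q (c * s)).card + L) := by
  classical
  have : Nonempty M := ⟨hS.choose⟩
  have hn : (0 : ℝ) < S.card := by exact_mod_cast hS.card_pos
  have h0 : 0 ≤ nearProb H s := le_nearProb hs fun a b _ => measureReal_nonneg
  have hΛ : 0 ≤ Λ := le_trans (by positivity) hL
  refine (lintegral_tableCost_le K L S _ q).trans ?_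
  have hterm : ∀ a ∈ S, (if a ∈ ballIn S q s then 2
      else ENNReal.ofReal (H.collisionProb a q ^ K)) ≤
      ENNReal.ofReal ((if a ∈ ballIn S q s then 2 else 0) +
        (if a ∈ ballIn S q (c * s) then nearProb H s ^ K else 0) + 1 / S.card) := by
    intro a ha
    by_cases hB : a ∈ ballIn S q s
    · simp only [hB, if_true]
      rw [← ENNReal.ofReal_ofNat]
      refine ENNReal.ofReal_le_ofReal ?_
      split_ifs
      · have : 0 ≤ nearProb H s ^ K + 1 / (S.card : ℝ) := by positivity
        linarith
      · have : 0 ≤ 1 / (S.card : ℝ) := by positivity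
        linarith
    · have hd : s < dist a q := by
        by_contra hle
        exact hB (Finset.mem_filter.2 ⟨ha, not_lt.1 hle⟩)
      simp only [hB, if_false, zero_add]
      refine ENNReal.ofReal_le_ofReal ?_
      by_cases hm : a ∈ ballIn S q (c * s)
      · rw [if_pos hm]
        have : H.collisionProb a q ^ K ≤ nearProb H s ^ K :=
          pow_le_pow_left₀ measureReal_nonneg (collisionProb_le_nearProb h hs hd) K
        have : 0 ≤ 1 / (S.card : ℝ) := by positivity
        linarith
      · rw [if_neg hm, zero_add]
        have hd' : c * s ≤ dist a q := by
          by_contra hlt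
          exact hm (Finset.mem_filter.2 ⟨ha, (not_le.1 hlt).le⟩)
        exact (pow_le_pow_left₀ measureReal_nonneg (h.far a q hd') K).trans hK
  have hsum := Finset.sum_le_sum hterm
  rw [← ENNReal.ofReal_sum_of_nonneg fun a _ => by positivity, Finset.sum_add_distrib,
    Finset.sum_add_distrib, ← Finset.sum_filter, ← Finset.sum_filter] at hsum
  have hf : ∀ y, S.filter (fun a => a ∈ ballIn S q y) = ballIn S q y := by
    intro y
    ext a
    simp only [Finset.mem_filter, ballIn]
    tauto
  rw [hf, hf] at hsum
  simp only [Finset.sum_const, nsmul_eq_mul] at hsum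
  rw [mul_one_div_cancel hn.ne'] at hsum
  refine (mul_le_mul_right hsum (L : ENNReal)).trans ?_
  rw [← ENNReal.ofReal_natCast, ← ENNReal.ofReal_mul (by positivity)]
  refine ENNReal.ofReal_le_ofReal ?_
  have h3 := mul_le_mul_of_nonneg_right hL (Nat.cast_nonneg (α := ℝ) (ballIn S q (c * s)).card)
  nlinarith

end Cost

/-! ### Independent blocks -/

section Blocks

set_option linter.unusedSectionVars false

variable {M : Type u} [MetricSpace M] {F : ℝ → ℝ → HashFamily.{u, v} M} {c' : ℝ} {rad : ℕ → ℝ}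

/-- The law of all random choices of the preprocessing. -/
noncomputable def seedsLaw (F : ℝ → ℝ → HashFamily.{u, v} M) (c' : ℝ) (rad : ℕ → ℝ) :
    Measure (Seeds F c' rad) :=
  Measure.infinitePi fun x => tableLaw (F c' (rad x))

noncomputable instance : IsProbabilityMeasure (seedsLaw F c' rad) := by
  unfold seedsLaw; infer_instance

theorem seedsLaw_preimage_le (x : ℕ) (A : Set (ℕ → ℕ → (F c' (rad x)).Seed)) :
    seedsLaw F c' rad {ω | ω x ∈ A} ≤ tableLaw (F c' (rad x)) A := by
  have h := measurePreserving_eval_infinitePi (fun x => tableLaw (F c' (rad x))) x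
  calc seedsLaw F c' rad {ω | ω x ∈ A}
      ≤ seedsLaw F c' rad ((Function.eval x) ⁻¹' (toMeasurable (tableLaw (F c' (rad x))) A)) :=
        measure_mono fun ω hω => subset_toMeasurable _ _ hω
    _ = tableLaw (F c' (rad x)) A := by
        rw [seedsLaw, h.measure_preimage (measurableSet_toMeasurable _ _).nullMeasurableSet,
          measure_toMeasurable]

theorem lintegral_seedsLaw_prod (f : (x : ℕ) → (ℕ → ℕ → (F c' (rad x)).Seed) → ENNReal)
    (hf : ∀ x, Measurable (f x)) (N : ℕ) :
    ∫⁻ ω, ∏ x ∈ Finset.range N, f x (ω x) ∂seedsLaw F c' rad =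
      ∏ x ∈ Finset.range N, ∫⁻ τ, f x τ ∂tableLaw (F c' (rad x)) := by
  rw [ProbabilityTheory.lintegral_prod_eq_prod_lintegral_of_indepFun (Finset.range N)
    (fun x (ω : Seeds F c' rad) => f x (ω x))]
  · refine Finset.prod_congr rfl fun x _ => ?_
    exact (measurePreserving_eval_infinitePi
      (fun x => tableLaw (F c' (rad x))) x).lintegral_comp (hf x)
  · exact ProbabilityTheory.iIndepFun_infinitePi hf
  · exact fun x => (hf x).comp (measurable_pi_apply x)

/-- A product of independent factors, `R` of which have mean at most one half, is rarely large. -/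
theorem seedsLaw_prod_gt_le {k R i : ℕ} (hi : i < k)
    (f : (x : ℕ) → (ℕ → ℕ → (F c' (rad x)).Seed) → ENNReal) (hf : ∀ x, Measurable (f x))
    (hfi : ∀ x, x % k = i → ∫⁻ τ, f x τ ∂tableLaw (F c' (rad x)) ≤ 2⁻¹)
    {δ : ENNReal} (hδ : δ ≠ 0) (hδ' : δ ≠ ⊤) :
    seedsLaw F c' rad {ω | ¬ ∏ x ∈ Finset.range (k * R),
      (if x % k = i then f x (ω x) else 1) ≤ δ} ≤ 2⁻¹ ^ R / δ := by
  let g : (x : ℕ) → (ℕ → ℕ → (F c' (rad x)).Seed) → ENNReal :=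
    fun x τ => if x % k = i then f x τ else 1
  have hg : ∀ x, Measurable (g x) := fun x => by
    by_cases hx : x % k = i
    · simpa [g, hx] using hf x
    · simp [g, hx]
  have hle : ∫⁻ ω, ∏ x ∈ Finset.range (k * R), g x (ω x) ∂seedsLaw F c' rad ≤ 2⁻¹ ^ R := by
    rw [lintegral_seedsLaw_prod g hg]
    refine (Finset.prod_le_prod' (g := fun x => if x % k = i then (2⁻¹ : ENNReal) else 1)
      fun x _ => ?_).trans ?_
    · by_cases hx : x % k = i
      · simpa [g, hx] using hfi x hx
      · simp [g, hx]
    · induction R with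
      | zero => simp
      | succ R ih =>
        rw [mul_add, mul_one, Finset.prod_range_add, pow_succ]
        refine mul_le_mul' ih ?_
        rw [Finset.prod_congr rfl fun j hj => by
          rw [Nat.mul_add_mod, Nat.mod_eq_of_lt (Finset.mem_range.1 hj)], Finset.prod_ite_eq']
        simp [hi]
  have hm : Measurable fun ω : Seeds F c' rad => ∏ x ∈ Finset.range (k * R), g x (ω x) :=
    Finset.measurable_prod _ fun x _ => (hg x).comp (measurable_pi_apply x)
  refine le_trans (measure_mono fun ω hω => ?_)
    ((meas_ge_le_lintegral_div hm.aemeasurable hδ hδ').trans (ENNReal.div_le_div_right hle δ))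
  exact (not_le.1 hω).le

end Blocks

end Query

/-! ### A level where the balls grow slowly -/

/-- One of the `k` consecutive growth factors of the balls between the radii `r` and `c r` is at
most `n ^ (1 / k)`, because their product is at most `n`. -/
theorem exists_slow_growth {M : Type u} [MetricSpace M] (S : Finset M) {c r : ℝ} (hc : 1 < c)
    (hr : 0 < r) {k : ℕ} (hk : 1 ≤ k) (q : M) (hq : (ballIn S q r).Nonempty) :
    ∃ i < k, ((ballIn S q (r * c ^ (((i : ℝ) + 1) / k))).card : ℝ) /
      ((ballIn S q (r * c ^ ((i : ℝ) / k))).card : ℝ) ≤ (S.card : ℝ) ^ (1 / (k : ℝ)) := by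
  classical
  by_contra! hcon
  have hsub : ∀ s, ballIn S q s ⊆ S := fun s => Finset.filter_subset _ _
  have hpos : ∀ i : ℕ, (0 : ℝ) < (ballIn S q (r * c ^ ((i : ℝ) / k))).card := by
    intro i
    obtain ⟨a, ha⟩ := hq
    have h1 : 1 ≤ c ^ ((i : ℝ) / k) := Real.one_le_rpow hc.le (by positivity)
    rw [ballIn, Finset.mem_filter] at ha
    have : (ballIn S q (r * c ^ ((i : ℝ) / k))).Nonempty :=
      ⟨a, by rw [ballIn, Finset.mem_filter]; exact ⟨ha.1, ha.2.trans (by nlinarith)⟩⟩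
    exact_mod_cast this.card_pos
  set z := (S.card : ℝ) ^ (1 / (k : ℝ)) with hz
  have hz0 : 0 ≤ z := by positivity
  have hstep : ∀ i < k, z * (ballIn S q (r * c ^ ((i : ℝ) / k))).card <
      (ballIn S q (r * c ^ (((i + 1 : ℕ) : ℝ) / k))).card := by
    intro i hi
    have := hcon i hi
    rw [lt_div_iff₀ (hpos i)] at this
    push_cast
    exact this
  have hind : ∀ i ≤ k, z ^ i ≤ (ballIn S q (r * c ^ ((i : ℝ) / k))).card := by
    intro i
    induction i with
    | zero =>
      intro _
      have := hpos 0
      rw [pow_zero]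
      exact_mod_cast this
    | succ i ih =>
      intro hi
      rw [pow_succ']
      exact (mul_le_mul_of_nonneg_left (ih (by omega)) hz0).trans (hstep i (by omega)).le
  have h1 := hstep (k - 1) (by omega)
  rw [Nat.sub_add_cancel hk] at h1
  have h2 := mul_le_mul_of_nonneg_left (hind (k - 1) (by omega)) hz0
  rw [← pow_succ', Nat.sub_add_cancel hk, hz, ← Real.rpow_natCast, ← Real.rpow_mul (by positivity),
    one_div_mul_cancel (by positivity), Real.rpow_one] at h2
  have h3 : ((ballIn S q (r * c ^ ((k : ℝ) / k))).card : ℝ) ≤ S.card := by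
    exact_mod_cast Finset.card_le_card (hsub _)
  rw [hz] at h1
  linarith

namespace Query

/-! ### Fairness of the answer to one query -/

section OneQuery

variable {M : Type u} [MetricSpace M] {F : ℝ → ℝ → HashFamily.{u, v} M}

/-- The radii of the blocks: block `x` has level `x % k`. -/
noncomputable def levelRadius (c r : ℝ) (k x : ℕ) : ℝ := r * c ^ (((x % k : ℕ) : ℝ) / k)

theorem levelRadius_mem {c r : ℝ} (hc : 1 < c) (hr : 0 < r) {k : ℕ} (hk : 1 ≤ k) (x : ℕ) :
    levelRadius c r k x ∈ Set.Icc r (c * r) := by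
  have hk0 : (0 : ℝ) < k := by exact_mod_cast hk
  have h1 : 1 ≤ c ^ (((x % k : ℕ) : ℝ) / k) := Real.one_le_rpow hc.le (by positivity)
  have h2 : c ^ (((x % k : ℕ) : ℝ) / k) ≤ c ^ (1 : ℝ) := by
    refine Real.rpow_le_rpow_of_exponent_le hc.le ?_
    rw [div_le_one hk0]
    exact_mod_cast (Nat.mod_lt x (by omega)).le
  rw [Real.rpow_one] at h2
  exact ⟨by unfold levelRadius; nlinarith, by unfold levelRadius; nlinarith⟩

/-- The requirements on the parameters of the data structure under which its answers are fair. -/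
structure GoodLayout (F : ℝ → ℝ → HashFamily.{u, v} M) (S : Finset M) (c r : ℝ) (k R : ℕ) (Λ : ℝ)
    (p : Layout) : Prop where
  NB_eq : p.NB = k * R
  n_eq : p.n = S.card
  L_le : ∀ x, p.L x ≤ p.Lm
  K_le : ∀ x, p.K x ≤ p.Km
  bound : p.NB * p.Lm * (p.Km + 1) + p.NB * p.Lm * p.n + p.Km + p.n + 2 * p.Lm + 2 * p.NB + p.B
    + 110 < 2 ^ p.J
  lsh : ∀ x, ∃ p₁ p₂ : ℝ, IsMonotoneLSH (F (c ^ (1 / (k : ℝ))) (levelRadius c r k x))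
    (c ^ (1 / (k : ℝ))) (levelRadius c r k x) p₁ p₂ ∧ p₂ ^ p.K x ≤ 1 / S.card
  le_mul_L : ∀ x, Λ ≤
    nearProb (F (c ^ (1 / (k : ℝ))) (levelRadius c r k x)) (levelRadius c r k x) ^ p.K x * p.L x
  L_mul_le : ∀ x, (p.L x : ℝ) *
    nearProb (F (c ^ (1 / (k : ℝ))) (levelRadius c r k x)) (levelRadius c r k x) ^ p.K x ≤ Λ + 1
  Λ_nonneg : 0 ≤ Λ
  B_pos : 0 < p.B
  le_B : 2 * (3 * p.Lm + (Λ + 1) * (S.card : ℝ) ^ (1 / (k : ℝ))) ≤ p.B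

variable {S : Finset M} {c r : ℝ} {k R : ℕ} {Λ : ℝ} {p : Layout}

/-- Every near point of every level is found in some table, except for a small probability. -/
theorem GoodLayout.measure_not_covered_le (h : GoodLayout F S c r k R Λ p) (hc : 1 < c)
    (hr : 0 < r) (hk : 1 ≤ k) (hS : S.Nonempty) (q : M) :
    seedsLaw F (c ^ (1 / (k : ℝ))) (levelRadius c r k) {ω | ¬ ∀ x < p.NB,
      ∀ a ∈ ballIn S q (levelRadius c r k x), ∃ t < p.L x,
        ω x t ∈ sameBucket (F (c ^ (1 / (k : ℝ))) (levelRadius c r k x)) (p.K x) q a} ≤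
      ENNReal.ofReal (k * R * S.card * Real.exp (-Λ)) := by
  classical
  have : Nonempty M := ⟨hS.choose⟩
  have hset : {ω : Seeds F (c ^ (1 / (k : ℝ))) (levelRadius c r k) | ¬ ∀ x < p.NB,
      ∀ a ∈ ballIn S q (levelRadius c r k x), ∃ t < p.L x,
        ω x t ∈ sameBucket (F (c ^ (1 / (k : ℝ))) (levelRadius c r k x)) (p.K x) q a} ⊆
      ⋃ x ∈ Finset.range p.NB, {ω | ω x ∈ {τ : ℕ → ℕ → _ | ¬ ∀ a ∈ ballIn S q (levelRadius c r k x),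
        ∃ t < p.L x, τ t ∈ sameBucket (F (c ^ (1 / (k : ℝ))) (levelRadius c r k x)) (p.K x) q a}} := by
    intro ω hω
    simp only [Set.mem_ofPred_eq, not_forall] at hω
    obtain ⟨x, hx, a, ha, h'⟩ := hω
    simp only [Set.mem_iUnion, Finset.mem_range]
    exact ⟨x, hx, fun hcov => h' (hcov a ha)⟩
  refine (measure_mono hset).trans ((measure_biUnion_finset_le _ _).trans ?_)
  have hR : (k : ℝ) * R * S.card * Real.exp (-Λ) = (p.NB : ℝ) * (S.card * Real.exp (-Λ)) := by
    rw [h.NB_eq]; push_cast; ring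
  rw [hR, ENNReal.ofReal_mul (by positivity), ENNReal.ofReal_natCast, ← nsmul_eq_mul]
  refine (Finset.sum_le_card_nsmul _ _ (ENNReal.ofReal (S.card * Real.exp (-Λ))) fun x _ => ?_).trans_eq
    (by rw [Finset.card_range])
  refine (seedsLaw_preimage_le x _).trans ?_
  have hrad : 0 ≤ levelRadius c r k x := hr.le.trans (levelRadius_mem hc hr hk x).1
  have h0 : 0 ≤ nearProb (F (c ^ (1 / (k : ℝ))) (levelRadius c r k x)) (levelRadius c r k x) :=
    le_nearProb hrad fun a b _ => measureReal_nonneg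
  refine (tableLaw_not_covered_le (p.K x) (p.L x) _ q (pow_nonneg h0 (p.K x)) fun a ha =>
    pow_le_pow_left₀ h0 (nearProb_le (Finset.mem_filter.1 ha).2) _).trans ?_
  refine ENNReal.ofReal_le_ofReal (mul_le_mul ?_ ?_ (by positivity) (by positivity))
  · exact_mod_cast Finset.card_le_card (Finset.filter_subset _ _)
  · exact Real.exp_le_exp.2 (neg_le_neg (h.le_mul_L x))

/-- On a level where the balls grow slowly, a block exhausts its budget with probability at most
one half. -/
theorem GoodLayout.lintegral_cost_le (h : GoodLayout F S c r k R Λ p) (hc : 1 < c)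
    (hr : 0 < r) (hk : 1 ≤ k) (hS : S.Nonempty) (q : M) {x : ℕ}
    (hne : (ballIn S q (levelRadius c r k x)).Nonempty)
    (hgrow : ((ballIn S q (c ^ (1 / (k : ℝ)) * levelRadius c r k x)).card : ℝ) ≤
      (S.card : ℝ) ^ (1 / (k : ℝ)) * (ballIn S q (levelRadius c r k x)).card) :
    ∫⁻ τ, tableCost (F (c ^ (1 / (k : ℝ))) (levelRadius c r k x)) (p.K x) (p.L x) S
        (ballIn S q (levelRadius c r k x)) q τ /
          ((p.B : ENNReal) * (ballIn S q (levelRadius c r k x)).card)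
      ∂tableLaw (F (c ^ (1 / (k : ℝ))) (levelRadius c r k x)) ≤ 2⁻¹ := by
  have hrad : 0 ≤ levelRadius c r k x := hr.le.trans (levelRadius_mem hc hr hk x).1
  obtain ⟨p₁, p₂, hlsh, hp₂⟩ := h.lsh x
  have h1 := lintegral_tableCost_ball_le hlsh hrad hS q (K := p.K x) hp₂ (h.L_mul_le x)
  set b := (ballIn S q (levelRadius c r k x)).card
  have hb : 0 < b := hne.card_pos
  have hb1 : (1 : ℝ) ≤ b := by exact_mod_cast hb
  have hLL : (p.L x : ℝ) ≤ p.Lm := by exact_mod_cast h.L_le x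
  simp only [div_eq_mul_inv]
  rw [lintegral_mul_const _ (measurable_tableCost _ _ _ _ _), ← div_eq_mul_inv]
  refine ENNReal.div_le_of_le_mul (h1.trans ?_)
  have h2 : (2⁻¹ : ENNReal) * (p.B * b) = ENNReal.ofReal (2⁻¹ * (p.B * b)) := by
    rw [ENNReal.ofReal_mul (by norm_num), ENNReal.ofReal_mul (by positivity),
      ENNReal.ofReal_natCast, ENNReal.ofReal_natCast, ENNReal.ofReal_inv_of_pos (by norm_num)]
    norm_num
  rw [h2]
  refine ENNReal.ofReal_le_ofReal ?_
  have h3 := mul_le_mul_of_nonneg_left hgrow (show 0 ≤ Λ + 1 by linarith [h.Λ_nonneg])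
  have h4 := mul_le_mul_of_nonneg_right h.le_B (show (0 : ℝ) ≤ b by positivity)
  have h5 : (p.L x : ℝ) * b ≤ p.Lm * b := mul_le_mul_of_nonneg_right hLL (by positivity)
  have h6 : (p.L x : ℝ) ≤ p.L x * b := le_mul_of_one_le_right (by positivity) hb1
  nlinarith

/-- The answer to a fixed query is relaxed fair, except for a small probability over the
preprocessing. -/
theorem GoodLayout.measure_not_relaxedFair_le (h : GoodLayout F S c r k R Λ p) (hc : 1 < c)
    (hr : 0 < r) (hk : 1 ≤ k) (hS : S.Nonempty) (q : M) (d : ℕ) {δ : ℝ} (hδ : 0 < δ) :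
    seedsLaw F (c ^ (1 / (k : ℝ))) (levelRadius c r k) {ω | ¬ RelaxedFairLaw S c r δ q
      (answerLaw queryProg (p.J + 1) d
        (buildData p hS (c ^ (1 / (k : ℝ))) (levelRadius c r k) ω) q)} ≤
      ENNReal.ofReal (k * R * S.card * Real.exp (-Λ)) + 2⁻¹ ^ R / ENNReal.ofReal δ := by
  classical
  have hrads := levelRadius_mem hc hr hk
  set c' := c ^ (1 / (k : ℝ)) with hc'
  have hball : ∀ x, (ballIn S q r).Nonempty → (ballIn S q (levelRadius c r k x)).Nonempty := by
    rintro x ⟨a, ha⟩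
    rw [ballIn, Finset.mem_filter] at ha
    exact ⟨a, by rw [ballIn, Finset.mem_filter]; exact ⟨ha.1, ha.2.trans (hrads x).1⟩⟩
  -- the factors that bound the failure probabilities of the blocks
  let f : (x : ℕ) → (ℕ → ℕ → (F c' (levelRadius c r k x)).Seed) → ENNReal := fun x τ =>
    tableCost (F c' (levelRadius c r k x)) (p.K x) (p.L x) S (ballIn S q (levelRadius c r k x)) q τ /
      ((p.B : ENNReal) * (ballIn S q (levelRadius c r k x)).card)
  -- fairness follows from coverage and from a small product of these factors
  have hfair : ∀ ω : Seeds F c' (levelRadius c r k), ∀ i,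
      (∀ x < p.NB, ∀ a ∈ ballIn S q (levelRadius c r k x), ∃ t < p.L x,
        ω x t ∈ sameBucket (F c' (levelRadius c r k x)) (p.K x) q a) →
      ((ballIn S q r).Nonempty → ∏ x ∈ Finset.range (k * R),
        (if x % k = i then f x (ω x) else 1) ≤ ENNReal.ofReal δ) →
      RelaxedFairLaw S c r δ q (answerLaw queryProg (p.J + 1) d
        (buildData p hS c' (levelRadius c r k) ω) q) := by
    intro ω i hcov hprod
    have hfit : p.Fits (buildData p hS c' (levelRadius c r k) ω) q :=
      fits_buildData h.n_eq (fun x _ => h.L_le x) (fun x _ => h.K_le x) h.bound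
    have hholds : ∀ x < p.NB, p.Holds _ q x S _ _ _ := fun x hx =>
      holds_buildData h.n_eq (fun x _ => h.L_le x) (fun x _ => h.K_le x) hfit hx
    let Bl : ℕ → Finset M := fun x => if x < p.NB then ballIn S q (levelRadius c r k x) else ∅
    have hBl : ∀ x < p.NB, Bl x = ballIn S q (levelRadius c r k x) := fun x hx => if_pos hx
    have hC : ∀ x < p.NB, p.Covered (buildData p hS c' (levelRadius c r k) ω) q x (Bl x) := by
      intro x hx
      rw [hBl x hx]
      exact (hholds x hx).covered (Finset.filter_subset _ _) (hcov x hx)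
    refine relaxedFairLaw_of_fairFrom (hfit.fairFrom_queryProg rfl hC) hBl
      (fun y hy => if_neg (not_lt.2 hy)) (fun y _ => hrads y) fun hne => ?_
    refine (hfit.expect_failInd_le rfl hC h.B_pos (fun x => if x % k = i then f x (ω x) else 1)
      fun x hx => ?_).trans ?_
    · by_cases hxi : x % k = i
      · right
        rw [hBl x hx]
        refine ⟨hball x hne, ?_⟩
        rw [(hholds x hx).sum_cost, if_pos hxi]
        exact le_rfl
      · left
        rw [if_neg hxi]
    · rw [h.NB_eq]
      exact hprod hne
  have hcover := h.measure_not_covered_le hc hr hk hS q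
  rw [← hc'] at hcover
  by_cases hne : (ballIn S q r).Nonempty
  · obtain ⟨i, hi, hgrow⟩ := exists_slow_growth S hc hr hk q hne
    have hf : ∀ x, Measurable (f x) := fun x => (measurable_tableCost _ _ _ _ _).div_const _
    have hfi : ∀ x, x % k = i → ∫⁻ τ, f x τ ∂tableLaw (F c' (levelRadius c r k x)) ≤ 2⁻¹ := by
      intro x hx
      refine h.lintegral_cost_le hc hr hk hS q (hball x hne) ?_
      have hpos : (0 : ℝ) < (ballIn S q (levelRadius c r k x)).card := by
        exact_mod_cast (hball x hne).card_pos
      have he : c ^ (1 / (k : ℝ)) * levelRadius c r k x = r * c ^ (((i : ℝ) + 1) / k) := by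
        rw [levelRadius, hx, add_div, Real.rpow_add (by linarith)]
        ring
      rw [he]
      rw [levelRadius, hx] at hpos ⊢
      rwa [div_le_iff₀ hpos] at hgrow
    have hprod := seedsLaw_prod_gt_le (R := R) hi f hf hfi (δ := ENNReal.ofReal δ)
      (by simpa using hδ) ENNReal.ofReal_ne_top
    refine (measure_mono fun ω hω => ?_).trans
      ((measure_union_le _ _).trans (add_le_add hcover hprod))
    by_contra hcon
    rw [Set.mem_union, not_or] at hcon
    exact hω (hfair ω i (not_not.1 hcon.1) fun _ => not_not.1 hcon.2)
  · refine (measure_mono fun ω hω => ?_).trans (hcover.trans le_self_add)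
    intro hcon
    exact hω (hfair ω 0 hcon fun h => absurd h hne)

/-- The answers to a sequence of queries are relaxed fair, except for a small probability. -/
theorem GoodLayout.solves (h : GoodLayout F S c r k R Λ p) (hc : 1 < c) (hr : 0 < r) (hk : 1 ≤ k)
    (hS : S.Nonempty) (d : ℕ) {δ : ℝ} (hδ : 0 < δ) {Q : ℕ} (hQ : 1 ≤ Q)
    (h1 : k * R * S.card * Real.exp (-Λ) ≤ δ / (2 * Q)) (h2 : (2⁻¹ : ℝ) ^ R ≤ δ ^ 2 / (2 * Q)) :
    SolvesRelaxedFairANN (seedsLaw F (c ^ (1 / (k : ℝ))) (levelRadius c r k))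
      (buildData p hS (c ^ (1 / (k : ℝ))) (levelRadius c r k)) queryProg (p.J + 1) d S c r Q δ := by
  classical
  intro qs hqs
  have hQ0 : (0 : ℝ) < Q := by exact_mod_cast hQ
  have hone : ∀ q : M, seedsLaw F (c ^ (1 / (k : ℝ))) (levelRadius c r k) {ω |
      ¬ RelaxedFairLaw S c r δ q (answerLaw queryProg (p.J + 1) d
        (buildData p hS (c ^ (1 / (k : ℝ))) (levelRadius c r k) ω) q)} ≤
      ENNReal.ofReal (δ / Q) := by
    intro q
    refine (h.measure_not_relaxedFair_le hc hr hk hS q d hδ).trans ?_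
    have e : (2⁻¹ : ENNReal) ^ R / ENNReal.ofReal δ = ENNReal.ofReal ((2⁻¹ : ℝ) ^ R / δ) := by
      rw [ENNReal.ofReal_div_of_pos hδ, ENNReal.ofReal_pow (by norm_num),
        ENNReal.ofReal_inv_of_pos (by norm_num)]
      norm_num
    rw [e, ← ENNReal.ofReal_add (by positivity) (by positivity)]
    refine ENNReal.ofReal_le_ofReal ?_
    have h3 : (2⁻¹ : ℝ) ^ R / δ ≤ δ / (2 * Q) := by
      rw [div_le_iff₀ hδ]
      exact h2.trans_eq (by ring)
    calc _ ≤ δ / (2 * Q) + δ / (2 * Q) := add_le_add h1 h3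
      _ = δ / Q := by field_simp; norm_num
  have hsub : {ω : Seeds F (c ^ (1 / (k : ℝ))) (levelRadius c r k) | ¬ RelaxedFairSession queryProg (p.J + 1) d
      (buildData p hS (c ^ (1 / (k : ℝ))) (levelRadius c r k) ω) S c r δ qs} ⊆
      ⋃ q ∈ qs.toFinset, {ω | ¬ RelaxedFairLaw S c r δ q (answerLaw queryProg (p.J + 1) d
        (buildData p hS (c ^ (1 / (k : ℝ))) (levelRadius c r k) ω) q)} := by
    intro ω hω
    by_contra hcon
    simp only [Set.mem_iUnion, not_exists, List.mem_toFinset] at hcon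
    exact hω (relaxedFairSession_of_forall _ _ _ _ _ _ _ _ _ fun q hq => not_not.1 (hcon q hq))
  refine (measure_mono hsub).trans ((measure_biUnion_finset_le _ _).trans
    ((Finset.sum_le_card_nsmul _ _ _ fun q _ => hone q).trans ?_))
  have hcard : qs.toFinset.card ≤ Q := (List.toFinset_card_le qs).trans hqs
  rw [nsmul_eq_mul, ← ENNReal.ofReal_natCast, ← ENNReal.ofReal_mul (by positivity)]
  refine ENNReal.ofReal_le_ofReal ?_
  have : (qs.toFinset.card : ℝ) ≤ Q := by exact_mod_cast hcard
  calc (qs.toFinset.card : ℝ) * (δ / Q) ≤ Q * (δ / Q) :=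
        mul_le_mul_of_nonneg_right this (by positivity)
    _ = δ := by field_simp

end OneQuery

end Query

namespace Query

/-! ### The choice of the parameters -/

section Parameters

set_option linter.unusedSectionVars false

theorem Layout.queryTime_le {p : Layout} {d : ℕ} {ℓ y z C₀ C₁ C₂ C₃ C₄ : ℝ} (hd : 1 ≤ d)
    (hℓ : 1 ≤ ℓ) (hy : 1 ≤ y) (hyz : y ≤ z) (h₀ : 0 ≤ C₀) (h₁ : 0 ≤ C₁) (h₂ : 0 ≤ C₂) (h₃ : 0 ≤ C₃)
    (h₄ : 0 ≤ C₄) (hNB : (p.NB : ℝ) ≤ C₀ * ℓ) (hLm : (p.Lm : ℝ) ≤ C₁ * (ℓ * y))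
    (hKm : (p.Km : ℝ) ≤ C₂ * ℓ) (hB : (p.B : ℝ) ≤ C₃ * (ℓ * z)) (hJ : (p.J : ℝ) ≤ C₄ * ℓ) :
    (p.queryTime d : ℝ) ≤
      (C₀ * (C₁ * (2 * (C₄ * (6 * C₂ + 16) + 3) + 11) + 20 +
        (6 * C₂ + 4 + 7 + 19 * C₄ + 1 + 30) * (C₃ + 2 * C₁) + 4 * C₃ + 2 + 1) + 16) *
        (d * z * ℓ ^ 4) := by
  have hd' : (1 : ℝ) ≤ d := by exact_mod_cast hd
  have hz : 1 ≤ z := hy.trans hyz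
  have hℓd : 1 ≤ ℓ * d := one_le_mul_of_one_le_of_one_le hℓ hd'
  have hLmz : (p.Lm : ℝ) ≤ C₁ * (ℓ * z) := hLm.trans (by gcongr)
  have hcmp : (p.cmpTime d : ℝ) ≤ (6 * C₂ + 4) * (ℓ * d) := by
    have : (p.cmpTime d : ℝ) = p.Km * (2 * d + 4) + 4 := by simp [Layout.cmpTime]
    rw [this]
    calc (p.Km : ℝ) * (2 * d + 4) + 4 ≤ C₂ * ℓ * (6 * d) + 4 * (ℓ * d) := by
          gcongr <;> linarith
      _ = _ := by ring
  have hsearch : (p.searchTime d : ℝ) ≤ (C₄ * (6 * C₂ + 16) + 3) * (ℓ ^ 2 * d) := by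
    have : (p.searchTime d : ℝ) = p.J * (p.cmpTime d + 12) + 3 := by simp [Layout.searchTime]
    rw [this]
    have h : 1 ≤ ℓ ^ 2 * d := one_le_mul_of_one_le_of_one_le (one_le_pow₀ hℓ) hd'
    calc (p.J : ℝ) * (p.cmpTime d + 12) + 3
        ≤ C₄ * ℓ * ((6 * C₂ + 4) * (ℓ * d) + 12 * (ℓ * d)) + 3 * (ℓ ^ 2 * d) := by
          gcongr <;> linarith
      _ = _ := by ring
  have hsetup : (p.setupTime d : ℝ) ≤
      (C₁ * (2 * (C₄ * (6 * C₂ + 16) + 3) + 11) + 20) * (ℓ ^ 3 * z * d) := by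
    have : (p.setupTime d : ℝ) = p.Lm * (2 * p.searchTime d + 11) + 20 := by
      simp [Layout.setupTime]
    rw [this]
    have h : 1 ≤ ℓ ^ 2 * d := one_le_mul_of_one_le_of_one_le (one_le_pow₀ hℓ) hd'
    have h' : 1 ≤ ℓ ^ 3 * z * d := one_le_mul_of_one_le_of_one_le
      (one_le_mul_of_one_le_of_one_le (one_le_pow₀ hℓ) hz) hd'
    calc (p.Lm : ℝ) * (2 * p.searchTime d + 11) + 20
        ≤ C₁ * (ℓ * z) * (2 * ((C₄ * (6 * C₂ + 16) + 3) * (ℓ ^ 2 * d)) + 11 * (ℓ ^ 2 * d)) +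
          20 * (ℓ ^ 3 * z * d) := by
          gcongr <;> linarith
      _ = _ := by ring
  have htrial : (p.trialTime d : ℝ) ≤ (6 * C₂ + 4 + 7 + 19 * C₄ + 1 + 30) * (ℓ * d) := by
    have : (p.trialTime d : ℝ) = p.cmpTime d + 7 + p.J * 19 + d + 30 := by
      simp [Layout.trialTime, Layout.probeTime]
    rw [this]
    have h1 : (p.J : ℝ) ≤ C₄ * (ℓ * d) := by
      refine hJ.trans ?_
      rw [← mul_assoc]
      exact le_mul_of_one_le_right (by positivity) hd'
    have h2 : (d : ℝ) ≤ ℓ * d := le_mul_of_one_le_left (by positivity) hℓ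
    linarith
  have hblock : (p.blockTime d : ℝ) ≤ (C₁ * (2 * (C₄ * (6 * C₂ + 16) + 3) + 11) + 20 +
      (6 * C₂ + 4 + 7 + 19 * C₄ + 1 + 30) * (C₃ + 2 * C₁) + 4 * C₃ + 2) * (ℓ ^ 3 * z * d) := by
    have : (p.blockTime d : ℝ) =
        p.setupTime d + p.trialTime d * (p.B + 2 * p.Lm) + 4 * p.B + 2 := by
      simp [Layout.blockTime]
    rw [this]
    have h' : 1 ≤ ℓ ^ 3 * z * d := one_le_mul_of_one_le_of_one_le
      (one_le_mul_of_one_le_of_one_le (one_le_pow₀ hℓ) hz) hd'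
    have h1 : ℓ * z ≤ ℓ ^ 3 * z * d := by
      calc ℓ * z = ℓ ^ 1 * z * 1 := by ring
        _ ≤ ℓ ^ 3 * z * d := by gcongr; norm_num
    have h2 : ℓ * d * (ℓ * z) ≤ ℓ ^ 3 * z * d := by
      calc ℓ * d * (ℓ * z) = ℓ ^ 2 * z * d := by ring
        _ ≤ ℓ ^ 3 * z * d := by gcongr; norm_num
    calc (p.setupTime d : ℝ) + p.trialTime d * (p.B + 2 * p.Lm) + 4 * p.B + 2
        ≤ (C₁ * (2 * (C₄ * (6 * C₂ + 16) + 3) + 11) + 20) * (ℓ ^ 3 * z * d) +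
          (6 * C₂ + 4 + 7 + 19 * C₄ + 1 + 30) * (ℓ * d) *
            (C₃ * (ℓ * z) + 2 * (C₁ * (ℓ * z))) + 4 * (C₃ * (ℓ * z)) + 2 * (ℓ ^ 3 * z * d) := by
          gcongr
          linarith
      _ = (C₁ * (2 * (C₄ * (6 * C₂ + 16) + 3) + 11) + 20) * (ℓ ^ 3 * z * d) +
          (6 * C₂ + 4 + 7 + 19 * C₄ + 1 + 30) * (C₃ + 2 * C₁) * (ℓ * d * (ℓ * z)) +
            4 * C₃ * (ℓ * z) + 2 * (ℓ ^ 3 * z * d) := by ring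
      _ ≤ (C₁ * (2 * (C₄ * (6 * C₂ + 16) + 3) + 11) + 20) * (ℓ ^ 3 * z * d) +
          (6 * C₂ + 4 + 7 + 19 * C₄ + 1 + 30) * (C₃ + 2 * C₁) * (ℓ ^ 3 * z * d) +
            4 * C₃ * (ℓ ^ 3 * z * d) + 2 * (ℓ ^ 3 * z * d) := by gcongr
      _ = _ := by ring
  have : (p.queryTime d : ℝ) = p.NB * (p.blockTime d + 1) + 16 := by simp [Layout.queryTime]
  rw [this]
  have h3 : 1 ≤ ℓ ^ 3 * z * d := one_le_mul_of_one_le_of_one_le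
    (one_le_mul_of_one_le_of_one_le (one_le_pow₀ hℓ) hz) hd'
  have h4 : 1 ≤ d * z * ℓ ^ 4 := one_le_mul_of_one_le_of_one_le
    (one_le_mul_of_one_le_of_one_le hd' hz) (one_le_pow₀ hℓ)
  set X := C₁ * (2 * (C₄ * (6 * C₂ + 16) + 3) + 11) + 20 +
      (6 * C₂ + 4 + 7 + 19 * C₄ + 1 + 30) * (C₃ + 2 * C₁) + 4 * C₃ + 2
  calc (p.NB : ℝ) * (p.blockTime d + 1) + 16
      ≤ C₀ * ℓ * (X * (ℓ ^ 3 * z * d) + 1 * (ℓ ^ 3 * z * d)) + 16 * (d * z * ℓ ^ 4) := by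
        gcongr <;> linarith
    _ = _ := by ring

theorem Layout.size_le {p : Layout} {ℓ y C₀ C₁ C₂ : ℝ} (hn : 1 ≤ p.n) (hℓ : 1 ≤ ℓ) (hy : 1 ≤ y)
    (h₀ : 0 ≤ C₀) (h₁ : 0 ≤ C₁) (h₂ : 0 ≤ C₂) (hNB : (p.NB : ℝ) ≤ C₀ * ℓ)
    (hLm : (p.Lm : ℝ) ≤ C₁ * (ℓ * y)) (hKm : (p.Km : ℝ) ≤ C₂ * ℓ) :
    (8 + 3 * p.NB + p.NB * p.Lm * p.n + p.NB * p.Lm * p.Km : ℝ) ≤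
      (8 + 3 * C₀ + C₀ * C₁ + C₀ * C₁ * C₂) * (p.n * y * ℓ ^ 4) := by
  have hn' : (1 : ℝ) ≤ p.n := by exact_mod_cast hn
  have hny : 1 ≤ p.n * y := one_le_mul_of_one_le_of_one_le hn' hy
  have h1 : 1 ≤ p.n * y * ℓ ^ 4 := one_le_mul_of_one_le_of_one_le hny (one_le_pow₀ hℓ)
  have h2 : ℓ ≤ p.n * y * ℓ ^ 4 := by
    calc ℓ = 1 * ℓ ^ 1 := by ring
      _ ≤ p.n * y * ℓ ^ 4 := by gcongr; norm_num
  have h3 : p.n * y * ℓ ^ 2 ≤ p.n * y * ℓ ^ 4 := by gcongr; norm_num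
  have h4 : ℓ ^ 3 * y ≤ p.n * y * ℓ ^ 4 := by
    calc ℓ ^ 3 * y = 1 * y * ℓ ^ 3 := by ring
      _ ≤ p.n * y * ℓ ^ 4 := by gcongr; norm_num
  calc (8 + 3 * p.NB + p.NB * p.Lm * p.n + p.NB * p.Lm * p.Km : ℝ)
      ≤ 8 * (p.n * y * ℓ ^ 4) + 3 * (C₀ * ℓ) + C₀ * ℓ * (C₁ * (ℓ * y)) * p.n +
        C₀ * ℓ * (C₁ * (ℓ * y)) * (C₂ * ℓ) := by
        gcongr; linarith
    _ = 8 * (p.n * y * ℓ ^ 4) + 3 * C₀ * ℓ + C₀ * C₁ * (p.n * y * ℓ ^ 2) +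
        C₀ * C₁ * C₂ * (ℓ ^ 3 * y) := by ring
    _ ≤ 8 * (p.n * y * ℓ ^ 4) + 3 * C₀ * (p.n * y * ℓ ^ 4) + C₀ * C₁ * (p.n * y * ℓ ^ 4) +
        C₀ * C₁ * C₂ * (p.n * y * ℓ ^ 4) := by gcongr
    _ = _ := by ring

/-- All addresses and counters are bounded by a polynomial. -/
theorem Layout.bound_le {p : Layout} {ℓ C₀ C₁ C₂ C₃ : ℝ} (hn : 1 ≤ p.n) (hℓ : 1 ≤ ℓ)
    (h₀ : 0 ≤ C₀) (h₁ : 0 ≤ C₁) (h₂ : 0 ≤ C₂) (h₃ : 0 ≤ C₃) (hNB : (p.NB : ℝ) ≤ C₀ * ℓ)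
    (hLm : (p.Lm : ℝ) ≤ C₁ * (ℓ * p.n)) (hKm : (p.Km : ℝ) ≤ C₂ * ℓ)
    (hB : (p.B : ℝ) ≤ C₃ * (ℓ * p.n)) :
    (p.NB * p.Lm * (p.Km + 1) + p.NB * p.Lm * p.n + p.Km + p.n + 2 * p.Lm + 2 * p.NB + p.B + 110
      : ℝ) ≤ (C₀ * C₁ * (C₂ + 1) + C₀ * C₁ + C₂ + 1 + 2 * C₁ + 2 * C₀ + C₃ + 110) *
        (p.n ^ 2 * ℓ ^ 3) := by
  have hn' : (1 : ℝ) ≤ p.n := by exact_mod_cast hn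
  have h1 : (1 : ℝ) ≤ p.n ^ 2 * ℓ ^ 3 :=
    one_le_mul_of_one_le_of_one_le (one_le_pow₀ hn') (one_le_pow₀ hℓ)
  have hmono : ∀ i j, i ≤ 2 → j ≤ 3 → (p.n : ℝ) ^ i * ℓ ^ j ≤ p.n ^ 2 * ℓ ^ 3 := by
    intro i j hi hj
    gcongr
  have e1 := hmono 1 3 (by norm_num) (by norm_num)
  have e2 := hmono 2 2 (by norm_num) (by norm_num)
  have e3 := hmono 0 1 (by norm_num) (by norm_num)
  have e4 := hmono 1 0 (by norm_num) (by norm_num)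
  have e5 := hmono 1 1 (by norm_num) (by norm_num)
  calc (p.NB * p.Lm * (p.Km + 1) + p.NB * p.Lm * p.n + p.Km + p.n + 2 * p.Lm + 2 * p.NB + p.B + 110
      : ℝ)
      ≤ C₀ * ℓ * (C₁ * (ℓ * p.n)) * (C₂ * ℓ + 1 * ℓ) + C₀ * ℓ * (C₁ * (ℓ * p.n)) * p.n + C₂ * ℓ +
        p.n + 2 * (C₁ * (ℓ * p.n)) + 2 * (C₀ * ℓ) + C₃ * (ℓ * p.n) + 110 * (p.n ^ 2 * ℓ ^ 3) := by
        gcongr <;> linarith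
    _ = C₀ * C₁ * (C₂ + 1) * ((p.n : ℝ) ^ 1 * ℓ ^ 3) + C₀ * C₁ * ((p.n : ℝ) ^ 2 * ℓ ^ 2) +
        C₂ * ((p.n : ℝ) ^ 0 * ℓ ^ 1) + 1 * ((p.n : ℝ) ^ 1 * ℓ ^ 0) +
        2 * C₁ * ((p.n : ℝ) ^ 1 * ℓ ^ 1) + 2 * C₀ * ((p.n : ℝ) ^ 0 * ℓ ^ 1) +
        C₃ * ((p.n : ℝ) ^ 1 * ℓ ^ 1) + 110 * (p.n ^ 2 * ℓ ^ 3) := by ring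
    _ ≤ C₀ * C₁ * (C₂ + 1) * (p.n ^ 2 * ℓ ^ 3) + C₀ * C₁ * (p.n ^ 2 * ℓ ^ 3) +
        C₂ * (p.n ^ 2 * ℓ ^ 3) + 1 * (p.n ^ 2 * ℓ ^ 3) + 2 * C₁ * (p.n ^ 2 * ℓ ^ 3) +
        2 * C₀ * (p.n ^ 2 * ℓ ^ 3) + C₃ * (p.n ^ 2 * ℓ ^ 3) + 110 * (p.n ^ 2 * ℓ ^ 3) := by
        gcongr
    _ = _ := by ring

/-- The word length that is needed for numbers up to a polynomial in `n` and `ℓ`. -/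
theorem log_add_one_le {X n : ℕ} {C ℓ : ℝ} (hn : 1 ≤ n) (hC : 1 ≤ C) (hℓ : 1 ≤ ℓ)
    (hnℓ : Real.log n ≤ ℓ) (hX : (X : ℝ) ≤ C * ((n : ℝ) ^ 2 * ℓ ^ 3)) :
    ((Nat.log 2 X + 1 : ℕ) : ℝ) ≤ (2 * (Real.log C + 5) + 1) * ℓ := by
  have hn' : (0 : ℝ) < n := by exact_mod_cast hn
  have hC0 : 0 ≤ Real.log C := Real.log_nonneg hC
  have hlogℓ : Real.log ℓ ≤ ℓ := (Real.log_le_sub_one_of_pos (by linarith)).trans (by linarith)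
  have h2 : 1 / 2 ≤ Real.log 2 := by linarith [Real.log_two_gt_d9]
  have hle : (Nat.log 2 X : ℝ) * Real.log 2 ≤ Real.log C + 5 * ℓ := by
    rcases Nat.eq_zero_or_pos X with rfl | hpos
    · simp only [Nat.log_zero_right, Nat.cast_zero, zero_mul]
      linarith
    · have h3 : (2 : ℝ) ^ Nat.log 2 X ≤ C * ((n : ℝ) ^ 2 * ℓ ^ 3) :=
        le_trans (by exact_mod_cast Nat.pow_log_le_self 2 hpos.ne') hX
      have h4 := Real.log_le_log (by positivity) h3
      rw [Real.log_pow, Real.log_mul (by linarith) (by positivity),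
        Real.log_mul (by positivity) (by positivity), Real.log_pow, Real.log_pow] at h4
      push_cast at h4
      linarith
  have h5 : (Nat.log 2 X : ℝ) * (1 / 2) ≤ Nat.log 2 X * Real.log 2 := by gcongr
  push_cast
  nlinarith

/-- The number of hash functions per table: far points rarely collide, and near points still
collide with probability at least `A n ^ (-ρ)`. -/
theorem exists_concatenation {p₁ p₂ A θ ρ' : ℝ} {n : ℕ} (hn : 1 ≤ n) (h₂ : 0 < p₂) (h₁₂ : p₂ < p₁)
    (h₁ : p₁ < 1) (hA : A ≤ p₁) (hθ : 0 < θ) (hθ₂ : θ ≤ Real.log (1 / p₂))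
    (hρ : ρ' = Real.log (1 / p₁) / Real.log (1 / p₂)) :
    ∃ K ≤ ⌈Real.log n / θ⌉₊, p₂ ^ K ≤ 1 / n ∧ A / (n : ℝ) ^ ρ' ≤ p₁ ^ K := by
  have hn' : (1 : ℝ) ≤ n := by exact_mod_cast hn
  have hn0 : (0 : ℝ) < n := by linarith
  have hlog : 0 ≤ Real.log n := Real.log_nonneg hn'
  have hp₁ : 0 < p₁ := h₂.trans h₁₂
  have h2 : 0 < Real.log (1 / p₂) := hθ.trans_le hθ₂
  have h1 : 0 < Real.log (1 / p₁) := Real.log_pos (by rw [lt_div_iff₀ hp₁]; linarith)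
  refine ⟨⌈Real.log n / Real.log (1 / p₂)⌉₊, Nat.ceil_mono (by gcongr), ?_, ?_⟩
  · have h3 := Nat.le_ceil (Real.log n / Real.log (1 / p₂))
    rw [div_le_iff₀ h2] at h3
    set K := ⌈Real.log n / Real.log (1 / p₂)⌉₊
    have h5 : Real.log (1 / p₂) = - Real.log p₂ := by rw [one_div, Real.log_inv]
    have h6 : Real.log (1 / (n : ℝ)) = - Real.log n := by rw [one_div, Real.log_inv]
    rw [← Real.log_le_log_iff (by positivity) (by positivity), Real.log_pow, h6]
    rw [h5] at h3
    linarith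
  · have h3 := (Nat.ceil_lt_add_one (a := Real.log n / Real.log (1 / p₂)) (by positivity)).le
    set K := ⌈Real.log n / Real.log (1 / p₂)⌉₊
    refine (div_le_div_of_nonneg_right hA (by positivity)).trans ?_
    rw [← Real.log_le_log_iff (by positivity) (by positivity), Real.log_pow,
      Real.log_div (by positivity) (by positivity), Real.log_rpow hn0, hρ]
    have h4 := mul_le_mul_of_nonneg_right h3 h1.le
    have h5 : Real.log (1 / p₁) = - Real.log p₁ := by rw [one_div, Real.log_inv]
    have h6 : (Real.log n / Real.log (1 / p₂) + 1) * Real.log (1 / p₁) =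
        Real.log (1 / p₁) / Real.log (1 / p₂) * Real.log n + Real.log (1 / p₁) := by
      field_simp
    rw [h6] at h4
    rw [h5] at h4 ⊢
    linarith

end Parameters

end Query

namespace Query

section Choice

set_option linter.unusedSectionVars false

variable {M : Type u} [MetricSpace M] {F : ℝ → ℝ → HashFamily.{u, v} M}

/-- Parameters that meet all requirements. The number of repetitions per level and the exponent `Λ`
of the covering probability are proportional to `ℓ`, the logarithm of the inverse failure
probability; the number of tables is `Λ` over the collision probability of near points. -/
theorem exists_goodLayout {S : Finset M} (hS : S.Nonempty) {c r : ℝ} (hc : 1 < c) (hr : 0 < r)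
    {k : ℕ} (hk : 1 ≤ k) {A θ ρ' ℓ : ℝ} (hA : 0 < A) (hθ : 0 < θ) (hℓ : 1 ≤ ℓ)
    (hnℓ : Real.log S.card ≤ ℓ)
    (hlsh : ∀ x, ∃ p₁ p₂ : ℝ, 0 < p₂ ∧ p₂ < p₁ ∧ p₁ < 1 ∧ A ≤ p₁ ∧ θ ≤ Real.log (1 / p₂) ∧
      ρ' = Real.log (1 / p₁) / Real.log (1 / p₂) ∧
      IsMonotoneLSH (F (c ^ (1 / (k : ℝ))) (levelRadius c r k x)) (c ^ (1 / (k : ℝ)))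
        (levelRadius c r k x) p₁ p₂) {C₀ C₁ C₂ C₃ : ℝ} (hC₀ : C₀ = 4 * k) (hC₁ : C₁ = 9 * k / A + 1)
    (hC₂ : C₂ = 1 / θ + 1) (hC₃ : C₃ = 6 * C₁ + 18 * k + 3) :
    0 ≤ ρ' ∧ ∃ p : Layout, GoodLayout F S c r k ⌈3 * ℓ⌉₊ (9 * k * ℓ) p ∧
      (p.NB : ℝ) ≤ C₀ * ℓ ∧ (p.Lm : ℝ) ≤ C₁ * (ℓ * (S.card : ℝ) ^ ρ') ∧ (p.Km : ℝ) ≤ C₂ * ℓ ∧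
      (p.B : ℝ) ≤ C₃ * (ℓ * (S.card : ℝ) ^ max ρ' (1 / (k : ℝ))) ∧
      (p.J : ℝ) ≤ (2 * (Real.log (C₀ * C₁ * (C₂ + 1) + C₀ * C₁ + C₂ + 1 + 2 * C₁ + 2 * C₀ + C₃ + 110)
        + 5) + 1) * ℓ := by
  have : Nonempty M := ⟨hS.choose⟩
  have hk' : (1 : ℝ) ≤ k := by exact_mod_cast hk
  have hn : 1 ≤ S.card := hS.card_pos
  have hn' : (1 : ℝ) ≤ S.card := by exact_mod_cast hn
  have hn0 : (0 : ℝ) < S.card := by linarith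
  have hlogn : 0 ≤ Real.log S.card := Real.log_nonneg hn'
  have hrad : ∀ x, 0 ≤ levelRadius c r k x := fun x => hr.le.trans (levelRadius_mem hc hr hk x).1
  have hρ : 0 ≤ ρ' ∧ ρ' ≤ 1 := by
    obtain ⟨p₁, p₂, h1, h2, h3, -, h5, rfl, -⟩ := hlsh 0
    have h6 : 0 < Real.log (1 / p₂) := hθ.trans_le h5
    have h7 : 0 < Real.log (1 / p₁) := Real.log_pos (by rw [lt_div_iff₀ (h1.trans h2)]; linarith)
    refine ⟨by positivity, (div_le_one h6).2 (Real.log_le_log (by have := h1.trans h2; positivity) ?_)⟩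
    exact one_div_le_one_div_of_le h1 h2.le
  have h₀ : 0 ≤ C₀ := by rw [hC₀]; positivity
  have h₁ : 0 ≤ C₁ := by rw [hC₁]; positivity
  have h₂ : 0 ≤ C₂ := by rw [hC₂]; positivity
  have h₃ : 0 ≤ C₃ := by rw [hC₃]; positivity
  set y := (S.card : ℝ) ^ ρ' with hy
  set z := (S.card : ℝ) ^ max ρ' (1 / (k : ℝ)) with hz
  have hy1 : 1 ≤ y := Real.one_le_rpow hn' hρ.1
  have hyz : y ≤ z := Real.rpow_le_rpow_of_exponent_le hn' (le_max_left _ _)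
  have hkz : (S.card : ℝ) ^ (1 / (k : ℝ)) ≤ z :=
    Real.rpow_le_rpow_of_exponent_le hn' (le_max_right _ _)
  have hzn : z ≤ S.card := by
    have h1 : max ρ' (1 / (k : ℝ)) ≤ 1 :=
      max_le hρ.2 ((div_le_one (by linarith)).2 hk')
    calc z ≤ (S.card : ℝ) ^ (1 : ℝ) := Real.rpow_le_rpow_of_exponent_le hn' h1
      _ = S.card := Real.rpow_one _
  set Λ := 9 * k * ℓ with hΛ
  have hΛ0 : 0 ≤ Λ := by positivity
  -- hash functions per table
  choose p₁ p₂ hp₂ hp₁₂ hp₁ hAp hθp hρp hmon using hlsh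
  choose K hKm hKfar hKnear using fun x =>
    exists_concatenation hn (hp₂ x) (hp₁₂ x) (hp₁ x) (hAp x) hθ (hθp x) (hρp x)
  set π : ℕ → ℝ := fun x =>
    nearProb (F (c ^ (1 / (k : ℝ))) (levelRadius c r k x)) (levelRadius c r k x) ^ K x with hπ
  have hπA : ∀ x, A / y ≤ π x := fun x => (hKnear x).trans
    (pow_le_pow_left₀ ((hp₂ x).trans (hp₁₂ x)).le (le_nearProb (hrad x) (hmon x).near) _)
  have hπ0 : ∀ x, 0 < π x := fun x => lt_of_lt_of_le (by positivity) (hπA x)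
  have hπ1 : ∀ x, π x ≤ 1 := fun x => pow_le_one₀
    (le_nearProb (hrad x) fun a b _ => measureReal_nonneg) (nearProb_le_one (hrad x))
  -- sizes
  set R := ⌈3 * ℓ⌉₊ with hR
  set Lm := ⌈Λ * y / A⌉₊ with hLm
  set Km := ⌈Real.log S.card / θ⌉₊ with hKmdef
  set B := ⌈2 * (3 * Lm + (Λ + 1) * (S.card : ℝ) ^ (1 / (k : ℝ)))⌉₊ with hB
  set X := k * R * Lm * (Km + 1) + k * R * Lm * S.card + Km + S.card + 2 * Lm + 2 * (k * R) + B + 110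
    with hX
  have bR : (R : ℝ) ≤ 4 * ℓ := by
    have := (Nat.ceil_lt_add_one (a := 3 * ℓ) (by positivity)).le
    linarith
  have bNB : ((k * R : ℕ) : ℝ) ≤ C₀ * ℓ := by
    push_cast
    rw [hC₀]
    nlinarith
  have hℓy : 1 ≤ ℓ * y := one_le_mul_of_one_le_of_one_le hℓ hy1
  have hℓz : 1 ≤ ℓ * z := one_le_mul_of_one_le_of_one_le hℓ (hy1.trans hyz)
  have bLm : (Lm : ℝ) ≤ C₁ * (ℓ * y) := by
    have h1 := (Nat.ceil_lt_add_one (a := Λ * y / A) (by positivity)).le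
    have h2 : Λ * y / A = 9 * k / A * (ℓ * y) := by rw [hΛ]; ring
    rw [hC₁, add_mul, one_mul, ← h2]
    linarith
  have bKm : (Km : ℝ) ≤ C₂ * ℓ := by
    have h1 := (Nat.ceil_lt_add_one (a := Real.log S.card / θ) (by positivity)).le
    have h2 : Real.log S.card / θ ≤ 1 / θ * ℓ := by
      rw [one_div_mul_eq_div]
      exact div_le_div_of_nonneg_right hnℓ hθ.le
    rw [hC₂, add_mul, one_mul]
    linarith
  have bB : (B : ℝ) ≤ C₃ * (ℓ * z) := by
    have h1 := (Nat.ceil_lt_add_one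
      (a := 2 * (3 * Lm + (Λ + 1) * (S.card : ℝ) ^ (1 / (k : ℝ)))) (by positivity)).le
    have h2 : C₁ * (ℓ * y) ≤ C₁ * (ℓ * z) := by gcongr
    have h3 : (Λ + 1) * (S.card : ℝ) ^ (1 / (k : ℝ)) ≤ (9 * k * ℓ + ℓ) * z := by
      rw [hΛ]; gcongr
    have h4 : C₃ * (ℓ * z) = 6 * (C₁ * (ℓ * z)) + 2 * ((9 * k * ℓ + ℓ) * z) + ℓ * z := by
      rw [hC₃]; ring
    rw [h4]
    linarith
  refine ⟨hρ.1, ⟨k * R, S.card, Nat.log 2 X + 1, B, Lm, Km, fun x => ⌈Λ / π x⌉₊, K⟩,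
    ⟨rfl, rfl, fun x => ?_, hKm, Nat.lt_pow_succ_log_self (by norm_num) X,
      fun x => ⟨_, _, hmon x, hKfar x⟩, fun x => ?_, fun x => ?_, hΛ0, ?_, Nat.le_ceil _⟩,
    bNB, bLm, bKm, bB, ?_⟩
  · refine Nat.ceil_mono ?_
    calc Λ / π x ≤ Λ / (A / y) := div_le_div_of_nonneg_left hΛ0 (by positivity) (hπA x)
      _ = Λ * y / A := by rw [div_div_eq_mul_div]
  · have h1 := Nat.le_ceil (Λ / π x)
    rw [div_le_iff₀ (hπ0 x)] at h1
    linarith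
  · have h1 := (Nat.ceil_lt_add_one (a := Λ / π x) (div_nonneg hΛ0 (hπ0 x).le)).le
    calc (⌈Λ / π x⌉₊ : ℝ) * π x ≤ (Λ / π x + 1) * π x :=
          mul_le_mul_of_nonneg_right h1 (hπ0 x).le
      _ = Λ + π x := by have := (hπ0 x).ne'; field_simp
      _ ≤ Λ + 1 := by linarith [hπ1 x]
  · exact Nat.ceil_pos.2 (by positivity)
  · refine log_add_one_le hn ?_ hℓ hnℓ ?_
    · have : 0 ≤ C₀ * C₁ * (C₂ + 1) + C₀ * C₁ + C₂ + 2 * C₁ + 2 * C₀ + C₃ := by positivity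
      linarith
    · have := Layout.bound_le
        (p := ⟨k * R, S.card, 0, B, Lm, Km, fun _ => 0, fun _ => 0⟩) hn hℓ h₀ h₁ h₂ h₃ bNB
        (bLm.trans (by gcongr; exact hyz.trans hzn)) bKm (bB.trans (by gcongr))
      refine le_trans (le_of_eq ?_) this
      rw [hX]
      push_cast
      ring

/-- The numerical requirements of `GoodLayout.solves`: half of the failure probability `δ / Q` of a
query is left for points that are not covered, and half for a conditional failure probability above
`δ`, where Markov's inequality costs the second factor `δ`. -/
theorem failure_bounds {n Q k : ℕ} {δ ℓ : ℝ} (hn : 1 ≤ n) (hQ : 1 ≤ Q) (hk : 1 ≤ k) (hδ : 0 < δ)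
    (hℓ : 1 ≤ ℓ) (hℓ' : ℓ = 1 + Real.log (n * Q / δ)) :
    k * ⌈3 * ℓ⌉₊ * n * Real.exp (-(9 * k * ℓ)) ≤ δ / (2 * Q) ∧
      (2⁻¹ : ℝ) ^ ⌈3 * ℓ⌉₊ ≤ δ ^ 2 / (2 * Q) := by
  have hn' : (1 : ℝ) ≤ n := by exact_mod_cast hn
  have hQ' : (1 : ℝ) ≤ Q := by exact_mod_cast hQ
  have hk' : (1 : ℝ) ≤ k := by exact_mod_cast hk
  have hexp : Real.exp (-ℓ) = Real.exp (-1) * (δ / (n * Q)) := by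
    rw [hℓ', neg_add, Real.exp_add, Real.exp_neg (Real.log _), Real.exp_log (by positivity), inv_div]
  have he1 : Real.exp (-1) ≤ 1 / 2 := by
    rw [Real.exp_neg, ← one_div]
    exact one_div_le_one_div_of_le (by norm_num) (by linarith [Real.add_one_le_exp (1 : ℝ)])
  constructor
  · have h1 : (⌈3 * ℓ⌉₊ : ℝ) ≤ 4 * ℓ := by
      have := (Nat.ceil_lt_add_one (a := 3 * ℓ) (by positivity)).le
      linarith
    have h2 : Real.exp (-(9 * k * ℓ)) ≤ δ / (n * Q) * (1 / (8 * k * ℓ)) := by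
      have h3 : Real.exp (-(8 * k * ℓ)) ≤ 1 / (8 * k * ℓ) := by
        rw [Real.exp_neg, ← one_div]
        exact one_div_le_one_div_of_le (by positivity)
          (by linarith [Real.add_one_le_exp (8 * k * ℓ)])
      have h4 : Real.exp (-ℓ) ≤ δ / (n * Q) := by
        rw [hexp]
        exact mul_le_of_le_one_left (by positivity) (by linarith)
      calc Real.exp (-(9 * k * ℓ)) ≤ Real.exp (-ℓ + -(8 * k * ℓ)) := by
            refine Real.exp_le_exp.2 ?_
            nlinarith
        _ = Real.exp (-ℓ) * Real.exp (-(8 * k * ℓ)) := Real.exp_add _ _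
        _ ≤ _ := by gcongr
    calc (k : ℝ) * ⌈3 * ℓ⌉₊ * n * Real.exp (-(9 * k * ℓ))
        ≤ k * (4 * ℓ) * n * (δ / (n * Q) * (1 / (8 * k * ℓ))) := by gcongr
      _ = δ / (2 * Q) := by field_simp; norm_num
  · have h1 : (2⁻¹ : ℝ) ^ ⌈3 * ℓ⌉₊ ≤ Real.exp (-ℓ) ^ 2 := by
      have h2 := Nat.le_ceil (3 * ℓ)
      have h3 : (2⁻¹ : ℝ) = Real.exp (-Real.log 2) := by
        rw [Real.exp_neg, Real.exp_log (by norm_num)]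
      rw [h3, ← Real.exp_nat_mul, ← Real.exp_nat_mul]
      refine Real.exp_le_exp.2 ?_
      push_cast
      have h4 := Real.log_two_gt_d9
      nlinarith
    refine h1.trans ?_
    have h5 : Real.exp (-ℓ) ≤ 1 / 2 * (δ / Q) := by
      rw [hexp]
      have : δ / (n * Q) ≤ δ / Q := by
        gcongr
        exact le_mul_of_one_le_left (by positivity) hn'
      gcongr
    calc Real.exp (-ℓ) ^ 2 ≤ (1 / 2 * (δ / Q)) ^ 2 := by gcongr
      _ = δ ^ 2 / (2 * Q) * (1 / (2 * Q)) := by field_simp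
      _ ≤ δ ^ 2 / (2 * Q) * 1 := by
          gcongr
          rw [div_le_one (by positivity)]
          linarith
      _ = _ := mul_one _

end Choice

end Query

theorem mainTheorem6 (c : ℝ) (hc : 1 < c) (ρ a b : ℝ → ℝ)
    (ha : ∀ c' ∈ Set.Ioc 1 c, 0 < a c') (hb : ∀ c' ∈ Set.Ioc 1 c, b c' < 1)
    (k : ℕ) (hk : 1 ≤ k) (β : ℝ) (hβ : β = max (ρ (c ^ (1 / (k : ℝ)))) (1 / (k : ℝ)))
    (hmin : ∀ j : ℕ, 1 ≤ j → β ≤ max (ρ (c ^ (1 / (j : ℝ)))) (1 / (j : ℝ))) :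
    ∃ (P : Prog) (C : ℝ) (e : ℕ),
      ∀ (M : Type u) [MetricSpace M] (d : ℕ) (r : ℝ) (F : ℝ → ℝ → HashFamily.{u, v} M),
        1 ≤ d → 0 < r → LSHEquipped F c r ρ a b →
      ∀ (S : Finset M) (n : ℕ), S.Nonempty → n = S.card →
        (∀ q : M, (ballIn S q r).Nonempty → ∃ i < k,
          ((ballIn S q (r * c ^ (((i : ℝ) + 1) / k))).card : ℝ) /
            ((ballIn S q (r * c ^ ((i : ℝ) / k))).card : ℝ) ≤ (n : ℝ) ^ (1 / (k : ℝ))) ∧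
        ∀ (Q : ℕ) (δ : ℝ), 1 ≤ Q → 0 < δ → δ < 1 →
          ∃ (w : ℕ) (Ω : Type v) (_ : MeasurableSpace Ω) (μ : Measure Ω)
            (_ : IsProbabilityMeasure μ) (D : Ω → DataStructure F),
            SolvesRelaxedFairANN μ D P w d S c r Q δ ∧
            (w : ℝ) ≤ C * (1 + Real.log (n * Q / δ)) ∧
            (∀ ω, ∀ x ∈ (D ω).words, x < 2 ^ w) ∧
            (∀ ω, ((D ω).size : ℝ) ≤
              C * (n : ℝ) ^ (1 + ρ (c ^ (1 / (k : ℝ)))) * (1 + Real.log (n * Q / δ)) ^ e) ∧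
            (∀ ω (q : M), ∀ x ∈ (P.run w d (D ω) q).support,
              (x.2 : ℝ) ≤ C * d * (n : ℝ) ^ β * (1 + Real.log (n * Q / δ)) ^ e) := by
  have hk0 : (0 : ℝ) < k := by exact_mod_cast hk
  set c' := c ^ (1 / (k : ℝ)) with hc'
  have hmem : c' ∈ Set.Ioc 1 c := by
    refine ⟨Real.one_lt_rpow hc (by positivity), ?_⟩
    calc c' ≤ c ^ (1 : ℝ) := Real.rpow_le_rpow_of_exponent_le hc.le
          ((div_le_one hk0).2 (by exact_mod_cast hk))
      _ = c := Real.rpow_one c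
  have hA := ha c' hmem
  -- `b c'` need not be positive when no metric space is equipped with hash families
  set b' := max (b c') (1 / 2) with hb'
  have hb0 : 0 < b' := lt_max_of_lt_right (by norm_num)
  have hb1 : b' < 1 := max_lt (hb c' hmem) (by norm_num)
  set θ := Real.log (1 / b') with hθ
  have hθ0 : 0 < θ := Real.log_pos (by rw [lt_div_iff₀ hb0]; linarith)
  obtain ⟨C₀, hC₀⟩ : ∃ C₀ : ℝ, C₀ = 4 * k := ⟨_, rfl⟩
  obtain ⟨C₁, hC₁⟩ : ∃ C₁ : ℝ, C₁ = 9 * k / a c' + 1 := ⟨_, rfl⟩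
  obtain ⟨C₂, hC₂⟩ : ∃ C₂ : ℝ, C₂ = 1 / θ + 1 := ⟨_, rfl⟩
  obtain ⟨C₃, hC₃⟩ : ∃ C₃ : ℝ, C₃ = 6 * C₁ + 18 * k + 3 := ⟨_, rfl⟩
  obtain ⟨C₄, hC₄⟩ : ∃ C₄ : ℝ, C₄ = 2 * (Real.log (C₀ * C₁ * (C₂ + 1) + C₀ * C₁ + C₂ + 1 +
    2 * C₁ + 2 * C₀ + C₃ + 110) + 5) + 1 := ⟨_, rfl⟩
  have h₀ : 0 ≤ C₀ := by rw [hC₀]; positivity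
  have h₁ : 0 ≤ C₁ := by rw [hC₁]; positivity
  have h₂ : 0 ≤ C₂ := by rw [hC₂]; positivity
  have h₃ : 0 ≤ C₃ := by rw [hC₃]; positivity
  have h₄ : 0 ≤ C₄ := by
    have h : 0 ≤ C₀ * C₁ * (C₂ + 1) + C₀ * C₁ + C₂ + 2 * C₁ + 2 * C₀ + C₃ := by positivity
    have := Real.log_nonneg (show 1 ≤ C₀ * C₁ * (C₂ + 1) + C₀ * C₁ + C₂ + 1 + 2 * C₁ + 2 * C₀ +
      C₃ + 110 by linarith)
    rw [hC₄]; linarith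
  -- the constants for the space and for the query time
  obtain ⟨Cs, hCs⟩ : ∃ Cs : ℝ, Cs = 8 + 3 * C₀ + C₀ * C₁ + C₀ * C₁ * C₂ := ⟨_, rfl⟩
  obtain ⟨Ct, hCt⟩ : ∃ Ct : ℝ, Ct = C₀ * (C₁ * (2 * (C₄ * (6 * C₂ + 16) + 3) + 11) + 20 +
    (6 * C₂ + 4 + 7 + 19 * C₄ + 1 + 30) * (C₃ + 2 * C₁) + 4 * C₃ + 2 + 1) + 16 := ⟨_, rfl⟩
  have hs : 0 ≤ Cs := by rw [hCs]; positivity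
  have ht : 0 ≤ Ct := by rw [hCt]; positivity
  refine ⟨Query.queryProg, C₄ + 1 + Cs + Ct, 4, ?_⟩
  intro M _ d r F hd hr hF S n hS hn
  subst hn
  refine ⟨fun q hq => exists_slow_growth S hc hr hk q hq, fun Q δ hQ hδ hδ1 => ?_⟩
  have hn' : (1 : ℝ) ≤ S.card := by exact_mod_cast hS.card_pos
  have hn0 : (0 : ℝ) < S.card := by linarith
  have hQ' : (1 : ℝ) ≤ Q := by exact_mod_cast hQ
  obtain ⟨ℓ, hℓ⟩ : ∃ ℓ, ℓ = 1 + Real.log (S.card * Q / δ) := ⟨_, rfl⟩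
  have hnle : (S.card : ℝ) ≤ S.card * Q / δ := by
    rw [le_div_iff₀ hδ]
    nlinarith
  have hlog : Real.log S.card ≤ Real.log (S.card * Q / δ) := Real.log_le_log hn0 hnle
  have hℓ1 : 1 ≤ ℓ := by linarith [Real.log_nonneg hn']
  obtain ⟨hρ0, p, hp, bNB, bLm, bKm, bB, bJ⟩ := Query.exists_goodLayout (F := F) (ρ' := ρ c') hS hc
    hr hk hA hθ0 hℓ1 (by linarith) (fun x => by
      obtain ⟨p₁, p₂, h1, h2, h3, h4, h5, h6, h7⟩ :=
        hF c' hmem _ (Query.levelRadius_mem hc hr hk x)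
      exact ⟨p₁, p₂, h1, h2, h3, h4, Real.log_le_log (by positivity)
        (one_div_le_one_div_of_le h1 (h5.trans (le_max_left _ _))), h6, h7⟩) hC₀ hC₁ hC₂ hC₃
  rw [← hC₄] at bJ
  rw [← hβ] at bB
  have hpn : 1 ≤ p.n := hp.n_eq ▸ hS.card_pos
  obtain ⟨hf1, hf2⟩ := Query.failure_bounds hS.card_pos hQ hk hδ hℓ1 hℓ
  rw [← hℓ]
  refine ⟨p.J + 1, Query.Seeds F c' (Query.levelRadius c r k), inferInstance,
    Query.seedsLaw F c' (Query.levelRadius c r k), inferInstance,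
    Query.buildData p hS c' (Query.levelRadius c r k),
    hp.solves hc hr hk hS d hδ hQ hf1 hf2, ?_, fun ω => ?_, fun ω => ?_, fun ω q x hx => ?_⟩
  · have h1 : ((p.J + 1 : ℕ) : ℝ) ≤ C₄ * ℓ + 1 * ℓ := by push_cast; linarith
    rw [← add_mul] at h1
    exact h1.trans (mul_le_mul_of_nonneg_right (by linarith) (by linarith))
  · exact Query.words_buildData_lt (fun x _ => hp.L_le x) (fun x _ => hp.K_le x) hp.bound
  · have h1 := Query.Layout.size_le hpn hℓ1 (Real.one_le_rpow hn' hρ0) h₀ h₁ h₂ bNB bLm bKm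
    rw [← hCs] at h1
    rw [Query.size_buildData, Real.rpow_add hn0, Real.rpow_one]
    push_cast
    rw [hp.n_eq] at h1 ⊢
    refine h1.trans ?_
    have h2 : 0 ≤ (S.card : ℝ) * (S.card : ℝ) ^ ρ c' * ℓ ^ 4 := by positivity
    have h3 : Cs ≤ C₄ + 1 + Cs + Ct := by linarith
    rw [mul_assoc (C₄ + 1 + Cs + Ct)]
    exact mul_le_mul_of_nonneg_right h3 h2
  · have hfit : p.Fits (Query.buildData p hS c' (Query.levelRadius c r k) ω) q :=
      Query.fits_buildData hp.n_eq (fun x _ => hp.L_le x) (fun x _ => hp.K_le x) hp.bound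
    have h1 : (x.2 : ℝ) ≤ p.queryTime d := by exact_mod_cast hfit.steps_le rfl x hx
    have h2 := Query.Layout.queryTime_le (z := (S.card : ℝ) ^ β) hd hℓ1 (Real.one_le_rpow hn' hρ0)
      (Real.rpow_le_rpow_of_exponent_le hn' (by rw [hβ]; exact le_max_left _ _)) h₀ h₁ h₂ h₃ h₄
      bNB bLm bKm bB bJ
    rw [← hCt] at h2
    refine (h1.trans h2).trans ?_
    have h3 : 0 ≤ (d : ℝ) * (S.card : ℝ) ^ β * ℓ ^ 4 := by positivity
    have h4 : Ct ≤ C₄ + 1 + Cs + Ct := by linarith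
    rw [mul_assoc (C₄ + 1 + Cs + Ct), mul_assoc (C₄ + 1 + Cs + Ct)]
    exact mul_le_mul_of_nonneg_right h4 h3
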